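/- Let $d$ be a natural number, $\delta\in(0,1)$, and let $a^{ij}=a^{ij}(t)$, $i,j=1,\dots,d$, be bounded measurable functions of $t\in\mathbb R$ only, satisfying $\delta|\xi|^2\le \sum_{i,j}a^{ij}(t)\xi_i\xi_j\le\delta^{-1}|\xi|^2$ for all $t\in\mathbb R$, $\xi\in\mathbb R^d$. Write $X=(t,x,y,z)\in\mathbb R\times\mathbb R^d\times\mathbb R^d\times\mathbb R^d$ and $$P_0u=\partial_tu-x\cdot\nabla_yu-y\cdot\nabla_zu-\sum_{i,j=1}^d a^{ij}(t)\,\partial_{x_ix_j}u .$$ For real numbers $S<T$ put $G=(S,T)\times\mathbb R^{3d}$, and let $S^2(G)$ be the set of real-valued $u\in L^2(G)$ whose distributional derivatives $\nabla_xu$, $\nabla_x^2u$ and $\partial_tu-x\cdot\nabla_yu-y\cdot\nabla_zu$ (the last one taken as a whole) belong to $L^2(G)$. For $s\in(0,1/2)$ the operators $(-\Delta_y)^s$, $(-\Delta_z)^s$ act on $u\in L^2(G)$ in the sense of distributions, i.e. $\langle(-\Delta_y)^su,\phi\rangle=\int_G u\,(-\Delta_y)^s\phi\,dX$ for $\phi\in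 C_0^\infty(G)$, where $$(-\Delta_y)^s\phi(t,x,y,z)=c_{s,d}\int_{\mathbb R^d}\frac{\phi(t,x,y,z)-\phi(t,x,y-w,z)}{|w|^{d+2s}}\,dw,\qquad c_{s,d}=\frac{4^s\,\Gamma(d/2+s)}{\pi^{d/2}|\Gamma(-s)|},$$ and similarly in $z$. Then for every $f\in L^2(G)$ the Cauchy problem $$P_0u=f\ \text{ a.e. in } G,\qquad u(S,\cdot)=0 \text{ in } \mathbb R^{3d},$$ has a unique solution $u\in S^2(G)$ (up to equality a.e.), where the initial condition means that $u(t,\cdot)\to0$ in $L^2(\mathbb R^{3d})$ as $t\downarrow S$ (outside a null set of times $t$). Moreover the distributions $\nabla_x(-\Delta_y)^{1/6}u$, $(-\Delta_y)^{1/3}u$ and $(-\Delta_z)^{1/5}u$ belong to $L^2(G)$, and $$\|u\|+\|\nabla_xu\|+\|\nabla_x(-\Delta_y)^{1/6}u\|+\|\nabla_x^2u\|+\|(-\Delta_y)^{1/3}u\|+\|(-\Delta_z)^{1/5}u\|+\|\partial_tu-x\cdot\nabla_yu-y\cdot\nabla_zu\|\le N\|f\|,$$ where all norms are those of $L^2(G)$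 and the constant $N$ depends only on $d$, $\delta$ and $T-S$. -/

import Mathlib

open MeasureTheory Filter Topology
open scoped ENNReal NNReal ContDiff

noncomputable section

namespace KFP

/-- `ℝ^d` with its Euclidean norm. -/
abbrev E (d : ℕ) : Type := EuclideanSpace ℝ (Fin d)

/-- Points `X = (t, x, y, z)` of `ℝ^{1+3d}`. -/
abbrev Pt (d : ℕ) : Type := ℝ × E d × E d × E d

/-- The slab `(S, T) × ℝ^{3d}`. -/
def slab (d : ℕ) (S T : ℝ) : Set (Pt d) := Set.Ioo S T ×ˢ Set.univ

/-- `φ ∈ C_0^∞(G)`. -/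
structure IsTest {d : ℕ} (G : Set (Pt d)) (φ : Pt d → ℝ) : Prop where
  smooth : ContDiff ℝ ∞ φ
  compact : HasCompactSupport φ
  support : tsupport φ ⊆ G

/-- The classical derivative `∂φ/∂x_i`. -/
def dX {d : ℕ} (i : Fin d) (φ : Pt d → ℝ) : Pt d → ℝ :=
  fun X => fderiv ℝ φ X (0, EuclideanSpace.single i 1, 0, 0)

/-- The classical transport derivative `∂_t φ - x · ∇_y φ - y · ∇_z φ`. -/
def transport {d : ℕ} (φ : Pt d → ℝ) : Pt d → ℝ :=
  fun X => fderiv ℝ φ X (1, 0, 0, 0) - fderiv ℝ φ X (0, 0, X.2.1, 0)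
    - fderiv ℝ φ X (0, 0, 0, X.2.2.1)

/-- The normalizing constant of the fractional Laplacian `(-Δ)^s` on `ℝ^d`, `0 < s < 1`. -/
def fracConst (d : ℕ) (s : ℝ) : ℝ :=
  4 ^ s * Real.Gamma ((d : ℝ) / 2 + s) / (Real.pi ^ ((d : ℝ) / 2) * |Real.Gamma (-s)|)

/-- `(-Δ_y)^s φ`; for `0 < s < 1/2` and bounded Lipschitz `φ` the integral converges absolutely. -/
def fracLapY {d : ℕ} (s : ℝ) (φ : Pt d → ℝ) : Pt d → ℝ :=
  fun X => fracConst d s * ∫ w : E d,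
    (φ X - φ (X.1, X.2.1, X.2.2.1 - w, X.2.2.2)) / ‖w‖ ^ ((d : ℝ) + 2 * s)

/-- `(-Δ_z)^s φ`; for `0 < s < 1/2` and bounded Lipschitz `φ` the integral converges absolutely. -/
def fracLapZ {d : ℕ} (s : ℝ) (φ : Pt d → ℝ) : Pt d → ℝ :=
  fun X => fracConst d s * ∫ w : E d,
    (φ X - φ (X.1, X.2.1, X.2.2.1, X.2.2.2 - w)) / ‖w‖ ^ ((d : ℝ) + 2 * s)

/-- `g ∈ L²(G)` is the distributional gradient `∇_x u` on `G`. -/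
def IsGradX {d : ℕ} (G : Set (Pt d)) (u : Pt d → ℝ) (g : Pt d → E d) : Prop :=
  MemLp g 2 (volume.restrict G) ∧ ∀ (i : Fin d) (φ : Pt d → ℝ), IsTest G φ →
    ∫ X in G, g X i * φ X = -∫ X in G, u X * dX i φ X

/-- `h ∈ L²(G)` is the distributional Hessian `∇_x² u` on `G`
(as a vector indexed by pairs, so that the norm is the Frobenius norm). -/
def IsHessX {d : ℕ} (G : Set (Pt d)) (u : Pt d → ℝ)
    (h : Pt d → EuclideanSpace ℝ (Fin d × Fin d)) : Prop :=
  MemLp h 2 (volume.restrict G) ∧ ∀ (i j : Fin d) (φ : Pt d → ℝ), IsTest G φ →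
    ∫ X in G, h X (i, j) * φ X = ∫ X in G, u X * dX i (dX j φ) X

/-- `g ∈ L²(G)` is the distribution `∂_t u - x · ∇_y u - y · ∇_z u` on `G`. -/
def IsTransport {d : ℕ} (G : Set (Pt d)) (u g : Pt d → ℝ) : Prop :=
  MemLp g 2 (volume.restrict G) ∧ ∀ φ : Pt d → ℝ, IsTest G φ →
    ∫ X in G, g X * φ X = -∫ X in G, u X * transport φ X

/-- `g ∈ L²(G)` is the distribution `(-Δ_y)^s u` on `G`. The operator is nonlocal in `y`,
so this is used on sets `G` that are unbounded cylinders in the `y` direction. -/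
def IsFracLapY {d : ℕ} (s : ℝ) (G : Set (Pt d)) (u g : Pt d → ℝ) : Prop :=
  MemLp g 2 (volume.restrict G) ∧ ∀ φ : Pt d → ℝ, IsTest G φ →
    ∫ X in G, g X * φ X = ∫ X in G, u X * fracLapY s φ X

/-- `g ∈ L²(G)` is the distribution `(-Δ_z)^s u` on `G`. -/
def IsFracLapZ {d : ℕ} (s : ℝ) (G : Set (Pt d)) (u g : Pt d → ℝ) : Prop :=
  MemLp g 2 (volume.restrict G) ∧ ∀ φ : Pt d → ℝ, IsTest G φ →
    ∫ X in G, g X * φ X = ∫ X in G, u X * fracLapZ s φ X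

/-- `g ∈ L²(G)` is the distribution `∇_x (-Δ_y)^s u` on `G`. -/
def IsGradXFracLapY {d : ℕ} (s : ℝ) (G : Set (Pt d)) (u : Pt d → ℝ) (g : Pt d → E d) : Prop :=
  MemLp g 2 (volume.restrict G) ∧ ∀ (i : Fin d) (φ : Pt d → ℝ), IsTest G φ →
    ∫ X in G, g X i * φ X = -∫ X in G, u X * fracLapY s (dX i φ) X

/-- `u ∈ S²(G)`: `u`, `∇_x u`, `∇_x² u` and `∂_t u - x · ∇_y u - y · ∇_z u` are in `L²(G)`. -/
structure MemS2 {d : ℕ} (G : Set (Pt d)) (u : Pt d → ℝ) : Prop where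
  memLp : MemLp u 2 (volume.restrict G)
  grad : ∃ g, IsGradX G u g
  hess : ∃ h, IsHessX G u h
  transp : ∃ g, IsTransport G u g

/-- `P₀ u = f` a.e. in `G`, where `P₀ = ∂_t - x · ∇_y - y · ∇_z - ∑ a^{ij}(t) ∂_{x_i x_j}` and the
derivatives are the distributional ones. -/
def SolvesP0 {d : ℕ} (a : ℝ → Matrix (Fin d) (Fin d) ℝ) (G : Set (Pt d))
    (u f : Pt d → ℝ) : Prop :=
  ∃ (h : Pt d → EuclideanSpace ℝ (Fin d × Fin d)) (g : Pt d → ℝ),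
    IsHessX G u h ∧ IsTransport G u g ∧
    ∀ᵐ X ∂(volume.restrict G), g X - ∑ i, ∑ j, a X.1 i j * h X (i, j) = f X

/-- `u(S, ·) = 0`: `u(t, ·) → 0` in `L²(ℝ^{3d})` as `t ↓ S`, outside a null set of times
(`u` is only defined up to null sets). -/
def ZeroInitial {d : ℕ} (S : ℝ) (u : Pt d → ℝ) : Prop :=
  Tendsto (fun t : ℝ => eLpNorm (fun p : E d × E d × E d => u (t, p)) 2 volume)
    (𝓝[>] S ⊓ ae volume) (𝓝 0)

/-- `u ∈ S²((S,T) × ℝ^{3d})` solves `P₀ u = f` in `(S,T) × ℝ^{3d}`, `u(S, ·) = 0`. -/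
structure IsCauchySolution {d : ℕ} (a : ℝ → Matrix (Fin d) (Fin d) ℝ) (S T : ℝ)
    (f u : Pt d → ℝ) : Prop where
  memS2 : MemS2 (slab d S T) u
  equation : SolvesP0 a (slab d S T) u f
  initial : ZeroInitial S u

/-- Bounded (Lebesgue) measurable coefficients, depending on `t` only, with
`δ |ξ|² ≤ a^{ij}(t) ξ_i ξ_j ≤ δ⁻¹ |ξ|²`. -/
structure IsElliptic {d : ℕ} (δ : ℝ) (a : ℝ → Matrix (Fin d) (Fin d) ℝ) : Prop where
  measurable : ∀ i j, AEMeasurable (fun t => a t i j) volume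
  bounded : ∃ K : ℝ, ∀ t i j, |a t i j| ≤ K
  lower : ∀ (t : ℝ) (ξ : E d), δ * ‖ξ‖ ^ 2 ≤ ∑ i, ∑ j, a t i j * ξ i * ξ j
  upper : ∀ (t : ℝ) (ξ : E d), ∑ i, ∑ j, a t i j * ξ i * ξ j ≤ δ⁻¹ * ‖ξ‖ ^ 2

/-- The norms over `G` of `u`, `∇_x u`, `∇_x (-Δ_y)^{1/6} u`, `∇_x² u`, `(-Δ_y)^{1/3} u`,
`(-Δ_z)^{1/5} u`, `∂_t u - x · ∇_y u - y · ∇_z u` in `L²(G)` all exist, and their sum is at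
most `C`. -/
def FullBound {d : ℕ} (G : Set (Pt d)) (u : Pt d → ℝ) (C : ℝ≥0∞) : Prop :=
  ∃ (Du DFu : Pt d → E d) (D2u : Pt d → EuclideanSpace ℝ (Fin d × Fin d))
    (Fyu Fzu Yu : Pt d → ℝ),
    IsGradX G u Du ∧ IsGradXFracLapY (1 / 6) G u DFu ∧ IsHessX G u D2u ∧
    IsFracLapY (1 / 3) G u Fyu ∧ IsFracLapZ (1 / 5) G u Fzu ∧ IsTransport G u Yu ∧
    eLpNorm u 2 (volume.restrict G) + eLpNorm Du 2 (volume.restrict G)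
      + eLpNorm DFu 2 (volume.restrict G) + eLpNorm D2u 2 (volume.restrict G)
      + eLpNorm Fyu 2 (volume.restrict G) + eLpNorm Fzu 2 (volume.restrict G)
      + eLpNorm Yu 2 (volume.restrict G) ≤ C

end KFP

end

/-! The field ∂_t − x·∇_y − y·∇_z is straightened by the shear (x, y + tx, z + ty + t²x/2) (`flow`).
Since the coefficients depend on t only, a Fourier transform in the sheared space variables then
reduces the problem to scalar equations Y' + q(t)Y = F, one for each frequency (k, l, m). In these
coordinates ∇_x, (−Δ_y)^s and (−Δ_z)^s become multipliers in κ(t) = k + tl + t²m/2, λ(t) = l + tm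
and m respectively, and q = 4π² Σ a^{ij} κ_i κ_j ≥ δ|κ|².

The estimate says that (1 + w)Y is bounded by F in L²(S,T), uniformly in the frequency, where w =
|κ|² + |λ|^{2/3} + |m|^{2/5}; every symbol on the left side of the theorem is dominated by 1 + w.
The gain in y and z comes from κ being a quadratic polynomial in t with κ' = λ and κ'' = m: with h =
t − r, ∫_r^t |κ|² is at least a multiple of h|κ|² + h³|λ|² + h⁵|m|², evaluated at either endpoint,
and this is at least hw − 2. So exp(−∫_r^t q) decays exponentially in hw. The weights at r and t
differ by a factor polynomial in hw, which half of the exponential absorbs (`exists_kernel_bound`).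
Row and column integrals of the weighted Duhamel kernel are therefore bounded, and Schur's test
applies (`exists_duhamel_bound`). Plancherel turns this into `exists_solution`.

For uniqueness, the transform of any solution is shown to satisfy the Volterra equation Y(t) = ∫_S^t
(F − qY) for almost every frequency (`hess_fourier`, `volterra_fourier`); the difference of two
solutions vanishes by Gronwall (`ae_eq_zero_of_volterra`).

The functions being merely L², the transform is handled by duality: in `IsPF H W` the function H
lives on the frequency side and W, on the physical side, is its forward transform. Operators are
thus computed on test functions only, where they are classical. -/

open scoped FourierTransform SchwartzMap ComplexConjugate

noncomputable section

namespace KFP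

/-! ### Square integrable functions and extension of isometries by density -/

section General

variable {α : Type*} [MeasurableSpace α] {μ : Measure α}

theorem eLpNorm_two_sq {F : Type*} [NormedAddCommGroup F] (f : α → F) :
    eLpNorm f 2 μ ^ 2 = ∫⁻ x, ‖f x‖ₑ ^ 2 ∂μ := by
  rw [eLpNorm_eq_lintegral_rpow_enorm_toReal (by norm_num) (by norm_num), ← ENNReal.rpow_natCast,
    ← ENNReal.rpow_mul]
  simp

theorem eLpNorm_two_le_of_sq {F F' : Type*} [NormedAddCommGroup F] [NormedAddCommGroup F']
    {β : Type*} [MeasurableSpace β] {ν : Measure β} {f : α → F} {g : β → F'}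
    (h : ∫⁻ x, ‖f x‖ₑ ^ 2 ∂μ ≤ ∫⁻ x, ‖g x‖ₑ ^ 2 ∂ν) : eLpNorm f 2 μ ≤ eLpNorm g 2 ν := by
  rw [← eLpNorm_two_sq, ← eLpNorm_two_sq] at h
  exact (ENNReal.pow_le_pow_left_iff two_ne_zero).1 h

theorem integrable_mul_of_memLp_two {f g : α → ℂ} (hf : MemLp f 2 μ) (hg : MemLp g 2 μ) :
    Integrable (fun x => f x * g x) μ :=
  MemLp.integrable_mul hf hg

theorem memLp_conj {f : α → ℂ} {p : ℝ≥0∞} (hf : MemLp f p μ) : MemLp (fun x => conj (f x)) p μ :=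
  hf.of_le (by exact Complex.continuous_conj.comp_aestronglyMeasurable hf.1)
    (Eventually.of_forall fun x => by simp)

theorem inner_toLp_conj {f g : α → ℂ} (hf : MemLp f 2 μ) (hg : MemLp g 2 μ) :
    inner ℂ ((memLp_conj hg).toLp _) (hf.toLp f) = ∫ x, f x * g x ∂μ := by
  rw [L2.inner_def]
  refine integral_congr_ae ?_
  filter_upwards [hf.coeFn_toLp, (memLp_conj hg).coeFn_toLp] with x h1 h2
  rw [h1, h2]
  simp

/-- Extension by density of an isometry given on continuous compactly supported functions,
together with its duality relations. -/
theorem exists_isometric_extension [TopologicalSpace α] [NormalSpace α] [BorelSpace α] [R1Space α]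
    [WeaklyLocallyCompactSpace α] [μ.Regular] (𝒯 : (α → ℂ) → (α → ℂ))
    (hT : ∀ g, Continuous g → HasCompactSupport g → MemLp (𝒯 g) 2 μ)
    (hnorm : ∀ g, Continuous g → HasCompactSupport g → eLpNorm (𝒯 g) 2 μ = eLpNorm g 2 μ)
    (hsub : ∀ g g', Continuous g → HasCompactSupport g → Continuous g' → HasCompactSupport g' →
      𝒯 (g - g') = 𝒯 g - 𝒯 g')
    {H : α → ℂ} (hH : MemLp H 2 μ) :
    ∃ W, MemLp W 2 μ ∧ eLpNorm W 2 μ ≤ eLpNorm H 2 μ ∧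
      ∀ Φ Ψ, MemLp Φ 2 μ → MemLp Ψ 2 μ →
        (∀ g, Continuous g → HasCompactSupport g → ∫ x, 𝒯 g x * Φ x ∂μ = ∫ x, g x * Ψ x ∂μ) →
        ∫ x, W x * Φ x ∂μ = ∫ x, H x * Ψ x ∂μ := by
  have hex : ∀ n : ℕ, ∃ g : α → ℂ, HasCompactSupport g ∧
      eLpNorm (H - g) 2 μ ≤ ((n : ℝ≥0∞) + 1)⁻¹ ∧ Continuous g ∧ MemLp g 2 μ := fun n =>
    hH.exists_hasCompactSupport_eLpNorm_sub_le (by norm_num) (by simp)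
  choose g hgc hgle hg hgL using hex
  have hTL : ∀ n, MemLp (𝒯 (g n)) 2 μ := fun n => hT _ (hg n) (hgc n)
  have hlim : Tendsto (fun n => (hgL n).toLp (g n)) atTop (𝓝 (hH.toLp H)) := by
    rw [tendsto_iff_edist_tendsto_0]
    have h0 : Tendsto (fun n : ℕ => ((n : ℝ≥0∞) + 1)⁻¹) atTop (𝓝 0) := by
      have := (tendsto_add_atTop_iff_nat 1).2 ENNReal.tendsto_inv_nat_nhds_zero
      simpa using this
    refine tendsto_of_tendsto_of_tendsto_of_le_of_le tendsto_const_nhds h0 (fun _ => zero_le) ?_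
    intro n
    simp only
    rw [edist_comm, Lp.edist_toLp_toLp]
    exact hgle n
  have hdist : ∀ m n, edist ((hTL m).toLp (𝒯 (g m))) ((hTL n).toLp (𝒯 (g n)))
      = edist ((hgL m).toLp (g m)) ((hgL n).toLp (g n)) := by
    intro m n
    rw [Lp.edist_toLp_toLp, Lp.edist_toLp_toLp, ← hsub _ _ (hg m) (hgc m) (hg n) (hgc n),
      hnorm _ ((hg m).sub (hg n))]
    exact (hgc m).sub (hgc n)
  have hC : CauchySeq (fun n => (hTL n).toLp (𝒯 (g n))) := by
    have := hlim.cauchySeq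
    rw [EMetric.cauchySeq_iff] at this ⊢
    simpa only [hdist] using this
  obtain ⟨W, hW⟩ := cauchySeq_tendsto_of_complete hC
  have hnormW : ‖W‖ ≤ ‖hH.toLp H‖ := by
    refine le_of_eq (tendsto_nhds_unique hW.norm ?_)
    have : ∀ n, ‖(hTL n).toLp (𝒯 (g n))‖ = ‖(hgL n).toLp (g n)‖ := fun n => by
      rw [Lp.norm_toLp, Lp.norm_toLp, hnorm _ (hg n) (hgc n)]
    simpa only [this] using hlim.norm
  refine ⟨W, Lp.memLp W, ?_, ?_⟩
  · rw [Lp.norm_def, Lp.norm_toLp] at hnormW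
    exact (ENNReal.toReal_le_toReal (Lp.memLp W).2.ne hH.2.ne).1 hnormW
  · intro Φ Ψ hΦ hΨ hpair
    -- Both sides of the duality relation are inner products with a fixed element of L², so the
    -- relation passes from the approximants to the limit.
    have e1 : Tendsto (fun n => ∫ x, 𝒯 (g n) x * Φ x ∂μ) atTop (𝓝 (∫ x, W x * Φ x ∂μ)) := by
      have := (tendsto_const_nhds (x := (memLp_conj hΦ).toLp _)).inner (𝕜 := ℂ) hW
      rw [← Lp.toLp_coeFn W (Lp.memLp W), inner_toLp_conj (Lp.memLp W) hΦ] at this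
      exact this.congr fun n => inner_toLp_conj (hTL n) hΦ
    have e2 : Tendsto (fun n => ∫ x, g n x * Ψ x ∂μ) atTop (𝓝 (∫ x, H x * Ψ x ∂μ)) := by
      have := (tendsto_const_nhds (x := (memLp_conj hΨ).toLp _)).inner (𝕜 := ℂ) hlim
      rw [inner_toLp_conj hH hΨ] at this
      exact this.congr fun n => inner_toLp_conj (hgL n) hΨ
    refine tendsto_nhds_unique e1 ?_
    simpa only [fun n => hpair _ (hg n) (hgc n)] using e2

end General

/-! ### Plancherel and the Fourier transform in the space variable -/

variable {V : Type*} [NormedAddCommGroup V] [InnerProductSpace ℝ V] [FiniteDimensional ℝ V]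
  [MeasurableSpace V] [BorelSpace V]

theorem continuous_fourier {g : V → ℂ} (h1 : Integrable g) : Continuous (𝓕 g) :=
  VectorFourier.fourierIntegral_continuous Real.continuous_fourierChar
    (by exact continuous_inner) h1

theorem integral_fourier_mul_eq {f g : V → ℂ} (hf : Integrable f) (hg : Integrable g) :
    ∫ x, 𝓕 f x * g x = ∫ x, f x * 𝓕 g x := by
  have := VectorFourier.integral_fourierIntegral_smul_eq_flip (L := innerₗ V) (f := f) (g := g)
    (μ := volume) (ν := volume) Real.continuous_fourierChar (by exact continuous_inner) hf hg
  rw [flip_innerₗ] at this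
  exact this

/-- The `L²` Fourier transform agrees with the Fourier integral on `L¹ ∩ L²`. -/
theorem fourier_toLp_ae_eq {g : V → ℂ} (h1 : Integrable g) (h2 : MemLp g 2) :
    (𝓕 (h2.toLp g) : Lp (α := V) ℂ 2) =ᵐ[volume] 𝓕 g := by
  refine ae_eq_of_integral_contDiff_smul_eq
    ((Lp.memLp _).locallyIntegrable (by norm_num)) (continuous_fourier h1).locallyIntegrable ?_
  intro ψ hψ hψc
  have hψ' : ContDiff ℝ ∞ (fun v => (ψ v : ℂ)) := Complex.ofRealCLM.contDiff.comp hψ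
  have hψc' : HasCompactSupport (fun v => (ψ v : ℂ)) :=
    hψc.comp_left (g := fun x : ℝ => (x : ℂ)) (by simp)
  let Ψ : 𝓢(V, ℂ) := hψc'.toSchwartzMap hψ'
  have e := congrArg (fun T : 𝓢'(V, ℂ) => T Ψ) (Lp.fourier_toTemperedDistribution_eq (h2.toLp g))
  simp only [TemperedDistribution.fourier_apply, Lp.toTemperedDistribution_apply] at e
  have e2 : ∫ x, Ψ x • 𝓕 g x = ∫ x, (𝓕 Ψ) x • g x := by
    exact (integral_fourier_mul_eq Ψ.integrable h1).symm
  have e3 : ∫ x, (𝓕 Ψ) x • (h2.toLp g) x = ∫ x, (𝓕 Ψ) x • g x := by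
    refine integral_congr_ae ?_
    filter_upwards [h2.coeFn_toLp] with x hx
    rw [hx]
  have e4 : ∀ x, Ψ x = (ψ x : ℂ) := fun x => rfl
  rw [e3, ← e2] at e
  simp only [e4] at e
  simpa [Complex.real_smul] using e.symm

theorem memLp_fourier {g : V → ℂ} (h1 : Integrable g) (h2 : MemLp g 2) : MemLp (𝓕 g) 2 :=
  (memLp_congr_ae (fourier_toLp_ae_eq h1 h2)).1 (Lp.memLp _)

theorem toLp_fourier {g : V → ℂ} (h1 : Integrable g) (h2 : MemLp g 2) :
    (memLp_fourier h1 h2).toLp (𝓕 g) = 𝓕 (h2.toLp g) := by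
  refine Lp.ext ?_
  exact (MemLp.coeFn_toLp _).trans (fourier_toLp_ae_eq h1 h2).symm

theorem eLpNorm_fourier {g : V → ℂ} (h1 : Integrable g) (h2 : MemLp g 2) :
    eLpNorm (𝓕 g) 2 volume = eLpNorm g 2 volume := by
  have := Lp.norm_fourier_eq (h2.toLp g)
  rw [← toLp_fourier h1 h2, Lp.norm_toLp, Lp.norm_toLp] at this
  exact (ENNReal.toReal_eq_toReal_iff' (memLp_fourier h1 h2).2.ne h2.2.ne).1 this

/-- Parseval for the pair f̄, g in bilinear form. Conjugating before and after the transform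
produces its inverse, so this identity is what makes `pfInv` dual to `pf`. -/
theorem integral_conj_fourier_conj_mul {f g : V → ℂ} (hf : Integrable f) (hf2 : MemLp f 2)
    (hg : Integrable g) (hg2 : MemLp g 2) :
    ∫ x, conj (𝓕 (fun p => conj (f p)) x) * 𝓕 g x = ∫ x, f x * g x := by
  have hcf : Integrable fun p => conj (f p) := by
    simpa only [memLp_one_iff_integrable] using memLp_conj (memLp_one_iff_integrable.2 hf)
  have key := Lp.inner_fourier_eq ((memLp_conj hf2).toLp _) (hg2.toLp g)
  rw [← toLp_fourier hcf (memLp_conj hf2), ← toLp_fourier hg hg2, inner_toLp_conj hg2 hf2,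
    L2.inner_def] at key
  simp only [mul_comm (f _)]
  rw [← key]
  refine integral_congr_ae ?_
  filter_upwards [(memLp_fourier hcf (memLp_conj hf2)).coeFn_toLp,
    (memLp_fourier hg hg2).coeFn_toLp] with x h1 h2
  rw [h1, h2]
  simp [mul_comm]

/-- Fourier transform in the second variable. -/
def pf (Φ : ℝ × V → ℂ) : ℝ × V → ℂ := fun q => 𝓕 (fun p => Φ (q.1, p)) q.2

/-- Square integrable functions, almost all of whose slices are integrable. -/
structure Adm (Φ : ℝ × V → ℂ) : Prop where
  memLp : MemLp Φ 2 volume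
  integrable : ∀ᵐ t : ℝ, Integrable fun p => Φ (t, p)

theorem lintegral_slices {f : ℝ × V → ℂ} (hf : AEStronglyMeasurable f volume) :
    ∫⁻ q, ‖f q‖ₑ ^ 2 = ∫⁻ t : ℝ, eLpNorm (fun p : V => f (t, p)) 2 volume ^ 2 := by
  simp only [eLpNorm_two_sq]
  exact lintegral_prod _ (hf.enorm.pow_const 2)

theorem ae_memLp_slice {f : ℝ × V → ℂ} (hf : MemLp f 2 volume) :
    ∀ᵐ t : ℝ, MemLp (fun p : V => f (t, p)) 2 volume := by
  have h1 : ∀ᵐ t : ℝ, AEStronglyMeasurable (fun p : V => f (t, p)) volume := by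
    have := hf.1
    rw [Measure.volume_eq_prod] at this
    exact this.prodMk_left
  have h2 : ∀ᵐ t : ℝ, eLpNorm (fun p : V => f (t, p)) 2 volume ^ 2 < ⊤ := by
    refine ae_lt_top' ?_ ?_
    · simp only [eLpNorm_two_sq]
      exact AEMeasurable.lintegral_prod_right' (hf.1.enorm.pow_const 2)
    · rw [← lintegral_slices hf.1, ← eLpNorm_two_sq]
      exact ENNReal.pow_ne_top hf.2.ne
  filter_upwards [h1, h2] with t h1 h2
  exact ⟨h1, by simpa using h2⟩

/-- Almost every slice of a null set is null, and a Fourier integral does not see null sets; hence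
equality for every frequency, not just almost every one. -/
theorem pf_congr_slice {Φ Ψ : ℝ × V → ℂ} (h : Φ =ᵐ[volume] Ψ) :
    ∀ᵐ t : ℝ, ∀ ζ : V, pf Φ (t, ζ) = pf Ψ (t, ζ) := by
  rw [Measure.volume_eq_prod] at h
  filter_upwards [Measure.ae_ae_of_ae_prod h] with t ht ζ
  exact Real.fourier_congr_ae ht ζ

theorem ae_prod_of_slice {P : ℝ × V → Prop} (h : ∀ᵐ t : ℝ, ∀ ζ : V, P (t, ζ)) :
    ∀ᵐ q : ℝ × V, P q := by
  rw [Measure.volume_eq_prod]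
  have := Measure.quasiMeasurePreserving_fst (μ := (volume : Measure ℝ)) (ν := (volume : Measure V))
  filter_upwards [this.ae h] with q hq using hq q.2

theorem stronglyMeasurable_pf {Φ : ℝ × V → ℂ} (hΦ : StronglyMeasurable Φ) :
    StronglyMeasurable (pf Φ) := by
  have : StronglyMeasurable (Function.uncurry fun (q : ℝ × V) (p : V) =>
      Real.fourierChar (-inner ℝ p q.2) • Φ (q.1, p)) := by
    simp only [Circle.smul_def, smul_eq_mul, Function.uncurry_def]
    refine StronglyMeasurable.mul ?_ ?_
    · refine Continuous.stronglyMeasurable ?_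
      exact continuous_subtype_val.comp (Real.continuous_fourierChar.comp (by fun_prop))
    · exact hΦ.comp_measurable (by fun_prop)
  have e : pf Φ = fun q => ∫ p, Real.fourierChar (-inner ℝ p q.2) • Φ (q.1, p) := by
    ext q
    exact Real.fourier_eq _ _
  rw [e]
  exact this.integral_prod_right

theorem aestronglyMeasurable_pf {Φ : ℝ × V → ℂ} (hΦ : AEStronglyMeasurable Φ volume) :
    AEStronglyMeasurable (pf Φ) volume :=
  ⟨pf (hΦ.mk Φ), stronglyMeasurable_pf hΦ.stronglyMeasurable_mk,
    ae_prod_of_slice (pf_congr_slice hΦ.ae_eq_mk)⟩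

theorem Adm.eLpNorm_pf {Φ : ℝ × V → ℂ} (h : Adm Φ) :
    eLpNorm (pf Φ) 2 volume = eLpNorm Φ 2 volume := by
  have : ∫⁻ q, ‖pf Φ q‖ₑ ^ 2 = ∫⁻ q, ‖Φ q‖ₑ ^ 2 := by
    rw [lintegral_slices h.memLp.1, lintegral_slices (aestronglyMeasurable_pf h.memLp.1)]
    refine lintegral_congr_ae ?_
    filter_upwards [h.integrable, ae_memLp_slice h.memLp] with t h1 h2
    simp only [pf]
    rw [eLpNorm_fourier h1 h2]
  exact le_antisymm (eLpNorm_two_le_of_sq this.le) (eLpNorm_two_le_of_sq this.ge)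

theorem Adm.memLp_pf {Φ : ℝ × V → ℂ} (h : Adm Φ) : MemLp (pf Φ) 2 volume :=
  ⟨aestronglyMeasurable_pf h.memLp.1, h.eLpNorm_pf ▸ h.memLp.2⟩

theorem hasCompactSupport_slice {V : Type*} [TopologicalSpace V] [R1Space V] {F : Type*} [Zero F]
    {Φ : ℝ × V → F} (hc : HasCompactSupport Φ)
    (t : ℝ) : HasCompactSupport fun p => Φ (t, p) := by
  refine HasCompactSupport.of_support_subset_isCompact (hc.isCompact.image continuous_snd) ?_
  intro p hp
  exact ⟨(t, p), subset_tsupport _ hp, rfl⟩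

theorem adm_of_continuous {Φ : ℝ × V → ℂ} (h : Continuous Φ) (hc : HasCompactSupport Φ) :
    Adm Φ where
  memLp := h.memLp_of_hasCompactSupport hc
  integrable := Eventually.of_forall fun t =>
    Continuous.integrable_of_hasCompactSupport (by fun_prop) (hasCompactSupport_slice hc t)

theorem Adm.conj {Φ : ℝ × V → ℂ} (h : Adm Φ) : Adm fun q => conj (Φ q) where
  memLp := memLp_conj h.memLp
  integrable := by
    filter_upwards [h.integrable] with t ht
    simpa only [memLp_one_iff_integrable] using memLp_conj (memLp_one_iff_integrable.2 ht)

/-- `W` is the Fourier transform of `H` in the second variable. -/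
structure IsPF (H W : ℝ × V → ℂ) : Prop where
  left : MemLp H 2 volume
  right : MemLp W 2 volume
  pairing : ∀ Φ, Adm Φ → ∫ q, W q * Φ q = ∫ q, H q * pf Φ q

theorem pf_sub {g g' : ℝ × V → ℂ} (hg : ∀ t, Integrable fun p => g (t, p))
    (hg' : ∀ t, Integrable fun p => g' (t, p)) : pf (g - g') = pf g - pf g' := by
  ext q
  have := VectorFourier.fourierIntegral_add (L := innerₗ V) Real.continuous_fourierChar
    (by exact continuous_inner) (hg q.1) (hg' q.1).neg
  have h2 := VectorFourier.fourierIntegral_const_smul Real.fourierChar (volume : Measure V)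
    (innerₗ V) (fun p => g' (q.1, p)) (-1)
  have e1 : pf (g - g') q = VectorFourier.fourierIntegral Real.fourierChar volume (innerₗ V)
      ((fun p => g (q.1, p)) + -(fun p => g' (q.1, p))) q.2 := by
    simp only [pf, sub_eq_add_neg]; rfl
  rw [e1, this]
  have e2 : (-(fun p : V => g' (q.1, p))) = ((-1 : ℂ) • fun p => g' (q.1, p)) := by
    ext p; simp
  rw [e2, h2]
  simp only [Pi.add_apply, Pi.sub_apply, Pi.smul_apply, pf]
  simp [sub_eq_add_neg]
  rfl

theorem integral_pf_mul_eq {g Φ : ℝ × V → ℂ} (hg : Adm g) (hΦ : Adm Φ) :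
    ∫ q, pf g q * Φ q = ∫ q, g q * pf Φ q := by
  rw [Measure.volume_eq_prod,
    integral_prod _ (integrable_mul_of_memLp_two hg.memLp_pf hΦ.memLp),
    integral_prod _ (integrable_mul_of_memLp_two hg.memLp hΦ.memLp_pf)]
  refine integral_congr_ae ?_
  filter_upwards [hg.integrable, hΦ.integrable] with t h1 h2
  exact integral_fourier_mul_eq h1 h2

/-- Inverse Fourier transform in the second variable. -/
def pfInv (Φ : ℝ × V → ℂ) : ℝ × V → ℂ := fun q => conj (pf (fun r => conj (Φ r)) q)

theorem integral_pfInv_mul_pf_eq {g Φ : ℝ × V → ℂ} (hg : Adm g) (hΦ : Adm Φ) :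
    ∫ q, pfInv g q * pf Φ q = ∫ q, g q * Φ q := by
  rw [Measure.volume_eq_prod, integral_prod (fun q => pfInv g q * pf Φ q)
    (integrable_mul_of_memLp_two (memLp_conj hg.conj.memLp_pf) hΦ.memLp_pf),
    integral_prod _ (integrable_mul_of_memLp_two hg.memLp hΦ.memLp)]
  refine integral_congr_ae ?_
  filter_upwards [hg.integrable, hΦ.integrable, ae_memLp_slice hg.memLp,
    ae_memLp_slice hΦ.memLp] with t h1 h2 h3 h4
  exact integral_conj_fourier_conj_mul h1 h3 h2 h4

theorem exists_isPF {H : ℝ × V → ℂ} (hH : MemLp H 2 volume) :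
    ∃ W, IsPF H W ∧ eLpNorm W 2 volume ≤ eLpNorm H 2 volume := by
  obtain ⟨W, hW, hle, hp⟩ := exists_isometric_extension (μ := (volume : Measure (ℝ × V))) pf
    (fun g h hc => (adm_of_continuous h hc).memLp_pf)
    (fun g h hc => (adm_of_continuous h hc).eLpNorm_pf)
    (fun g g' h hc h' hc' => pf_sub
      (fun t => Continuous.integrable_of_hasCompactSupport (by fun_prop)
        (hasCompactSupport_slice hc t))
      (fun t => Continuous.integrable_of_hasCompactSupport (by fun_prop)
        (hasCompactSupport_slice hc' t))) hH
  exact ⟨W, ⟨hH, hW, fun Φ hΦ => hp _ _ hΦ.memLp hΦ.memLp_pf fun g h hc =>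
    integral_pf_mul_eq (adm_of_continuous h hc) hΦ⟩, hle⟩

theorem exists_isPF_inv {W : ℝ × V → ℂ} (hW : MemLp W 2 volume) :
    ∃ H, IsPF H W ∧ eLpNorm H 2 volume ≤ eLpNorm W 2 volume := by
  have hcc : ∀ g : ℝ × V → ℂ, Continuous g → HasCompactSupport g →
      Continuous (fun q => conj (g q)) ∧ HasCompactSupport fun q => conj (g q) := fun g h hc =>
    ⟨Complex.continuous_conj.comp h, hc.comp_left (g := fun z : ℂ => conj z) (by simp)⟩
  obtain ⟨H, hH, hle, hp⟩ := exists_isometric_extension (μ := (volume : Measure (ℝ × V))) pfInv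
    (fun g h hc => memLp_conj (adm_of_continuous h hc).conj.memLp_pf)
    (fun g h hc => by
      rw [← (eLpNorm_congr_norm_ae (f := fun q => conj (g q)) (g := g)
        (Eventually.of_forall fun x => by simp)),
        ← (adm_of_continuous h hc).conj.eLpNorm_pf]
      exact eLpNorm_congr_norm_ae (Eventually.of_forall fun x => by simp [pfInv]))
    (fun g g' h hc h' hc' => by
      obtain ⟨a1, a2⟩ := hcc g h hc
      obtain ⟨b1, b2⟩ := hcc g' h' hc'
      have := pf_sub (g := fun q => conj (g q)) (g' := fun q => conj (g' q))
        (fun t => Continuous.integrable_of_hasCompactSupport (f := fun p => conj (g (t, p)))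
          (by fun_prop) (hasCompactSupport_slice a2 t))
        (fun t => Continuous.integrable_of_hasCompactSupport (f := fun p => conj (g' (t, p)))
          (by fun_prop) (hasCompactSupport_slice b2 t))
      ext q
      have e : (fun r => conj ((g - g') r)) = (fun r => conj (g r)) - fun r => conj (g' r) := by
        ext r; simp
      change conj (pf (fun r => conj ((g - g') r)) q) = pfInv g q - pfInv g' q
      rw [e, this, Pi.sub_apply, map_sub]
      rfl) hW
  refine ⟨H, ⟨hH, hW, fun Φ hΦ => (hp _ _ hΦ.memLp_pf hΦ.memLp fun g h hc => ?_).symm⟩, hle⟩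
  exact integral_pfInv_mul_pf_eq (adm_of_continuous h hc) hΦ

/-- Smooth compactly supported functions are admissible, so the pairing determines W as a
distribution. -/
theorem IsPF.unique {H W W' : ℝ × V → ℂ} (h : IsPF H W) (h' : IsPF H W') : W =ᵐ[volume] W' := by
  refine ae_eq_of_integral_contDiff_smul_eq (h.right.locallyIntegrable (by norm_num))
    (h'.right.locallyIntegrable (by norm_num)) ?_
  intro ψ hψ hψc
  have hΨ : Adm fun q => (ψ q : ℂ) := by
    refine adm_of_continuous ?_ (hψc.comp_left (g := fun x : ℝ => (x : ℂ)) (by simp))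
    exact Complex.continuous_ofReal.comp hψ.continuous
  have := (h.pairing _ hΨ).trans (h'.pairing _ hΨ).symm
  simpa only [Complex.real_smul, mul_comm] using this

theorem IsPF.eLpNorm_le {H W : ℝ × V → ℂ} (h : IsPF H W) :
    eLpNorm W 2 volume ≤ eLpNorm H 2 volume := by
  obtain ⟨W', h', hle⟩ := exists_isPF h.left
  rwa [eLpNorm_congr_ae (h.unique h')]

theorem IsPF.congr {H H' W W' : ℝ × V → ℂ} (h : IsPF H W) (hH : H =ᵐ[volume] H')
    (hW : W =ᵐ[volume] W') : IsPF H' W' where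
  left := (memLp_congr_ae hH).1 h.left
  right := (memLp_congr_ae hW).1 h.right
  pairing Φ hΦ := by
    have e1 : ∫ q, W' q * Φ q = ∫ q, W q * Φ q :=
      integral_congr_ae (hW.symm.mul (ae_eq_refl Φ))
    have e2 : ∫ q, H' q * pf Φ q = ∫ q, H q * pf Φ q :=
      integral_congr_ae (hH.symm.mul (ae_eq_refl _))
    rw [e1, e2, h.pairing Φ hΦ]

theorem IsPF.add {H H' W W' : ℝ × V → ℂ} (h : IsPF H W) (h' : IsPF H' W') :
    IsPF (fun q => H q + H' q) (fun q => W q + W' q) where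
  left := h.left.add h'.left
  right := h.right.add h'.right
  pairing Φ hΦ := by
    simp only [add_mul]
    rw [integral_add (integrable_mul_of_memLp_two h.right hΦ.memLp)
      (integrable_mul_of_memLp_two h'.right hΦ.memLp),
      integral_add (integrable_mul_of_memLp_two h.left hΦ.memLp_pf)
      (integrable_mul_of_memLp_two h'.left hΦ.memLp_pf), h.pairing Φ hΦ, h'.pairing Φ hΦ]

theorem isPF_zero : IsPF (fun _ : ℝ × V => 0) fun _ => 0 where
  left := MemLp.zero
  right := MemLp.zero
  pairing Φ hΦ := by simp

theorem IsPF.sum {ι : Type*} (s : Finset ι) {H W : ι → ℝ × V → ℂ}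
    (h : ∀ i ∈ s, IsPF (H i) (W i)) :
    IsPF (fun q => ∑ i ∈ s, H i q) (fun q => ∑ i ∈ s, W i q) := by
  classical
  induction s using Finset.induction_on with
  | empty => simpa using isPF_zero
  | insert a s ha ih =>
    simp only [Finset.sum_insert ha]
    exact (h a (by simp)).add (ih fun i hi => h i (by simp [hi]))

theorem pf_time_mul (c : ℝ → ℂ) (Φ : ℝ × V → ℂ) (q : ℝ × V) :
    pf (fun q => c q.1 * Φ q) q = c q.1 * pf Φ q := by
  simp only [pf, Real.fourier_eq]
  rw [← integral_const_mul]
  congr 1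
  ext p
  simp only [Circle.smul_def, smul_eq_mul]
  ring

theorem memLp_time_mul {c : ℝ → ℂ} (hc : AEStronglyMeasurable c volume) {K : ℝ}
    (hK : ∀ t, ‖c t‖ ≤ K) {Φ : ℝ × V → ℂ} {p : ℝ≥0∞} (hΦ : MemLp Φ p volume) :
    MemLp (fun q => c q.1 * Φ q) p volume := by
  refine MemLp.of_le_mul (c := K) hΦ (AEStronglyMeasurable.mul ?_ hΦ.1)
    (Eventually.of_forall fun q => ?_)
  · rw [Measure.volume_eq_prod]
    exact hc.comp_fst
  · rw [norm_mul]
    gcongr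
    exact hK _

theorem Adm.time_mul {c : ℝ → ℂ} (hc : AEStronglyMeasurable c volume) {K : ℝ}
    (hK : ∀ t, ‖c t‖ ≤ K) {Φ : ℝ × V → ℂ} (hΦ : Adm Φ) : Adm fun q => c q.1 * Φ q where
  memLp := memLp_time_mul hc hK hΦ.memLp
  integrable := by
    filter_upwards [hΦ.integrable] with t ht
    exact ht.const_mul _

/-- Multiplication by a function of t commutes with a transform in space. Both the coefficients
a^{ij}(t) and the cutoffs in time pass to the Fourier side through this lemma. -/
theorem IsPF.time_mul {c : ℝ → ℂ} (hc : AEStronglyMeasurable c volume) {K : ℝ}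
    (hK : ∀ t, ‖c t‖ ≤ K) {H W : ℝ × V → ℂ} (h : IsPF H W) :
    IsPF (fun q => c q.1 * H q) (fun q => c q.1 * W q) where
  left := memLp_time_mul hc hK h.left
  right := memLp_time_mul hc hK h.right
  pairing Φ hΦ := by
    have := h.pairing _ (hΦ.time_mul hc hK)
    simp only [pf_time_mul] at this
    convert this using 3 <;> ring

theorem IsPF.const_mul (c : ℂ) {H W : ℝ × V → ℂ} (h : IsPF H W) :
    IsPF (fun q => c * H q) (fun q => c * W q) :=
  h.time_mul (c := fun _ => c) aestronglyMeasurable_const (fun _ => le_rfl)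

/-- `IsPF` carries no information on individual times. Cutting off to an arbitrary measurable set A
of times gives the inequality of the integrals over A, hence the inequality for almost every t. -/
theorem IsPF.slice_le {H W : ℝ × V → ℂ} (h : IsPF H W) :
    ∀ᵐ t : ℝ, eLpNorm (fun p => W (t, p)) 2 volume ≤ eLpNorm (fun p => H (t, p)) 2 volume := by
  have hm : ∀ {f : ℝ × V → ℂ}, MemLp f 2 volume →
      AEMeasurable (fun t : ℝ => eLpNorm (fun p => f (t, p)) 2 volume ^ 2) volume := fun hf => by
    simp only [eLpNorm_two_sq]
    exact AEMeasurable.lintegral_prod_right' (hf.1.enorm.pow_const 2)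
  have key := ae_le_of_forall_setLIntegral_le_of_sigmaFinite₀ (hm h.right)
    (g := fun t : ℝ => eLpNorm (fun p => H (t, p)) 2 volume ^ 2) ?_
  · filter_upwards [key] with t ht
    exact (ENNReal.pow_le_pow_left_iff two_ne_zero).1 ht
  · intro A hA _
    have hi := h.time_mul (c := A.indicator fun _ => (1 : ℂ))
      ((measurable_const.indicator hA).aestronglyMeasurable) (K := 1) fun t => by
        by_cases ht : t ∈ A <;> simp [ht]
    have e : ∀ {f : ℝ × V → ℂ}, MemLp f 2 volume →
        ∫⁻ t in A, eLpNorm (fun p => f (t, p)) 2 volume ^ 2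
          = ∫⁻ q, ‖A.indicator (fun _ => (1 : ℂ)) q.1 * f q‖ₑ ^ 2 := fun {f} hf => by
      rw [← lintegral_indicator hA, lintegral_slices (memLp_time_mul
        ((measurable_const.indicator hA).aestronglyMeasurable) (K := 1) (fun t => by
        by_cases ht : t ∈ A <;> simp [ht]) hf).1]
      refine lintegral_congr fun t => ?_
      by_cases ht : t ∈ A <;> simp [ht]
    rw [e h.right, e h.left, ← eLpNorm_two_sq, ← eLpNorm_two_sq]
    gcongr
    exact hi.eLpNorm_le

/-! ### The scalar equation Y' + qY = F with measurable q -/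

section Duhamel

/-- The solution of `Y' + q Y = F`, `Y(S) = 0`. -/
def duhamel (S : ℝ) (q : ℝ → ℝ) (F : ℝ → ℂ) (t : ℝ) : ℂ :=
  (Real.exp (-∫ s in S..t, q s) : ℂ) * ∫ r in S..t, (Real.exp (∫ s in S..r, q s) : ℂ) * F r

/-- Since q is only measurable, the product rule is available only for absolutely continuous
functions. Boundedness of q makes this factor Lipschitz, hence absolutely continuous. -/
theorem lipschitzOn_exp_neg_primitive {S T K : ℝ} (hST : S ≤ T) {q : ℝ → ℝ}
    (hq : ∀ a b, IntervalIntegrable q volume a b) (hK : ∀ t ∈ Set.Icc S T, |q t| ≤ K) :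
    ∃ C, LipschitzOnWith C (fun t => Real.exp (-∫ s in S..t, q s)) (Set.uIcc S T) := by
  have hK0 : 0 ≤ K := (abs_nonneg _).trans (hK S ⟨le_rfl, hST⟩)
  have hc : Continuous fun t => ∫ s in S..t, q s := intervalIntegral.continuous_primitive hq S
  obtain ⟨M, hM⟩ := (isCompact_Icc (a := S) (b := T)).exists_bound_of_continuousOn hc.continuousOn
  have h1 : LipschitzOnWith (Real.exp M).toNNReal Real.exp (Set.Icc (-M) M) := by
    refine (convex_Icc _ _).lipschitzOnWith_of_nnnorm_deriv_le (fun x _ => Real.differentiableAt_exp)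
      ?_
    intro x hx
    rw [Real.deriv_exp, ← NNReal.coe_le_coe, coe_nnnorm, Real.norm_eq_abs, Real.abs_exp,
      Real.coe_toNNReal _ (Real.exp_pos _).le]
    exact Real.exp_le_exp.2 hx.2
  have h2 : LipschitzOnWith K.toNNReal (fun t => -∫ s in S..t, q s) (Set.Icc S T) := by
    refine LipschitzOnWith.of_dist_le_mul fun x hx y hy => ?_
    rw [Real.coe_toNNReal _ hK0, dist_neg_neg, Real.dist_eq, Real.dist_eq,
      intervalIntegral.integral_interval_sub_left (hq _ _) (hq _ _),
      ← Real.norm_eq_abs]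
    refine intervalIntegral.norm_integral_le_of_norm_le_const fun s hs => ?_
    have hs' := Set.uIoc_subset_uIcc hs
    have := Set.uIcc_subset_Icc hy hx hs'
    exact hK s this
  rw [Set.uIcc_of_le hST]
  refine ⟨_, h1.comp h2 ?_⟩
  intro t ht
  have := abs_le.1 (hM t ht)
  constructor <;> linarith [this.1, this.2]

/-- Integrated product rule for e^{−Q} ∫ e^{Q} F with Q = ∫_S q: the two factors are absolutely
continuous, and almost everywhere the derivative of the product is F − q times the product. -/
theorem duhamel_real_eq {S T K : ℝ} {q F : ℝ → ℝ}
    (hq : ∀ a b, IntervalIntegrable q volume a b) (hK : ∀ t ∈ Set.Icc S T, |q t| ≤ K)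
    (hF : IntervalIntegrable F volume S T) {t : ℝ} (ht : t ∈ Set.Icc S T) :
    Real.exp (-∫ s in S..t, q s) * ∫ r in S..t, Real.exp (∫ s in S..r, q s) * F r
      = ∫ r in S..t, (F r - q r * (Real.exp (-∫ s in S..r, q s) *
          ∫ r' in S..r, Real.exp (∫ s in S..r', q s) * F r')) := by
  have hSt : S ≤ t := ht.1
  have hc : Continuous fun t => ∫ s in S..t, q s := intervalIntegral.continuous_primitive hq S
  obtain ⟨C, hC⟩ := lipschitzOn_exp_neg_primitive hSt hq
    (fun s hs => hK s ⟨hs.1, hs.2.trans ht.2⟩)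
  have hFt : IntervalIntegrable F volume S t := hF.mono_set (by
    rw [Set.uIcc_of_le hSt, Set.uIcc_of_le (hSt.trans ht.2)]
    exact Set.Icc_subset_Icc_right ht.2)
  have hG : IntervalIntegrable (fun r => Real.exp (∫ s in S..r, q s) * F r) volume S t :=
    hFt.continuousOn_mul (by fun_prop)
  have hmem : S ∈ Set.uIcc S t := Set.left_mem_uIcc
  have key := AbsolutelyContinuousOnInterval.integral_deriv_mul_eq_sub
    hC.absolutelyContinuousOnInterval
    (hG.absolutelyContinuousOnInterval_intervalIntegral hmem)
  simp only [intervalIntegral.integral_same, mul_zero, sub_zero] at key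
  rw [← key]
  refine intervalIntegral.integral_congr_ae ?_
  filter_upwards [(hq S t).ae_hasDerivAt_integral, hG.ae_hasDerivAt_integral] with x h1 h2 hx
  have hx' := Set.uIoc_subset_uIcc hx
  rw [(h1 hx' S hmem).fun_neg.exp.deriv, (h2 hx' S hmem).deriv]
  have : Real.exp (-∫ s in S..x, q s) * (Real.exp (∫ s in S..x, q s) * F x) = F x := by
    rw [← mul_assoc, ← Real.exp_add]
    simp
  rw [this]
  ring

/-- As q is real, the real and imaginary parts solve separate equations, which reduces `duhamel_eq`
to `duhamel_real_eq`. -/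
theorem duhamel_re (S : ℝ) {T : ℝ} (q : ℝ → ℝ) (F : ℝ → ℂ)
    (hq : ∀ a b, IntervalIntegrable q volume a b) (hF : IntervalIntegrable F volume S T) {t : ℝ}
    (ht : t ∈ Set.Icc S T) :
    (duhamel S q F t).re = Real.exp (-∫ s in S..t, q s) *
      ∫ r in S..t, Real.exp (∫ s in S..r, q s) * (F r).re ∧
    (duhamel S q F t).im = Real.exp (-∫ s in S..t, q s) *
      ∫ r in S..t, Real.exp (∫ s in S..r, q s) * (F r).im := by
  have hc : Continuous fun t => ∫ s in S..t, q s := intervalIntegral.continuous_primitive hq S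
  have hG : IntervalIntegrable (fun r => (Real.exp (∫ s in S..r, q s) : ℂ) * F r) volume S t :=
    (hF.mono_set (by
      rw [Set.uIcc_of_le ht.1, Set.uIcc_of_le (ht.1.trans ht.2)]
      exact Set.Icc_subset_Icc_right ht.2)).continuousOn_mul
      (Continuous.continuousOn (Complex.continuous_ofReal.comp (Real.continuous_exp.comp hc)))
  constructor
  · have := Complex.reCLM.intervalIntegral_comp_comm hG
    simp only [Complex.reCLM_apply, Complex.re_ofReal_mul] at this
    rw [duhamel, Complex.re_ofReal_mul, this]
  · have := Complex.imCLM.intervalIntegral_comp_comm hG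
    simp only [Complex.imCLM_apply, Complex.im_ofReal_mul] at this
    rw [duhamel, Complex.im_ofReal_mul, this]

theorem continuousOn_duhamel {S T : ℝ} {q : ℝ → ℝ} {F : ℝ → ℂ}
    (hq : ∀ a b, IntervalIntegrable q volume a b) (hF : IntervalIntegrable F volume S T) :
    ContinuousOn (duhamel S q F) (Set.uIcc S T) := by
  have hc : Continuous fun t => ∫ s in S..t, q s := intervalIntegral.continuous_primitive hq S
  have hG : IntervalIntegrable (fun r => (Real.exp (∫ s in S..r, q s) : ℂ) * F r) volume S T :=
    hF.continuousOn_mul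
      (Continuous.continuousOn (Complex.continuous_ofReal.comp (Real.continuous_exp.comp hc)))
  have h2 := intervalIntegral.continuousOn_primitive_interval' hG Set.left_mem_uIcc
  refine ContinuousOn.mul (Continuous.continuousOn ?_) h2
  exact Complex.continuous_ofReal.comp (Real.continuous_exp.comp hc.neg)

theorem duhamel_eq {S T K : ℝ} {q : ℝ → ℝ} {F : ℝ → ℂ}
    (hq : ∀ a b, IntervalIntegrable q volume a b) (hK : ∀ t ∈ Set.Icc S T, |q t| ≤ K)
    (hF : IntervalIntegrable F volume S T) {t : ℝ} (ht : t ∈ Set.Icc S T) :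
    duhamel S q F t = ∫ r in S..t, (F r - q r * duhamel S q F r) := by
  have hsub : Set.uIcc S t ⊆ Set.uIcc S T := by
    rw [Set.uIcc_of_le ht.1, Set.uIcc_of_le (ht.1.trans ht.2)]
    exact Set.Icc_subset_Icc_right ht.2
  have hI : IntervalIntegrable (fun r => F r - q r * duhamel S q F r) volume S t := by
    refine (hF.mono_set hsub).sub (IntervalIntegrable.mul_continuousOn ?_
      ((continuousOn_duhamel hq hF).mono hsub))
    exact ⟨(hq S t).1.ofReal, (hq S t).2.ofReal⟩
  have hmem : ∀ r ∈ Set.uIcc S t, r ∈ Set.Icc S T := fun r hr => by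
    rw [Set.uIcc_of_le ht.1] at hr
    exact ⟨hr.1, hr.2.trans ht.2⟩
  have hFre : IntervalIntegrable (fun r => (F r).re) volume S T := ⟨hF.1.re, hF.2.re⟩
  have hFim : IntervalIntegrable (fun r => (F r).im) volume S T := ⟨hF.1.im, hF.2.im⟩
  apply Complex.ext
  · rw [(duhamel_re S q F hq hF ht).1, duhamel_real_eq hq hK hFre ht]
    have := Complex.reCLM.intervalIntegral_comp_comm hI
    simp only [Complex.reCLM_apply] at this
    rw [← this]
    refine intervalIntegral.integral_congr fun r hr => ?_
    simp only [Complex.sub_re, Complex.re_ofReal_mul, (duhamel_re S q F hq hF (hmem r hr)).1]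
  · rw [(duhamel_re S q F hq hF ht).2, duhamel_real_eq hq hK hFim ht]
    have := Complex.imCLM.intervalIntegral_comp_comm hI
    simp only [Complex.imCLM_apply] at this
    rw [← this]
    refine intervalIntegral.integral_congr fun r hr => ?_
    simp only [Complex.sub_im, Complex.im_ofReal_mul, (duhamel_re S q F hq hF (hmem r hr)).2]

end Duhamel

/-! ### Schur's test -/

section Schur

/-- Cauchy–Schwarz after writing kF as √k · √k F. -/
theorem lintegral_mul_sq_le {α : Type*} [MeasurableSpace α] {μ : Measure α} {k F : α → ℝ≥0∞}
    (hk : AEMeasurable k μ) (hF : AEMeasurable F μ) :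
    (∫⁻ x, k x * F x ∂μ) ^ 2 ≤ (∫⁻ x, k x ∂μ) * ∫⁻ x, k x * F x ^ 2 ∂μ := by
  have h := ENNReal.lintegral_mul_le_Lp_mul_Lq μ (p := 2) (q := 2)
    (by constructor <;> norm_num)
    (hk.pow_const (1 / 2 : ℝ)) ((hk.pow_const (1 / 2 : ℝ)).mul hF)
  have e1 : ∀ x, k x ^ (1 / 2 : ℝ) * (k x ^ (1 / 2 : ℝ) * F x) = k x * F x := fun x => by
    rw [← mul_assoc, ← ENNReal.rpow_add_of_nonneg _ _ (by norm_num) (by norm_num)]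
    norm_num
  have e2 : ∀ x, (k x ^ (1 / 2 : ℝ)) ^ (2 : ℝ) = k x := fun x => by
    rw [← ENNReal.rpow_mul]
    norm_num
  simp only [Pi.mul_apply, e1, e2, ENNReal.mul_rpow_of_nonneg _ _ (zero_le_two (α := ℝ))] at h
  calc (∫⁻ x, k x * F x ∂μ) ^ 2 ≤ ((∫⁻ x, k x ∂μ) ^ (1 / 2 : ℝ) *
        (∫⁻ x, k x * F x ^ (2 : ℝ) ∂μ) ^ (1 / 2 : ℝ)) ^ 2 := by gcongr
    _ = _ := by
      rw [mul_pow, ← ENNReal.rpow_natCast, ← ENNReal.rpow_natCast, ← ENNReal.rpow_mul,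
        ← ENNReal.rpow_mul]
      norm_num

/-- Schur's test. -/
theorem schur_test {α : Type*} [MeasurableSpace α] {μ : Measure α} [SFinite μ]
    {k : α → α → ℝ≥0∞} (hk : Measurable (Function.uncurry k)) {F : α → ℝ≥0∞} (hF : Measurable F)
    {C : ℝ≥0∞} (h1 : ∀ᵐ t ∂μ, ∫⁻ r, k t r ∂μ ≤ C) (h2 : ∀ᵐ r ∂μ, ∫⁻ t, k t r ∂μ ≤ C) :
    ∫⁻ t, (∫⁻ r, k t r * F r ∂μ) ^ 2 ∂μ ≤ C ^ 2 * ∫⁻ r, F r ^ 2 ∂μ := by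
  have hmk : Measurable (Function.uncurry fun t r => k t r * F r ^ 2) :=
    hk.mul ((hF.comp measurable_snd).pow_const 2)
  calc ∫⁻ t, (∫⁻ r, k t r * F r ∂μ) ^ 2 ∂μ
      ≤ ∫⁻ t, C * ∫⁻ r, k t r * F r ^ 2 ∂μ ∂μ := by
        refine lintegral_mono_ae ?_
        filter_upwards [h1] with t ht
        refine (lintegral_mul_sq_le (hk.of_uncurry_left).aemeasurable hF.aemeasurable).trans ?_
        gcongr
    _ = C * ∫⁻ r, ∫⁻ t, k t r * F r ^ 2 ∂μ ∂μ := by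
        rw [lintegral_const_mul _ (Measurable.lintegral_prod_right hmk), lintegral_lintegral_swap hmk.aemeasurable]
    _ ≤ C * ∫⁻ r, C * F r ^ 2 ∂μ := by
        gcongr 1
        refine lintegral_mono_ae ?_
        filter_upwards [h2] with r hr
        rw [lintegral_mul_const _ (hk.of_uncurry_right)]
        gcongr
    _ = _ := by
        rw [lintegral_const_mul _ (hF.pow_const 2)]
        ring

end Schur

/-! ### Decay of the weighted kernel along a characteristic -/

section Kernel

variable {E : Type*} [NormedAddCommGroup E] [InnerProductSpace ℝ E]

/-- The right side is ∫_0^1 ‖A + sB + s²C‖² ds. Expanded in shifted Legendre polynomials it equals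
‖A + B/2 + C/3‖² + ‖B + C‖²/12 + ‖C‖²/180. The bounds `hA` and `hB` recover A and B from these three
vectors, and the last coefficient is the one that forces a constant close to 1/900. -/
theorem quadratic_form_lower (A B C : E) :
    1 / 900 * (‖A‖ ^ 2 + ‖B‖ ^ 2 + ‖C‖ ^ 2) ≤
      ‖A‖ ^ 2 + inner ℝ A B + ‖B‖ ^ 2 / 3 + 2 / 3 * inner ℝ A C + inner ℝ B C / 2
        + ‖C‖ ^ 2 / 5 := by
  have expand : ∀ a b c : ℝ, ‖a • A + b • B + c • C‖ ^ 2 = a ^ 2 * ‖A‖ ^ 2 + b ^ 2 * ‖B‖ ^ 2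
      + c ^ 2 * ‖C‖ ^ 2 + 2 * a * b * inner ℝ A B + 2 * a * c * inner ℝ A C
      + 2 * b * c * inner ℝ B C := fun a b c => by
    rw [norm_add_sq_real, norm_add_sq_real, inner_add_left, norm_smul, norm_smul, norm_smul]
    simp only [real_inner_smul_left, real_inner_smul_right, mul_pow, Real.norm_eq_abs, sq_abs]
    ring
  have hA : ‖A‖ ^ 2 ≤ 3 * ‖(1 : ℝ) • A + (1 / 2 : ℝ) • B + (1 / 3 : ℝ) • C‖ ^ 2
      + 3 / 4 * ‖B‖ ^ 2 + 1 / 3 * ‖C‖ ^ 2 := by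
    have e1 := sq_nonneg ‖(1 : ℝ) • A + (1 : ℝ) • B + (1 / 3 : ℝ) • C‖
    have e2 := sq_nonneg ‖(1 : ℝ) • A + (1 / 2 : ℝ) • B + (2 / 3 : ℝ) • C‖
    have e3 := sq_nonneg ‖(0 : ℝ) • A + (1 / 2 : ℝ) • B + (-1 / 3 : ℝ) • C‖
    rw [expand] at *
    linarith
  have hB : ‖B‖ ^ 2 ≤ 2 * ‖(0 : ℝ) • A + (1 : ℝ) • B + (1 : ℝ) • C‖ ^ 2 + 2 * ‖C‖ ^ 2 := by
    have e1 := sq_nonneg ‖(0 : ℝ) • A + (1 : ℝ) • B + (2 : ℝ) • C‖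
    rw [expand] at *
    linarith
  have h1 := sq_nonneg ‖(1 : ℝ) • A + (1 / 2 : ℝ) • B + (1 / 3 : ℝ) • C‖
  have h2 := sq_nonneg ‖(0 : ℝ) • A + (1 : ℝ) • B + (1 : ℝ) • C‖
  have h3 := sq_nonneg ‖C‖
  have e1 := expand 1 (1 / 2) (1 / 3)
  have e2 := expand 0 1 1
  linarith

theorem integral_norm_sq_quadratic (α β γ : E) (h : ℝ) :
    ∫ s in (0 : ℝ)..h, ‖α + s • β + s ^ 2 • γ‖ ^ 2 = h * ‖α‖ ^ 2 + h ^ 2 * inner ℝ α β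
      + h ^ 3 * (‖β‖ ^ 2 / 3 + 2 / 3 * inner ℝ α γ) + h ^ 4 * (inner ℝ β γ / 2)
      + h ^ 5 * (‖γ‖ ^ 2 / 5) := by
  have expand : ∀ s : ℝ, ‖α + s • β + s ^ 2 • γ‖ ^ 2 = ‖α‖ ^ 2 + 2 * s * inner ℝ α β
      + s ^ 2 * (‖β‖ ^ 2 + 2 * inner ℝ α γ) + s ^ 3 * (2 * inner ℝ β γ) + s ^ 4 * ‖γ‖ ^ 2 :=
    fun s => by
    rw [norm_add_sq_real, norm_add_sq_real, inner_add_left, norm_smul, norm_smul]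
    simp only [real_inner_smul_left, real_inner_smul_right, mul_pow, Real.norm_eq_abs, sq_abs]
    ring
  have hd : ∀ s : ℝ, HasDerivAt (fun h : ℝ => h * ‖α‖ ^ 2 + h ^ 2 * inner ℝ α β
      + h ^ 3 * (‖β‖ ^ 2 / 3 + 2 / 3 * inner ℝ α γ) + h ^ 4 * (inner ℝ β γ / 2)
      + h ^ 5 * (‖γ‖ ^ 2 / 5)) (‖α + s • β + s ^ 2 • γ‖ ^ 2) s := fun s => by
    rw [expand]
    have := (((((hasDerivAt_id s).mul_const (‖α‖ ^ 2)).add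
      ((hasDerivAt_pow 2 s).mul_const (inner ℝ α β))).add
      ((hasDerivAt_pow 3 s).mul_const (‖β‖ ^ 2 / 3 + 2 / 3 * inner ℝ α γ))).add
      ((hasDerivAt_pow 4 s).mul_const (inner ℝ β γ / 2))).add
      ((hasDerivAt_pow 5 s).mul_const (‖γ‖ ^ 2 / 5))
    refine this.congr_deriv ?_
    simp only [Nat.cast_ofNat, Nat.reduceSub]
    ring
  rw [intervalIntegral.integral_eq_sub_of_hasDerivAt (fun s _ => hd s)
    (Continuous.intervalIntegrable (by fun_prop) _ _)]
  simp

/-- The unit interval case rescaled, that is, applied to α, hβ, h²γ. -/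
theorem integral_norm_sq_quadratic_lower (α β γ : E) {h : ℝ} (hh : 0 ≤ h) :
    1 / 900 * (h * ‖α‖ ^ 2 + h ^ 3 * ‖β‖ ^ 2 + h ^ 5 * ‖γ‖ ^ 2) ≤
      ∫ s in (0 : ℝ)..h, ‖α + s • β + s ^ 2 • γ‖ ^ 2 := by
  rw [integral_norm_sq_quadratic]
  have := mul_le_mul_of_nonneg_left (quadratic_form_lower α (h • β) (h ^ 2 • γ)) hh
  simp only [norm_smul, real_inner_smul_left, real_inner_smul_right, mul_pow, Real.norm_eq_abs,
    sq_abs] at this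
  nlinarith [this]

/-- The position at time `t` of the Fourier characteristic. -/
def kap (k l m : E) (t : ℝ) : E := k + t • l + (t ^ 2 / 2) • m

/-- The velocity at time `t` of the Fourier characteristic. -/
def lam (l m : E) (t : ℝ) : E := l + t • m

/-- Taylor expansion of κ about either endpoint: κ(r + s) = κ(r) + sλ(r) + s²m/2 and κ(t − s) = κ(t)
− sλ(t) + s²m/2. The factor 1/2 on m turns 900 into 3600. Schur's test needs both endpoints. -/
theorem integral_kap_lower (k l m : E) {r t : ℝ} (h : r ≤ t) :
    1 / 3600 * ((t - r) * ‖kap k l m r‖ ^ 2 + (t - r) ^ 3 * ‖lam l m r‖ ^ 2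
      + (t - r) ^ 5 * ‖m‖ ^ 2) ≤ ∫ s in r..t, ‖kap k l m s‖ ^ 2 ∧
    1 / 3600 * ((t - r) * ‖kap k l m t‖ ^ 2 + (t - r) ^ 3 * ‖lam l m t‖ ^ 2
      + (t - r) ^ 5 * ‖m‖ ^ 2) ≤ ∫ s in r..t, ‖kap k l m s‖ ^ 2 := by
  have h0 : 0 ≤ t - r := sub_nonneg.2 h
  have p1 : ∀ v : E, 0 ≤ (t - r) * ‖v‖ ^ 2 := fun v => by positivity
  have p3 : ∀ v : E, 0 ≤ (t - r) ^ 3 * ‖v‖ ^ 2 := fun v => by positivity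
  have p5 : ∀ v : E, 0 ≤ (t - r) ^ 5 * ‖v‖ ^ 2 := fun v => by positivity
  constructor
  · have := integral_norm_sq_quadratic_lower (kap k l m r) (lam l m r) ((1 / 2 : ℝ) • m) h0
    have e : ∫ s in r..t, ‖kap k l m s‖ ^ 2 =
        ∫ s in (0 : ℝ)..(t - r), ‖kap k l m r + s • lam l m r + s ^ 2 • (1 / 2 : ℝ) • m‖ ^ 2 := by
      have := intervalIntegral.integral_comp_add_left (a := 0) (b := t - r)
        (fun s => ‖kap k l m s‖ ^ 2) r
      simp only [add_zero, add_sub_cancel] at this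
      rw [← this]
      congr 1
      ext s
      congr 2
      simp only [kap, lam]
      module
    rw [e]
    refine le_trans ?_ this
    rw [norm_smul, mul_pow]
    norm_num
    linarith [p1 (kap k l m r), p3 (lam l m r)]
  · have := integral_norm_sq_quadratic_lower (kap k l m t) (-lam l m t) ((1 / 2 : ℝ) • m) h0
    have e : ∫ s in r..t, ‖kap k l m s‖ ^ 2 =
        ∫ s in (0 : ℝ)..(t - r),
          ‖kap k l m t + s • (-lam l m t) + s ^ 2 • (1 / 2 : ℝ) • m‖ ^ 2 := by
      have := intervalIntegral.integral_comp_sub_left (a := 0) (b := t - r)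
        (fun s => ‖kap k l m s‖ ^ 2) t
      simp only [sub_zero, sub_sub_cancel] at this
      rw [← this]
      congr 1
      ext s
      congr 2
      simp only [kap, lam]
      module
    rw [e]
    refine le_trans ?_ this
    rw [norm_smul, mul_pow, norm_neg]
    norm_num
    linarith [p1 (kap k l m t), p3 (lam l m t)]

/-- The anisotropic weight controlling the maximal regularity estimate. -/
def wt (k l m : E) (t : ℝ) : ℝ :=
  ‖kap k l m t‖ ^ 2 + ‖lam l m t‖ ^ (2 / 3 : ℝ) + ‖m‖ ^ (2 / 5 : ℝ)

theorem wt_nonneg (k l m : E) (t : ℝ) : 0 ≤ wt k l m t := by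
  unfold wt
  positivity

theorem rpow_two_thirds_pow {B : ℝ} (hB : 0 ≤ B) : (B ^ (2 / 3 : ℝ)) ^ 3 = B ^ 2 := by
  rw [← Real.rpow_natCast, ← Real.rpow_mul hB, ← Real.rpow_natCast]
  norm_num

theorem rpow_two_fifths_pow {B : ℝ} (hB : 0 ≤ B) : (B ^ (2 / 5 : ℝ)) ^ 5 = B ^ 2 := by
  rw [← Real.rpow_natCast, ← Real.rpow_mul hB, ← Real.rpow_natCast]
  norm_num

/-- For x ≥ 0 both x³ and x⁵ are at least x − 1; take x = hB^{2/3} and x = hC^{2/5}. Being linear in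
h times the weight, the bound yields exponential decay. -/
theorem weight_exponent_lower {A B C h : ℝ} (hB : 0 ≤ B) (hC : 0 ≤ C) (hh : 0 ≤ h) :
    h * (A ^ 2 + B ^ (2 / 3 : ℝ) + C ^ (2 / 5 : ℝ)) - 2 ≤ h * A ^ 2 + h ^ 3 * B ^ 2 + h ^ 5 * C ^ 2 := by
  rw [← rpow_two_thirds_pow hB, ← rpow_two_fifths_pow hC, ← mul_pow, ← mul_pow]
  set b := B ^ (2 / 3 : ℝ)
  set c := C ^ (2 / 5 : ℝ)
  have hb : 0 ≤ h * b := by positivity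
  have hc : 0 ≤ h * c := by positivity
  have h3 : h * b - 1 ≤ (h * b) ^ 3 := by
    rcases le_total (h * b) 1 with h1 | h1
    · have : 0 ≤ (h * b) ^ 3 := by positivity
      linarith
    · have := le_self_pow₀ h1 (n := 3) (by norm_num)
      linarith
  have h5 : h * c - 1 ≤ (h * c) ^ 5 := by
    rcases le_total (h * c) 1 with h1 | h1
    · have : 0 ≤ (h * c) ^ 5 := by positivity
      linarith
    · have := le_self_pow₀ h1 (n := 5) (by norm_num)
      linarith
  linarith

/-- Here A, B, C stand for |κ|, |λ|, |m| at one time and A', B' for |κ|, |λ| at a time h later. With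
w the weight at the first time, B ≤ w^{3/2} and C ≤ w^{5/2}, so each term is at most w times a
polynomial of degree at most 4 in x = hw. -/
theorem weight_transport {A B C A' B' h : ℝ} (hB : 0 ≤ B) (hC : 0 ≤ C) (hh : 0 ≤ h)
    (hA' : 0 ≤ A') (hB' : 0 ≤ B') (h1 : A' ≤ A + h * B + h ^ 2 * C) (h2 : B' ≤ B + h * C) :
    A' ^ 2 + B' ^ (2 / 3 : ℝ) + C ^ (2 / 5 : ℝ) ≤
      10 * (A ^ 2 + B ^ (2 / 3 : ℝ) + C ^ (2 / 5 : ℝ)) *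
        (1 + h * (A ^ 2 + B ^ (2 / 3 : ℝ) + C ^ (2 / 5 : ℝ))) ^ 4 := by
  have e1 : A' ^ 2 ≤ 3 * (A ^ 2 + h ^ 2 * B ^ 2 + h ^ 4 * C ^ 2) := by
    calc A' ^ 2 ≤ (A + h * B + h ^ 2 * C) ^ 2 := by gcongr
      _ ≤ _ := by
        have s1 := sq_nonneg (A - h * B)
        have s2 := sq_nonneg (A - h ^ 2 * C)
        have s3 := sq_nonneg (h * B - h ^ 2 * C)
        linarith
  have e2 : B' ^ (2 / 3 : ℝ) ≤ B ^ (2 / 3 : ℝ) + (h * C) ^ (2 / 3 : ℝ) := by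
    calc B' ^ (2 / 3 : ℝ) ≤ (B + h * C) ^ (2 / 3 : ℝ) := by gcongr
      _ ≤ _ := Real.rpow_add_le_add_rpow hB (by positivity) (by norm_num) (by norm_num)
  -- With c = C^{2/5} one has (hC)^{2/3} = c (hc)^{2/3}, and x^{2/3} ≤ 1 + x.
  have e3 : (h * C) ^ (2 / 3 : ℝ) ≤ C ^ (2 / 5 : ℝ) * (1 + h * C ^ (2 / 5 : ℝ)) := by
    have hC5 : C = (C ^ (2 / 5 : ℝ)) ^ (5 / 2 : ℝ) := by
      rw [← Real.rpow_mul hC]; norm_num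
    have hc0 : 0 ≤ C ^ (2 / 5 : ℝ) := by positivity
    set c := C ^ (2 / 5 : ℝ)
    have : (h * C) ^ (2 / 3 : ℝ) = c * (h * c) ^ (2 / 3 : ℝ) := by
      rw [hC5, Real.mul_rpow hh (by positivity), Real.mul_rpow hh hc0, ← Real.rpow_mul hc0]
      have : c ^ (5 / 2 * (2 / 3) : ℝ) = c * c ^ (2 / 3 : ℝ) := by
        rw [← Real.rpow_one_add' hc0 (by norm_num)]
        norm_num
      rw [this]
      ring
    rw [this]
    gcongr
    have hx : 0 ≤ h * c := by positivity
    rcases le_total (h * c) 1 with h1 | h1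
    · have := Real.rpow_le_one hx h1 (z := (2 / 3 : ℝ)) (by norm_num)
      linarith
    · have := Real.rpow_le_rpow_of_exponent_le h1 (y := (2 / 3 : ℝ)) (z := 1) (by norm_num)
      rw [Real.rpow_one] at this
      linarith
  rw [← rpow_two_thirds_pow hB, ← rpow_two_fifths_pow hC] at e1
  have hb0 : 0 ≤ B ^ (2 / 3 : ℝ) := by positivity
  have hc0 : 0 ≤ C ^ (2 / 5 : ℝ) := by positivity
  set b := B ^ (2 / 3 : ℝ)
  set c := C ^ (2 / 5 : ℝ)
  set w := A ^ 2 + b + c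
  have hw : 0 ≤ w := by positivity
  have hbw : b ≤ w := by simp only [w]; nlinarith [sq_nonneg A]
  have hcw : c ≤ w := by simp only [w]; nlinarith [sq_nonneg A]
  have hAw : A ^ 2 ≤ w := by simp only [w]; linarith
  set x := h * w
  have hx : 0 ≤ x := by positivity
  have f1 : h ^ 2 * b ^ 3 ≤ w * x ^ 2 := by
    calc h ^ 2 * b ^ 3 ≤ h ^ 2 * w ^ 3 := by gcongr
      _ = _ := by simp only [x]; ring
  have f2 : h ^ 4 * c ^ 5 ≤ w * x ^ 4 := by
    calc h ^ 4 * c ^ 5 ≤ h ^ 4 * w ^ 5 := by gcongr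
      _ = _ := by simp only [x]; ring
  have f3 : c * (1 + h * c) ≤ w * (1 + x) := by
    simp only [x]; gcongr
  have f4 : 3 * (1 + x ^ 2 + x ^ 4) + 1 + (1 + x) + 1 ≤ 10 * (1 + x) ^ 4 := by
    nlinarith [pow_nonneg hx 2, pow_nonneg hx 3, pow_nonneg hx 4]
  calc A' ^ 2 + B' ^ (2 / 3 : ℝ) + c ≤ 3 * (w + w * x ^ 2 + w * x ^ 4) + w + w * (1 + x) + w := by
        linarith
    _ = w * (3 * (1 + x ^ 2 + x ^ 4) + 1 + (1 + x) + 1) := by ring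
    _ ≤ w * (10 * (1 + x) ^ 4) := by gcongr
    _ = _ := by ring

theorem one_add_le_exp_div {c x : ℝ} (hc : 0 < c) (hx : 0 ≤ x) :
    1 + x ≤ Real.exp (c * x) / min 1 c := by
  have hm : 0 < min 1 c := lt_min one_pos hc
  rw [le_div_iff₀ hm]
  calc (1 + x) * min 1 c = min 1 c + x * min 1 c := by ring
    _ ≤ 1 + x * c := by
        gcongr
        · exact min_le_left _ _
        · exact min_le_right _ _
    _ ≤ _ := by linarith [Real.add_one_le_exp (c * x)]

/-- Pointwise bounds for the weighted Duhamel kernel in terms of either endpoint. -/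
theorem exists_kernel_bound {δ : ℝ} (hδ : 0 < δ) :
    ∃ C c : ℝ, 0 ≤ C ∧ 0 < c ∧ ∀ (k l m : E) (q : ℝ → ℝ),
      (∀ a b, IntervalIntegrable q volume a b) → (∀ t, δ * ‖kap k l m t‖ ^ 2 ≤ q t) →
      ∀ r t, r ≤ t →
        (1 + wt k l m t) * Real.exp (-∫ s in r..t, q s) ≤
          1 + C * (wt k l m t * Real.exp (-(c * (wt k l m t * (t - r))))) ∧
        (1 + wt k l m t) * Real.exp (-∫ s in r..t, q s) ≤
          1 + C * (wt k l m r * Real.exp (-(c * (wt k l m r * (t - r))))) := by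
  -- The decay rate given by `integral_kap_lower` is c₀. Half of it is spent on absorbing the factor
  -- 10(1 + x)⁴ of `weight_transport`, by (1 + x)⁴ ≤ min(1, c₀/8)⁻⁴ e^{c₀x/2}; this explains `D` and
  -- the final rate c₀/2.
  set c₀ := δ / 3600 with hc₀
  have hc₀p : 0 < c₀ := by positivity
  set D := 10 * (min 1 (c₀ / 8))⁻¹ ^ 4 with hD
  have hm : 0 < min 1 (c₀ / 8) := lt_min one_pos (by positivity)
  have hD1 : 1 ≤ D := by
    have : 1 ≤ (min 1 (c₀ / 8))⁻¹ := (one_le_inv₀ hm).2 (min_le_left _ _)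
    have := one_le_pow₀ this (n := 4)
    linarith
  -- The factor e^{2c₀} pays for the −2 in `weight_exponent_lower`.
  refine ⟨Real.exp (2 * c₀) * D, c₀ / 2, by positivity, by positivity, ?_⟩
  intro k l m q hq hlow r t hrt
  have hh : 0 ≤ t - r := sub_nonneg.2 hrt
  have hQ : δ * ∫ s in r..t, ‖kap k l m s‖ ^ 2 ≤ ∫ s in r..t, q s := by
    rw [← intervalIntegral.integral_const_mul]
    refine intervalIntegral.integral_mono_on hrt ?_ (hq _ _) fun s _ => hlow s
    refine Continuous.intervalIntegrable ?_ _ _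
    unfold kap
    fun_prop
  obtain ⟨lr, lt⟩ := integral_kap_lower k l m hrt
  have Qr : c₀ * (wt k l m r * (t - r)) - 2 * c₀ ≤ ∫ s in r..t, q s := by
    have h1 := weight_exponent_lower (A := ‖kap k l m r‖) (norm_nonneg (lam l m r))
      (norm_nonneg m) hh
    have h2 := mul_le_mul_of_nonneg_left lr hδ.le
    have h3 := mul_le_mul_of_nonneg_left h1 hc₀p.le
    simp only [wt, hc₀] at h3 ⊢
    linarith
  have Qt : c₀ * (wt k l m t * (t - r)) - 2 * c₀ ≤ ∫ s in r..t, q s := by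
    have h1 := weight_exponent_lower (A := ‖kap k l m t‖) (norm_nonneg (lam l m t))
      (norm_nonneg m) hh
    have h2 := mul_le_mul_of_nonneg_left lt hδ.le
    have h3 := mul_le_mul_of_nonneg_left h1 hc₀p.le
    simp only [wt, hc₀] at h3 ⊢
    linarith
  have hone : Real.exp (-∫ s in r..t, q s) ≤ 1 := by
    rw [Real.exp_le_one_iff, neg_nonpos]
    refine intervalIntegral.integral_nonneg hrt fun s _ => le_trans ?_ (hlow s)
    positivity
  have hwt := wt_nonneg k l m t
  have hwr := wt_nonneg k l m r
  have hexp : ∀ w : ℝ, c₀ * (w * (t - r)) - 2 * c₀ ≤ ∫ s in r..t, q s →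
      Real.exp (-∫ s in r..t, q s) ≤ Real.exp (2 * c₀) * Real.exp (-(c₀ * (w * (t - r)))) :=
    fun w hw => by
    rw [← Real.exp_add, Real.exp_le_exp]
    linarith
  constructor
  · have h1 : Real.exp (-(c₀ * (wt k l m t * (t - r)))) ≤
        D * Real.exp (-(c₀ / 2 * (wt k l m t * (t - r)))) := by
      calc Real.exp (-(c₀ * (wt k l m t * (t - r))))
          ≤ 1 * Real.exp (-(c₀ / 2 * (wt k l m t * (t - r)))) := by
            rw [one_mul, Real.exp_le_exp]
            have : 0 ≤ c₀ * (wt k l m t * (t - r)) := by positivity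
            linarith
        _ ≤ _ := by gcongr
    calc (1 + wt k l m t) * Real.exp (-∫ s in r..t, q s)
        = Real.exp (-∫ s in r..t, q s) + wt k l m t * Real.exp (-∫ s in r..t, q s) := by ring
      _ ≤ 1 + wt k l m t * (Real.exp (2 * c₀) *
            (D * Real.exp (-(c₀ / 2 * (wt k l m t * (t - r)))))) := by
          gcongr
          exact (hexp _ Qt).trans (by gcongr)
      _ = _ := by ring
  · have htr : wt k l m t ≤ 10 * wt k l m r * (1 + (t - r) * wt k l m r) ^ 4 := by
      refine weight_transport (norm_nonneg _) (norm_nonneg _) hh (norm_nonneg _)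
        (norm_nonneg _) ?_ ?_
      · have e : kap k l m t = kap k l m r + (t - r) • lam l m r + ((t - r) ^ 2 / 2) • m := by
          simp only [kap, lam]
          module
        rw [e]
        refine (norm_add₃_le).trans ?_
        rw [norm_smul, norm_smul, Real.norm_of_nonneg hh, Real.norm_of_nonneg (by positivity)]
        gcongr
        have : 0 ≤ (t - r) ^ 2 := sq_nonneg _
        linarith
      · have e : lam l m t = lam l m r + (t - r) • m := by
          simp only [lam]
          module
        rw [e]
        refine (norm_add_le _ _).trans ?_
        rw [norm_smul, Real.norm_of_nonneg hh]
    set x := (t - r) * wt k l m r with hx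
    have hx0 : 0 ≤ x := by positivity
    have hpoly : (1 + x) ^ 4 ≤ (min 1 (c₀ / 8))⁻¹ ^ 4 * Real.exp (c₀ / 2 * x) := by
      calc (1 + x) ^ 4 ≤ (Real.exp (c₀ / 8 * x) / min 1 (c₀ / 8)) ^ 4 := by
            gcongr
            exact one_add_le_exp_div (by positivity) hx0
        _ = _ := by
            rw [div_eq_mul_inv, mul_pow, ← Real.exp_nat_mul, mul_comm]
            congr 2
            push_cast
            ring
    have e1 : wt k l m r * (t - r) = x := mul_comm _ _
    rw [e1]
    have hq2 := hexp _ Qr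
    rw [e1] at hq2
    calc (1 + wt k l m t) * Real.exp (-∫ s in r..t, q s)
        = Real.exp (-∫ s in r..t, q s) + wt k l m t * Real.exp (-∫ s in r..t, q s) := by ring
      _ ≤ 1 + (10 * wt k l m r * ((min 1 (c₀ / 8))⁻¹ ^ 4 * Real.exp (c₀ / 2 * x))) *
            (Real.exp (2 * c₀) * Real.exp (-(c₀ * x))) := by
          gcongr
          exact htr.trans (by gcongr)
      _ = 1 + Real.exp (2 * c₀) * D * (wt k l m r *
            (Real.exp (c₀ / 2 * x) * Real.exp (-(c₀ * x)))) := by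
          rw [hD]; ring
      _ = _ := by
          rw [← Real.exp_add]
          congr 4
          ring

end Kernel

/-! ### Maximal regularity of the scalar equation -/

section DuhamelBound

/-- The integral of w e^{−cw(t−r)} is at most 1/c whatever w is. This is the source of uniformity in
the frequency. -/
theorem lintegral_exp_kernel_left {C c w S t : ℝ} (hC : 0 ≤ C) (hc : 0 < c) (hw : 0 ≤ w)
    (hSt : S ≤ t) :
    ∫⁻ r in Set.Ioo S t, ENNReal.ofReal (1 + C * (w * Real.exp (-(c * (w * (t - r)))))) ≤
      ENNReal.ofReal (t - S + C / c) := by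
  have hd : ∀ r : ℝ, HasDerivAt (fun r => r + C / c * Real.exp (-(c * (w * (t - r)))))
      (1 + C * (w * Real.exp (-(c * (w * (t - r)))))) r := fun r => by
    have h1 : HasDerivAt (fun r : ℝ => -(c * (w * (t - r)))) (c * w) r := by
      have := ((((hasDerivAt_id r).const_sub t).const_mul w).const_mul c).fun_neg
      refine this.congr_deriv ?_
      ring
    refine ((hasDerivAt_id r).add (h1.exp.const_mul (C / c))).congr_deriv ?_
    field_simp
  have hcont : Continuous fun r : ℝ => 1 + C * (w * Real.exp (-(c * (w * (t - r))))) := by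
    fun_prop
  rw [restrict_Ioo_eq_restrict_Ioc, ← ofReal_integral_eq_lintegral_ofReal
    (hcont.integrableOn_Ioc) (Eventually.of_forall fun r => by positivity)]
  refine ENNReal.ofReal_le_ofReal ?_
  rw [← intervalIntegral.integral_of_le hSt,
    intervalIntegral.integral_eq_sub_of_hasDerivAt (fun r _ => hd r) (hcont.intervalIntegrable _ _)]
  have : 0 ≤ C / c * Real.exp (-(c * (w * (t - S)))) := by positivity
  simp only [sub_self, mul_zero, neg_zero, Real.exp_zero, mul_one]
  linarith

theorem lintegral_exp_kernel_right {C c w r T : ℝ} (hC : 0 ≤ C) (hc : 0 < c) (hw : 0 ≤ w)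
    (hrT : r ≤ T) :
    ∫⁻ t in Set.Ioo r T, ENNReal.ofReal (1 + C * (w * Real.exp (-(c * (w * (t - r)))))) ≤
      ENNReal.ofReal (T - r + C / c) := by
  have hd : ∀ t : ℝ, HasDerivAt (fun t => t - C / c * Real.exp (-(c * (w * (t - r)))))
      (1 + C * (w * Real.exp (-(c * (w * (t - r)))))) t := fun t => by
    have h1 : HasDerivAt (fun t : ℝ => -(c * (w * (t - r)))) (-(c * w)) t := by
      have := ((((hasDerivAt_id t).sub_const r).const_mul w).const_mul c).fun_neg
      refine this.congr_deriv ?_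
      ring
    refine ((hasDerivAt_id t).sub (h1.exp.const_mul (C / c))).congr_deriv ?_
    field_simp
    ring
  have hcont : Continuous fun t : ℝ => 1 + C * (w * Real.exp (-(c * (w * (t - r))))) := by
    fun_prop
  rw [restrict_Ioo_eq_restrict_Ioc, ← ofReal_integral_eq_lintegral_ofReal
    (hcont.integrableOn_Ioc) (Eventually.of_forall fun r => by positivity)]
  refine ENNReal.ofReal_le_ofReal ?_
  rw [← intervalIntegral.integral_of_le hrT,
    intervalIntegral.integral_eq_sub_of_hasDerivAt (fun r _ => hd r) (hcont.intervalIntegrable _ _)]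
  have : 0 ≤ C / c * Real.exp (-(c * (w * (T - r)))) := by positivity
  simp only [sub_self, mul_zero, neg_zero, Real.exp_zero, mul_one]
  linarith

theorem measurable_wt {E : Type*} [NormedAddCommGroup E] [InnerProductSpace ℝ E] (k l m : E) :
    Measurable (wt k l m) := by
  have h1 : Continuous (kap k l m) := by unfold kap; fun_prop
  have h2 : Continuous (lam l m) := by unfold lam; fun_prop
  unfold wt
  exact ((h1.norm.pow 2).measurable.add (h2.norm.measurable.pow_const _)).add_const _

theorem enorm_duhamel_le {S t : ℝ} (hSt : S ≤ t) {q : ℝ → ℝ}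
    (hq : ∀ a b, IntervalIntegrable q volume a b) (F : ℝ → ℂ) :
    ‖duhamel S q F t‖ₑ ≤
      ∫⁻ r in Set.Ioo S t, ENNReal.ofReal (Real.exp (-∫ s in r..t, q s)) * ‖F r‖ₑ := by
  have e : duhamel S q F t = ∫ r in Set.Ioo S t, (Real.exp (-∫ s in r..t, q s) : ℂ) * F r := by
    rw [duhamel, intervalIntegral.integral_of_le (f := fun r => _ * F r) hSt,
      integral_Ioc_eq_integral_Ioo, ← integral_const_mul]
    congr 1
    ext r
    rw [← mul_assoc, ← Complex.ofReal_mul, ← Real.exp_add,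
      ← intervalIntegral.integral_interval_sub_left (hq S t) (hq S r)]
    congr 3
    ring
  rw [e]
  refine (enorm_integral_le_lintegral_enorm _).trans (le_of_eq ?_)
  congr 1
  ext r
  rw [enorm_mul]
  congr 1
  rw [← ofReal_norm, Complex.norm_real, Real.norm_of_nonneg (Real.exp_pos _).le]

/-- Maximal regularity along one characteristic. -/
theorem exists_duhamel_bound (E : Type*) [NormedAddCommGroup E] [InnerProductSpace ℝ E]
    {δ : ℝ} (hδ : 0 < δ) (τ : ℝ) :
    ∃ N : ℝ≥0, ∀ (S T : ℝ), T - S = τ → ∀ (k l m : E) (q : ℝ → ℝ),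
      (∀ a b, IntervalIntegrable q volume a b) → (∀ t, δ * ‖kap k l m t‖ ^ 2 ≤ q t) →
      ∀ F : ℝ → ℂ, Measurable F →
        ∫⁻ t in Set.Ioo S T, ‖((1 + wt k l m t : ℝ) : ℂ) * duhamel S q F t‖ₑ ^ 2 ≤
          (N : ℝ≥0∞) ^ 2 * ∫⁻ t in Set.Ioo S T, ‖F t‖ₑ ^ 2 := by
  obtain ⟨C, c, hC, hc, hbound⟩ := exists_kernel_bound (E := E) hδ
  refine ⟨(τ + C / c).toNNReal, ?_⟩
  intro S T hST k l m q hq hlow F hF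
  have hQ : Continuous fun t => ∫ s in S..t, q s := intervalIntegral.continuous_primitive hq S
  have hw := wt_nonneg k l m
  -- The kernel is extended by zero to r ≥ t. Writing ∫_r^t q as a difference of primitives from S
  -- makes joint measurability a matter of continuity.
  let κ : ℝ → ℝ → ℝ≥0∞ := fun t r => (Set.Iio t).indicator (fun r => ENNReal.ofReal
    ((1 + wt k l m t) * Real.exp (-((∫ s in S..t, q s) - ∫ s in S..r, q s)))) r
  have hκm : Measurable (Function.uncurry κ) := by
    have h1 : Measurable fun p : ℝ × ℝ => ENNReal.ofReal
        ((1 + wt k l m p.1) * Real.exp (-((∫ s in S..p.1, q s) - ∫ s in S..p.2, q s))) := by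
      refine (((measurable_wt k l m).comp measurable_fst).const_add 1 |>.mul ?_).ennreal_ofReal
      exact Continuous.measurable (Real.continuous_exp.comp
        ((hQ.comp continuous_fst).sub (hQ.comp continuous_snd)).neg)
    have h2 : MeasurableSet {p : ℝ × ℝ | p.2 < p.1} := measurableSet_lt measurable_snd measurable_fst
    exact h1.indicator h2
  have hκ : ∀ t r, r < t → κ t r = ENNReal.ofReal
      ((1 + wt k l m t) * Real.exp (-∫ s in r..t, q s)) := fun t r hr => by
    simp only [κ, Set.indicator_of_mem (Set.mem_Iio.2 hr)]
    rw [intervalIntegral.integral_interval_sub_left (hq _ _) (hq _ _)]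
  have hsub : ∀ {t : ℝ}, t ∈ Set.Ioo S T → Set.Ioo S T ∩ Set.Iio t = Set.Ioo S t := fun {t} ht => by
    ext r
    simp only [Set.mem_inter_iff, Set.mem_Ioo, Set.mem_Iio]
    exact ⟨fun h => ⟨h.1.1, h.2⟩, fun h => ⟨⟨h.1, h.2.trans ht.2⟩, h.2⟩⟩
  have hsub' : ∀ {r : ℝ}, r ∈ Set.Ioo S T → Set.Ioo S T ∩ Set.Ioi r = Set.Ioo r T :=
    fun {r} hr => by
    ext t
    simp only [Set.mem_inter_iff, Set.mem_Ioo, Set.mem_Ioi]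
    exact ⟨fun h => ⟨h.2, h.1.2⟩, fun h => ⟨⟨hr.1.trans h.1, h.2⟩, h.1⟩⟩
  have hind : ∀ t, ∀ g : ℝ → ℝ≥0∞, ∫⁻ r in Set.Ioo S T, (Set.Iio t).indicator g r
      = ∫⁻ r in Set.Ioo S T ∩ Set.Iio t, g r := fun t g => by
    rw [lintegral_indicator measurableSet_Iio, Measure.restrict_restrict measurableSet_Iio,
      Set.inter_comm]
  have hle : ∀ {x : ℝ}, x ≤ τ + C / c → ENNReal.ofReal x ≤ ((τ + C / c).toNNReal : ℝ≥0∞) :=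
    fun h => ENNReal.ofReal_le_ofReal h
  -- Rows are integrated in r, so the bound with the weight frozen at t is the one to use.
  have hrow : ∀ᵐ t ∂volume.restrict (Set.Ioo S T),
      ∫⁻ r in Set.Ioo S T, κ t r ≤ ((τ + C / c).toNNReal : ℝ≥0∞) := by
    refine (ae_restrict_iff' measurableSet_Ioo).2 (Eventually.of_forall fun t ht => ?_)
    simp only [κ]
    rw [hind, hsub ht]
    refine le_trans (setLIntegral_mono' measurableSet_Ioo fun r hr => ?_)
      ((lintegral_exp_kernel_left (w := wt k l m t) hC hc (hw t) ht.1.le).trans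
        (hle (by linarith [ht.2])))
    rw [intervalIntegral.integral_interval_sub_left (hq _ _) (hq _ _)]
    exact ENNReal.ofReal_le_ofReal (hbound k l m q hq hlow r t hr.2.le).1
  -- Columns are integrated in t, where the weight at t varies; the bound with the weight frozen at
  -- r is used instead.
  have hcol : ∀ᵐ r ∂volume.restrict (Set.Ioo S T),
      ∫⁻ t in Set.Ioo S T, κ t r ≤ ((τ + C / c).toNNReal : ℝ≥0∞) := by
    refine (ae_restrict_iff' measurableSet_Ioo).2 (Eventually.of_forall fun r hr => ?_)
    have e : ∀ t, κ t r = (Set.Ioi r).indicator (fun t => ENNReal.ofReal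
        ((1 + wt k l m t) * Real.exp (-∫ s in r..t, q s))) t := fun t => by
      by_cases h : r < t
      · rw [hκ t r h, Set.indicator_of_mem (Set.mem_Ioi.2 h)]
      · rw [Set.indicator_of_notMem (by simpa using h)]
        simp only [κ]
        rw [Set.indicator_of_notMem (by simpa using h)]
    simp only [e]
    rw [lintegral_indicator measurableSet_Ioi, Measure.restrict_restrict measurableSet_Ioi,
      Set.inter_comm, hsub' hr]
    refine le_trans (setLIntegral_mono' measurableSet_Ioo fun t ht => ?_)
      ((lintegral_exp_kernel_right (w := wt k l m r) hC hc (hw r) hr.2.le).trans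
        (hle (by linarith [hr.1])))
    exact ENNReal.ofReal_le_ofReal (hbound k l m q hq hlow r t ht.1.le).2
  refine le_trans ?_ (schur_test hκm hF.enorm hrow hcol)
  refine setLIntegral_mono' measurableSet_Ioo fun t ht => ?_
  gcongr
  have e1 : ∫⁻ r in Set.Ioo S T, κ t r * ‖F r‖ₑ = ∫⁻ r in Set.Ioo S t, κ t r * ‖F r‖ₑ := by
    rw [← hsub ht, ← hind]
    congr 1
    ext r
    by_cases h : r < t
    · simp [h]
    · simp [κ, h]
  rw [e1, enorm_mul]
  refine (mul_le_mul_right (enorm_duhamel_le ht.1.le hq F) _).trans ?_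
  rw [← lintegral_const_mul' _ _ (by simp)]
  refine setLIntegral_mono' measurableSet_Ioo fun r hr => ?_
  rw [hκ t r hr.2, ← mul_assoc]
  gcongr
  rw [← ofReal_norm, Complex.norm_real, Real.norm_of_nonneg (by linarith [hw t]),
    ENNReal.ofReal_mul (by linarith [hw t])]

end DuhamelBound

/-! ### Integration by parts in time and a Volterra uniqueness statement -/

section TimeIntegration

/-- Fubini on the triangle S < r < t < T. It replaces integration by parts, and ψ need not vanish at
S because the primitive of K does. -/
theorem integral_primitive_mul {S T : ℝ} {K ψ ψ' : ℝ → ℂ} (hK : IntegrableOn K (Set.Ioo S T))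
    (hψ' : IntegrableOn ψ' (Set.Ioo S T))
    (hψ : ∀ r ∈ Set.Ioo S T, ψ r = -∫ t in Set.Ioo r T, ψ' t) :
    ∫ t in Set.Ioo S T, (∫ r in S..t, K r) * ψ' t = -∫ t in Set.Ioo S T, K t * ψ t := by
  have hm : MeasurableSet {p : ℝ × ℝ | p.2 < p.1} := measurableSet_lt measurable_snd measurable_fst
  have hint : Integrable ({p : ℝ × ℝ | p.2 < p.1}.indicator fun p => ψ' p.1 * K p.2)
      ((volume.restrict (Set.Ioo S T)).prod (volume.restrict (Set.Ioo S T))) :=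
    (Integrable.mul_prod hψ' hK).indicator hm
  have e1 : ∫ t in Set.Ioo S T, (∫ r in S..t, K r) * ψ' t = ∫ t in Set.Ioo S T,
      ∫ r in Set.Ioo S T, ({p : ℝ × ℝ | p.2 < p.1}.indicator fun p => ψ' p.1 * K p.2) (t, r) := by
    refine setIntegral_congr_fun measurableSet_Ioo fun t ht => ?_
    have : ∀ r, ({p : ℝ × ℝ | p.2 < p.1}.indicator fun p => ψ' p.1 * K p.2) (t, r)
        = (Set.Iio t).indicator (fun r => ψ' t * K r) r := fun r => rfl
    simp only [this]
    rw [setIntegral_indicator measurableSet_Iio, integral_const_mul, mul_comm,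
      intervalIntegral.integral_of_le ht.1.le, integral_Ioc_eq_integral_Ioo]
    congr 3
    ext r
    simp only [Set.mem_inter_iff, Set.mem_Ioo, Set.mem_Iio]
    exact ⟨fun h => ⟨⟨h.1, h.2.trans ht.2⟩, h.2⟩, fun h => ⟨h.1.1, h.2⟩⟩
  rw [e1, integral_integral_swap (f := fun t r =>
    ({p : ℝ × ℝ | p.2 < p.1}.indicator fun p => ψ' p.1 * K p.2) (t, r)) hint, ← integral_neg]
  refine setIntegral_congr_fun measurableSet_Ioo fun r hr => ?_
  have : ∀ t, ({p : ℝ × ℝ | p.2 < p.1}.indicator fun p => ψ' p.1 * K p.2) (t, r)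
      = (Set.Ioi r).indicator (fun t => ψ' t * K r) t := fun t => rfl
  simp only [this]
  rw [setIntegral_indicator measurableSet_Ioi, integral_mul_const, hψ r hr, mul_neg, neg_neg,
    mul_comm]
  congr 3
  ext t
  simp only [Set.mem_inter_iff, Set.mem_Ioo, Set.mem_Ioi]
  exact ⟨fun h => ⟨h.2, h.1.2⟩, fun h => ⟨⟨hr.1.trans h.1, h.2⟩, h.1⟩⟩

/-- The right side of the equation is a continuous representative Z of Y with |Z(t)| ≤ K ∫_S^t |Z|,
and Gronwall applied to M(t) = ∫_S^t |Z| gives M = 0. -/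
theorem ae_eq_zero_of_volterra {S T K : ℝ} {q : ℝ → ℝ} {Y : ℝ → ℂ}
    (hqm : AEStronglyMeasurable q (volume.restrict (Set.Ioo S T)))
    (hK : ∀ t ∈ Set.Ioo S T, |q t| ≤ K) (hYi : IntegrableOn Y (Set.Ioo S T))
    (hY : ∀ᵐ t ∂volume.restrict (Set.Ioo S T), Y t = -∫ r in S..t, q r * Y r) :
    ∀ᵐ t ∂volume.restrict (Set.Ioo S T), Y t = 0 := by
  rcases le_or_gt T S with hTS | hST
  · simp [Set.Ioo_eq_empty (not_lt.2 hTS)]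
  have hK0 : 0 ≤ K := by
    obtain ⟨t, ht⟩ := Set.nonempty_Ioo.2 hST
    exact (abs_nonneg _).trans (hK t ht)
  have hpi : IntegrableOn (fun r => (q r : ℂ) * Y r) (Set.Ioo S T) := by
    refine Integrable.bdd_mul (c := K) hYi ?_ ?_
    · exact Complex.continuous_ofReal.comp_aestronglyMeasurable hqm
    · refine (ae_restrict_iff' measurableSet_Ioo).2 (Eventually.of_forall fun t ht => ?_)
      simpa using hK t ht
  -- Extension by zero makes the integrand integrable on ℝ, so that its primitive is continuous
  -- everywhere.
  let p : ℝ → ℂ := (Set.Ioo S T).indicator fun r => (q r : ℂ) * Y r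
  have hp : Integrable p := (integrable_indicator_iff measurableSet_Ioo).2 hpi
  let Z : ℝ → ℂ := fun t => -∫ r in S..t, p r
  have hZc : Continuous Z :=
    (intervalIntegral.continuous_primitive (fun a b => hp.intervalIntegrable) S).neg
  have hYZ : ∀ᵐ t ∂volume.restrict (Set.Ioo S T), Y t = Z t := by
    filter_upwards [hY, ae_restrict_mem measurableSet_Ioo] with t h1 ht
    rw [h1]
    simp only [Z]
    rw [intervalIntegral.integral_of_le ht.1.le, intervalIntegral.integral_of_le ht.1.le]
    congr 1
    refine setIntegral_congr_fun measurableSet_Ioc fun r hr => ?_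
    simp only [p]
    rw [Set.indicator_of_mem (show r ∈ Set.Ioo S T from ⟨hr.1, hr.2.trans_lt ht.2⟩)]
  let M : ℝ → ℝ := fun t => ∫ r in S..t, ‖Z r‖
  have hM : ∀ t, HasDerivAt M ‖Z t‖ t := fun t =>
    intervalIntegral.integral_hasDerivAt_right (hZc.norm.intervalIntegrable _ _)
      hZc.norm.stronglyMeasurable.stronglyMeasurableAtFilter hZc.norm.continuousAt
  have hZM : ∀ t ∈ Set.Ico S T, ‖Z t‖ ≤ K * ‖M t‖ := by
    intro t ht
    have hM0 : 0 ≤ M t := intervalIntegral.integral_nonneg ht.1 fun r _ => norm_nonneg _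
    rw [Real.norm_of_nonneg hM0]
    have e : ‖Z t‖ = ‖∫ r in S..t, p r‖ := norm_neg _
    rw [e]
    simp only [M]
    rw [← intervalIntegral.integral_const_mul]
    refine intervalIntegral.norm_integral_le_of_norm_le ht.1 ?_
      ((hZc.norm.const_mul K).intervalIntegrable _ _)
    have := (ae_restrict_iff' measurableSet_Ioo).1 hYZ
    filter_upwards [this] with r hr hrt
    have hmem : r ∈ Set.Ioo S T := ⟨hrt.1, hrt.2.trans_lt ht.2⟩
    simp only [p]
    rw [Set.indicator_of_mem hmem, hr hmem, norm_mul]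
    gcongr
    simpa using hK r hmem
  have hg := norm_le_gronwallBound_of_norm_deriv_right_le (f := M) (f' := fun t => ‖Z t‖)
    (δ := 0) (K := K) (ε := 0) (a := S) (b := T)
    (fun t _ => (hM t).continuousAt.continuousWithinAt)
    (fun t _ => (hM t).hasDerivWithinAt) (by simp [M])
    (fun t ht => by simpa using hZM t ht)
  filter_upwards [hYZ, ae_restrict_mem measurableSet_Ioo] with t h1 ht
  have h2 := hg t ⟨ht.1.le, ht.2.le⟩
  rw [gronwallBound_ε0_δ0] at h2
  have h3 := hZM t ⟨ht.1.le, ht.2⟩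
  have h4 : ‖Z t‖ ≤ 0 := h3.trans (by nlinarith)
  rw [h1]
  simpa using h4

end TimeIntegration

/-! ### The fractional Laplacian on test functions and its symbol -/

section Fractional

variable {d : ℕ} {s : ℝ}

/-- In polar coordinates the radial density is at most ar^{−2s} near 0, integrable as 2s < 1, and at
most br^{−1−2s} at infinity, integrable as s > 0. -/
theorem integrable_min_div_norm_rpow (hs₀ : 0 < s) (hs₁ : s < 1 / 2) {a b : ℝ} (ha : 0 ≤ a)
    (hb : 0 ≤ b) :
    Integrable fun w : E d => min (a * ‖w‖) b / ‖w‖ ^ ((d : ℝ) + 2 * s) := by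
  -- Polar coordinates require a nontrivial space; in dimension zero the integrand vanishes.
  rcases Nat.eq_zero_or_pos d with rfl | hd
  · have : (fun w : E 0 => min (a * ‖w‖) b / ‖w‖ ^ (((0 : ℕ) : ℝ) + 2 * s)) = fun _ => 0 := by
      ext w
      have : w = 0 := Subsingleton.elim _ _
      simp [this, hb]
    rw [this]
    exact integrable_zero _ _ _
  have hfin : Module.finrank ℝ (E d) = d := by simp
  have : Nontrivial (E d) := Module.nontrivial_of_finrank_pos (R := ℝ) (by omega)
  refine (integrable_fun_norm_addHaar (volume : Measure (E d))
    (f := fun y => min (a * y) b / y ^ ((d : ℝ) + 2 * s))).2 ?_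
  rw [hfin]
  have hm : Measurable fun y : ℝ => y ^ (d - 1) • (min (a * y) b / y ^ ((d : ℝ) + 2 * s)) := by
    refine (measurable_id.pow_const _).mul (Measurable.div ?_ (measurable_id.pow_const _))
    exact (measurable_id.const_mul a).min measurable_const
  have hform : ∀ y : ℝ, 0 < y → ∀ x : ℝ,
      y ^ (d - 1) • (x / y ^ ((d : ℝ) + 2 * s)) = x * y ^ (-1 - 2 * s) := fun y hy x => by
    have h1 : y ^ (d - 1) = y ^ ((d : ℝ) - 1) := by
      rw [← Real.rpow_natCast, Nat.cast_sub hd, Nat.cast_one]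
    rw [smul_eq_mul, h1, div_eq_mul_inv, ← Real.rpow_neg hy.le, mul_left_comm, ← Real.rpow_add hy]
    congr 2
    ring
  rw [← Set.Ioc_union_Ioi_eq_Ioi (zero_le_one (α := ℝ))]
  refine IntegrableOn.union ?_ ?_
  · have h1 : IntegrableOn (fun y : ℝ => a * y ^ (-(2 * s))) (Set.Ioc 0 1) := by
      have := intervalIntegral.intervalIntegrable_rpow' (a := 0) (b := 1) (r := -(2 * s))
        (by linarith)
      exact ((intervalIntegrable_iff_integrableOn_Ioc_of_le zero_le_one).1 this).const_mul a
    refine Integrable.mono' h1 hm.aestronglyMeasurable ?_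
    refine (ae_restrict_iff' measurableSet_Ioc).2 (Eventually.of_forall fun y hy => ?_)
    have hy0 := hy.1
    have h0 : 0 ≤ min (a * y) b := le_min (by positivity) hb
    rw [hform y hy.1, Real.norm_of_nonneg (by positivity)]
    calc min (a * y) b * y ^ (-1 - 2 * s) ≤ (a * y) * y ^ (-1 - 2 * s) := by
          gcongr
          exact min_le_left _ _
      _ = a * (y ^ (1 : ℝ) * y ^ (-1 - 2 * s)) := by rw [Real.rpow_one]; ring
      _ = _ := by
          rw [← Real.rpow_add hy.1]
          congr 2
          ring
  · have h1 : IntegrableOn (fun y : ℝ => b * y ^ (-1 - 2 * s)) (Set.Ioi 1) :=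
      (integrableOn_Ioi_rpow_of_lt (by linarith) one_pos).const_mul b
    refine Integrable.mono' h1 hm.aestronglyMeasurable ?_
    refine (ae_restrict_iff' measurableSet_Ioi).2 (Eventually.of_forall fun y hy => ?_)
    have hy0 : 0 < y := one_pos.trans hy
    have h0 : 0 ≤ min (a * y) b := le_min (by positivity) hb
    rw [hform y hy0, Real.norm_of_nonneg (by positivity)]
    gcongr
    exact min_le_right _ _

/-- The Fourier symbol of the fractional Laplacian. -/
def fracSymbol (d : ℕ) (s : ℝ) (l : E d) : ℂ :=
  fracConst d s * ∫ w : E d, (1 - (Real.fourierChar (-inner ℝ w l) : ℂ)) /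
    (‖w‖ ^ ((d : ℝ) + 2 * s) : ℝ)

theorem norm_one_sub_fourierChar_le (x : ℝ) :
    ‖1 - (Real.fourierChar (-x) : ℂ)‖ ≤ min (2 * Real.pi * |x|) 2 := by
  refine le_min ?_ ?_
  · rw [Real.fourierChar_apply, norm_sub_rev]
    have h := Real.norm_exp_I_mul_ofReal_sub_one_le (x := 2 * Real.pi * -x)
    rw [mul_comm Complex.I] at h
    refine h.trans (le_of_eq ?_)
    rw [Real.norm_eq_abs, abs_mul, abs_neg, abs_of_pos Real.two_pi_pos]
  · refine (norm_sub_le _ _).trans ?_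
    rw [Circle.norm_coe]
    norm_num

theorem norm_fracSymbol_integrand_le (w l : E d) :
    ‖(1 - (Real.fourierChar (-inner ℝ w l) : ℂ)) / (‖w‖ ^ ((d : ℝ) + 2 * s) : ℝ)‖ ≤
      min (2 * Real.pi * ‖l‖ * ‖w‖) 2 / ‖w‖ ^ ((d : ℝ) + 2 * s) := by
  rw [norm_div, Complex.norm_real, Real.norm_of_nonneg (by positivity)]
  gcongr
  refine (norm_one_sub_fourierChar_le _).trans (min_le_min ?_ le_rfl)
  rw [mul_assoc, mul_assoc, mul_assoc, mul_comm ‖l‖]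
  have := abs_real_inner_le_norm w l
  gcongr

/-- Rescaling w by ‖l‖ shows that the bound for the integral is homogeneous of degree 2s. Only this
upper bound is needed, so neither the exact symbol nor the value of `fracConst` enters. -/
theorem exists_norm_fracSymbol_le (d : ℕ) (hs₀ : 0 < s) (hs₁ : s < 1 / 2) :
    ∃ C : ℝ, 0 ≤ C ∧ ∀ l : E d, ‖fracSymbol d s l‖ ≤ C * ‖l‖ ^ (2 * s) := by
  let f : E d → ℝ := fun w => min (2 * Real.pi * ‖w‖) 2 / ‖w‖ ^ ((d : ℝ) + 2 * s)
  have hf0 : ∀ w, 0 ≤ f w := fun w => by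
    have : 0 ≤ min (2 * Real.pi * ‖w‖) 2 := le_min (by positivity) zero_le_two
    positivity
  refine ⟨|fracConst d s| * ∫ w, f w, mul_nonneg (abs_nonneg _) (integral_nonneg hf0), ?_⟩
  intro l
  rw [fracSymbol, norm_mul, Complex.norm_real, Real.norm_eq_abs, mul_assoc]
  gcongr
  refine (norm_integral_le_of_norm_le (integrable_min_div_norm_rpow hs₀ hs₁ (by positivity)
    zero_le_two) (Eventually.of_forall fun w => norm_fracSymbol_integrand_le w l)).trans ?_
  rcases eq_or_ne l 0 with rfl | hl
  · simp only [norm_zero, mul_zero, zero_mul]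
    rw [Real.zero_rpow (by positivity)]
    simp
  have hR : 0 < ‖l‖ := norm_pos_iff.2 hl
  have e : ∀ w : E d, min (2 * Real.pi * ‖l‖ * ‖w‖) 2 / ‖w‖ ^ ((d : ℝ) + 2 * s)
      = ‖l‖ ^ ((d : ℝ) + 2 * s) * f (‖l‖ • w) := fun w => by
    simp only [f, norm_smul, norm_norm]
    rw [Real.mul_rpow hR.le (norm_nonneg w), ← mul_assoc (2 * Real.pi)]
    have : ‖l‖ ^ ((d : ℝ) + 2 * s) ≠ 0 := (Real.rpow_pos_of_pos hR _).ne'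
    rw [mul_div_assoc', mul_div_mul_left _ _ this]
  simp only [e]
  rw [integral_const_mul, Measure.integral_comp_smul]
  have hfin : Module.finrank ℝ (E d) = d := by simp
  rw [hfin, smul_eq_mul, abs_of_pos (by positivity), Real.rpow_add hR, Real.rpow_natCast]
  have : ‖l‖ ^ d ≠ 0 := (pow_pos hR d).ne'
  refine le_of_eq ?_
  field_simp

theorem measurable_norm_rpow (a : ℝ) : Measurable fun w : E d => ‖w‖ ^ a :=
  measurable_norm.pow_const a

theorem stronglyMeasurable_fracSymbol (d : ℕ) (s : ℝ) : StronglyMeasurable (fracSymbol d s) := by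
  unfold fracSymbol
  refine StronglyMeasurable.const_mul ?_ _
  refine StronglyMeasurable.integral_prod_right (f := fun l w : E d =>
    (1 - (Real.fourierChar (-inner ℝ w l) : ℂ)) / (‖w‖ ^ ((d : ℝ) + 2 * s) : ℝ)) ?_
  refine Measurable.stronglyMeasurable ?_
  refine Measurable.div ?_ ?_
  · refine (Continuous.measurable ?_).const_sub 1
    exact continuous_subtype_val.comp (Real.continuous_fourierChar.comp (by fun_prop))
  · exact Complex.measurable_ofReal.comp ((measurable_norm_rpow _).comp measurable_snd)

section Difference

variable {P : Type*} [NormedAddCommGroup P] [NormedSpace ℝ P]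

/-- The fractional Laplacian along the image of `τ`. -/
def fracLapDir (s : ℝ) (τ : E d →L[ℝ] P) (φ : P → ℝ) (X : P) : ℝ :=
  fracConst d s * ∫ w : E d, (φ X - φ (X - τ w)) / ‖w‖ ^ ((d : ℝ) + 2 * s)

theorem exists_difference_bound {φ : P → ℝ} (hφ : ContDiff ℝ ∞ φ) (hc : HasCompactSupport φ)
    (τ : E d →L[ℝ] P) :
    ∃ a b : ℝ, 0 ≤ a ∧ 0 ≤ b ∧ ∀ X w, |φ X - φ (X - τ w)| ≤ min (a * ‖w‖) b := by
  obtain ⟨L, hL⟩ := hφ.lipschitzWith_of_hasCompactSupport hc (by simp)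
  obtain ⟨B, hB⟩ := hφ.continuous.bounded_above_of_compact_support hc
  have hB0 : 0 ≤ B := (norm_nonneg _).trans (hB 0)
  refine ⟨L * ‖τ‖, 2 * B, by positivity, by positivity, fun X w => le_min ?_ ?_⟩
  · have := hL.dist_le_mul X (X - τ w)
    rw [Real.dist_eq] at this
    refine this.trans ?_
    rw [dist_eq_norm, sub_sub_cancel, mul_assoc]
    gcongr
    exact τ.le_opNorm w
  · refine (abs_sub _ _).trans ?_
    have h1 := hB X
    have h2 := hB (X - τ w)
    rw [Real.norm_eq_abs] at h1 h2
    linarith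

theorem exists_abs_fracLapDir_le (hs₀ : 0 < s) (hs₁ : s < 1 / 2) {φ : P → ℝ}
    (hφ : ContDiff ℝ ∞ φ) (hc : HasCompactSupport φ) (τ : E d →L[ℝ] P) :
    ∃ B : ℝ, ∀ X, |fracLapDir s τ φ X| ≤ B := by
  obtain ⟨a, b, ha, hb, hab⟩ := exists_difference_bound hφ hc τ
  refine ⟨|fracConst d s| * ∫ w : E d, min (a * ‖w‖) b / ‖w‖ ^ ((d : ℝ) + 2 * s), fun X => ?_⟩
  rw [fracLapDir, abs_mul]
  gcongr
  rw [← Real.norm_eq_abs]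
  refine norm_integral_le_of_norm_le (integrable_min_div_norm_rpow hs₀ hs₁ ha hb)
    (Eventually.of_forall fun w => ?_)
  rw [norm_div, Real.norm_of_nonneg (by positivity : 0 ≤ ‖w‖ ^ ((d : ℝ) + 2 * s))]
  gcongr
  exact hab X w

variable [MeasurableSpace P] [BorelSpace P] (μ : Measure P)
  [SFinite μ] [μ.IsAddLeftInvariant] [IsFiniteMeasureOnCompacts μ]

/-- For fixed w the difference is supported in the support K of φ and one translate of it, so its L¹
norm is at most 2μ(K) min(a‖w‖, b), which is integrable against ‖w‖^{−d−2s}. Joint integrability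
licenses Fubini below. -/
theorem integrable_difference_quotient_prod (hs₀ : 0 < s) (hs₁ : s < 1 / 2) {φ : P → ℝ}
    (hφ : ContDiff ℝ ∞ φ) (hc : HasCompactSupport φ) (τ : E d →L[ℝ] P) :
    Integrable (fun p : P × E d => (φ p.1 - φ (p.1 - τ p.2)) / ‖p.2‖ ^ ((d : ℝ) + 2 * s))
      (μ.prod volume) := by
  obtain ⟨a, b, ha, hb, hab⟩ := exists_difference_bound hφ hc τ
  have hφc := hφ.continuous
  have hi : Integrable φ μ := hφc.integrable_of_hasCompactSupport hc
  have hit : ∀ v : P, Integrable (fun X => φ (X - v)) μ := fun v => hi.comp_sub_right v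
  have hm : Measurable fun p : P × E d =>
      (φ p.1 - φ (p.1 - τ p.2)) / ‖p.2‖ ^ ((d : ℝ) + 2 * s) := by
    refine Measurable.div ?_ ((measurable_norm_rpow _).comp measurable_snd)
    exact Continuous.measurable (by fun_prop)
  refine (integrable_prod_iff' hm.aestronglyMeasurable).2 ⟨Eventually.of_forall fun w => by
    exact (hi.sub (hit (τ w))).div_const (‖w‖ ^ ((d : ℝ) + 2 * s)), ?_⟩
  set K := tsupport φ with hK
  have hKc : IsCompact K := hc
  set κ := μ.real K
  refine Integrable.mono' (integrable_min_div_norm_rpow hs₀ hs₁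
    (a := 2 * κ * a) (b := 2 * κ * b) (by positivity) (by positivity)) ?_
    (Eventually.of_forall fun w => ?_)
  · exact hm.norm.stronglyMeasurable.integral_prod_left'.aestronglyMeasurable
  · have hN : 0 ≤ ‖w‖ ^ ((d : ℝ) + 2 * s) := by positivity
    rw [Real.norm_of_nonneg (integral_nonneg fun X => norm_nonneg _)]
    simp only [norm_div, Real.norm_of_nonneg hN]
    rw [integral_div]
    gcongr
    set m := min (a * ‖w‖) b with hmdef
    have hm0 : 0 ≤ m := le_min (by positivity) hb
    have hmm : min (2 * κ * a * ‖w‖) (2 * κ * b) = 2 * κ * m := by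
      rw [hmdef, mul_min_of_nonneg _ _ (by positivity)]
      congr 1
      ring
    rw [hmm]
    have hKv : IsCompact ((fun X => X - τ w) ⁻¹' K) :=
      (Homeomorph.subRight (τ w)).isClosedEmbedding.isCompact_preimage hKc
    have hKvm : μ.real ((fun X => X - τ w) ⁻¹' K) = κ := by
      simp only [κ, Measure.real, sub_eq_add_neg]
      rw [measure_preimage_add_right]
    calc ∫ X, ‖φ X - φ (X - τ w)‖ ∂μ
        ≤ ∫ X, (K.indicator (fun _ => m) X + ((fun X => X - τ w) ⁻¹' K).indicator (fun _ => m) X)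
            ∂μ := by
          refine integral_mono ((hi.sub (hit (τ w))).norm) ?_ fun X => ?_
          · refine Integrable.add ?_ ?_
            · exact (integrable_indicator_iff hKc.measurableSet).2
                (integrableOn_const hKc.measure_lt_top.ne)
            · exact (integrable_indicator_iff hKv.measurableSet).2
                (integrableOn_const hKv.measure_lt_top.ne)
          · by_cases h1 : X ∈ K
            · rw [Set.indicator_of_mem h1]
              have : 0 ≤ ((fun X => X - τ w) ⁻¹' K).indicator (fun _ => m) X :=
                Set.indicator_nonneg (fun _ _ => hm0) _
              have h3 := hab X w
              simp only [Real.norm_eq_abs]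
              linarith
            · by_cases h2 : X - τ w ∈ K
              · rw [Set.indicator_of_mem (s := (fun X => X - τ w) ⁻¹' K) h2]
                have : 0 ≤ K.indicator (fun _ => m) X := Set.indicator_nonneg (fun _ _ => hm0) _
                have h3 := hab X w
                simp only [Real.norm_eq_abs]
                linarith
              · rw [image_eq_zero_of_notMem_tsupport h1, image_eq_zero_of_notMem_tsupport h2]
                simp only [sub_self, norm_zero]
                exact add_nonneg (Set.indicator_nonneg (fun _ _ => hm0) _)
                  (Set.indicator_nonneg (fun _ _ => hm0) _)
      _ = 2 * κ * m := by
          rw [integral_add, integral_indicator_const _ hKc.measurableSet,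
            integral_indicator_const _ hKv.measurableSet, hKvm]
          · simp only [smul_eq_mul, κ]
            ring
          · exact (integrable_indicator_iff hKc.measurableSet).2
              (integrableOn_const hKc.measure_lt_top.ne)
          · exact (integrable_indicator_iff hKv.measurableSet).2
              (integrableOn_const hKv.measure_lt_top.ne)

theorem integrable_fracLapDir (hs₀ : 0 < s) (hs₁ : s < 1 / 2) {φ : P → ℝ}
    (hφ : ContDiff ℝ ∞ φ) (hc : HasCompactSupport φ) (τ : E d →L[ℝ] P) :
    Integrable (fracLapDir s τ φ) μ :=
  (integrable_difference_quotient_prod μ hs₀ hs₁ hφ hc τ).integral_prod_left.const_mul _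

theorem memLp_two_of_integrable_of_bounded {α : Type*} [MeasurableSpace α] {μ : Measure α}
    {f : α → ℝ} (hf : Integrable f μ) {B : ℝ} (hB : ∀ x, |f x| ≤ B) : MemLp f 2 μ := by
  refine (memLp_two_iff_integrable_sq hf.1).2 ?_
  refine Integrable.mono' (hf.norm.const_mul B) (hf.1.pow 2) (Eventually.of_forall fun x => ?_)
  rw [norm_pow, pow_two]
  gcongr
  exact hB x

/-- The fractional Laplacian destroys compact support; being bounded and integrable is what remains,
and this is why the transform is paired with the class `Adm` instead of test functions. -/
theorem memLp_fracLapDir (hs₀ : 0 < s) (hs₁ : s < 1 / 2) {φ : P → ℝ}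
    (hφ : ContDiff ℝ ∞ φ) (hc : HasCompactSupport φ) (τ : E d →L[ℝ] P) :
    MemLp (fracLapDir s τ φ) 2 μ := by
  obtain ⟨B, hB⟩ := exists_abs_fracLapDir_le hs₀ hs₁ hφ hc τ
  exact memLp_two_of_integrable_of_bounded (integrable_fracLapDir μ hs₀ hs₁ hφ hc τ) hB

end Difference

variable {V : Type*} [NormedAddCommGroup V] [InnerProductSpace ℝ V] [FiniteDimensional ℝ V]
  [MeasurableSpace V] [BorelSpace V]

theorem fourier_comp_sub (g : V → ℂ) (v ζ : V) :
    𝓕 (fun p => g (p - v)) ζ = (Real.fourierChar (-inner ℝ v ζ) : ℂ) * 𝓕 g ζ := by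
  have := congrFun (VectorFourier.fourierIntegral_comp_add_right Real.fourierChar
    (volume : Measure V) (innerₗ V) g (-v)) ζ
  simp only [innerₗ_apply_apply, inner_neg_left, Circle.smul_def, smul_eq_mul] at this
  simp only [sub_eq_add_neg]
  exact this

/-- Translation by Jw multiplies the transform by the character at ⟨Jw, ζ⟩ = ⟨w, l⟩, and Fubini
takes the integral in w outside. Thus l is the frequency seen along the image of J. -/
theorem fourier_fracLapDir (hs₀ : 0 < s) (hs₁ : s < 1 / 2) {g : V → ℝ} (hg : ContDiff ℝ ∞ g)
    (hc : HasCompactSupport g) (J : E d →L[ℝ] V) {ζ : V} {l : E d}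
    (hl : ∀ w, inner ℝ (J w) ζ = inner ℝ w l) :
    𝓕 (fun p => (fracLapDir s J g p : ℂ)) ζ = fracSymbol d s l * 𝓕 (fun p => (g p : ℂ)) ζ := by
  have hgc := hg.continuous
  have hi : Integrable fun p => (g p : ℂ) :=
    (hgc.integrable_of_hasCompactSupport hc).ofReal
  have hit : ∀ v : V, Integrable fun p => (g (p - v) : ℂ) := fun v => hi.comp_sub_right v
  have hprod := integrable_difference_quotient_prod (volume : Measure V) hs₀ hs₁ hg hc J
  let k : V → E d → ℂ := fun p w => (Real.fourierChar (-inner ℝ p ζ) : ℂ) *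
    (((g p - g (p - J w)) / ‖w‖ ^ ((d : ℝ) + 2 * s) : ℝ) : ℂ)
  have hk : Integrable (Function.uncurry k) (volume.prod volume) := by
    refine Integrable.bdd_mul (c := 1) hprod.ofReal ?_ ?_
    · refine Continuous.aestronglyMeasurable ?_
      exact continuous_subtype_val.comp (Real.continuous_fourierChar.comp (by fun_prop))
    · exact Eventually.of_forall fun p => (Circle.norm_coe _).le
  have e1 : 𝓕 (fun p => (fracLapDir s J g p : ℂ)) ζ = fracConst d s * ∫ p, ∫ w, k p w := by
    rw [Real.fourier_eq, ← integral_const_mul]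
    congr 1
    ext p
    simp only [k, fracLapDir]
    rw [integral_const_mul, Circle.smul_def, smul_eq_mul, Complex.ofReal_mul,
      ← integral_complex_ofReal]
    ring
  have e2 : ∀ w, ∫ p, k p w = (1 - (Real.fourierChar (-inner ℝ w l) : ℂ)) /
      (‖w‖ ^ ((d : ℝ) + 2 * s) : ℝ) * 𝓕 (fun p => (g p : ℂ)) ζ := fun w => by
    have h1 := fourier_comp_sub (fun p => (g p : ℂ)) (J w) ζ
    rw [hl] at h1
    have hexp : ∀ p, k p w = (Real.fourierChar (-inner ℝ p ζ) • (g p : ℂ) -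
        Real.fourierChar (-inner ℝ p ζ) • (g (p - J w) : ℂ)) *
          ((‖w‖ ^ ((d : ℝ) + 2 * s) : ℝ) : ℂ)⁻¹ := fun p => by
      simp only [k, Circle.smul_def, smul_eq_mul]
      push_cast
      ring
    simp only [hexp]
    rw [integral_mul_const, integral_sub ((Real.fourierIntegral_convergent_iff ζ).2 hi)
      ((Real.fourierIntegral_convergent_iff ζ).2 (hit _)), ← Real.fourier_eq, ← Real.fourier_eq, h1]
    ring
  rw [e1, integral_integral_swap hk]
  simp only [e2]
  rw [integral_mul_const, fracSymbol]
  ring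

end Fractional

/-! ### The shear that straightens the transport field, and the dual frequencies -/

section Flow

variable {d : ℕ}

/-- `ℝ^{3d}` with its Euclidean structure. -/
abbrev VV (d : ℕ) : Type := WithLp 2 (E d × WithLp 2 (E d × E d))

/-- The identification of `ℝ^{3d}` with `ℝ^d × ℝ^d × ℝ^d`. -/
def split (d : ℕ) : VV d ≃L[ℝ] E d × E d × E d :=
  (WithLp.prodContinuousLinearEquiv 2 ℝ (E d) (WithLp 2 (E d × E d))).trans
    ((ContinuousLinearEquiv.refl ℝ (E d)).prodCongr
      (WithLp.prodContinuousLinearEquiv 2 ℝ (E d) (E d)))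

/-- The transport flow on `ℝ^{3d}`. -/
def shear (t : ℝ) (p : E d × E d × E d) : E d × E d × E d :=
  (p.1, p.2.1 + t • p.1, p.2.2 + t • p.2.1 + (t ^ 2 / 2) • p.1)

theorem shear_shear (s t : ℝ) (p : E d × E d × E d) : shear s (shear t p) = shear (s + t) p := by
  simp only [shear, Prod.mk.injEq, true_and]
  constructor <;> module

theorem shear_zero (p : E d × E d × E d) : shear 0 p = p := by
  simp [shear]

theorem shear_add (t : ℝ) (p p' : E d × E d × E d) :
    shear t (p + p') = shear t p + shear t p' := by
  simp only [shear, Prod.fst_add, Prod.snd_add, Prod.mk_add_mk, Prod.mk.injEq, true_and]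
  constructor <;> module

theorem shear_smul (t c : ℝ) (p : E d × E d × E d) : shear t (c • p) = c • shear t p := by
  simp only [shear, Prod.smul_fst, Prod.smul_snd, Prod.smul_mk, Prod.mk.injEq, true_and]
  constructor <;> module

theorem contDiff_shear :
    ContDiff ℝ ∞ fun q : ℝ × E d × E d × E d => shear q.1 q.2 := by
  unfold shear
  fun_prop

/-- The shear as a continuous linear map. -/
def shearL (t : ℝ) : E d × E d × E d →L[ℝ] E d × E d × E d where
  toFun := shear t
  map_add' := shear_add t
  map_smul' := shear_smul t
  cont := (contDiff_shear.comp (contDiff_const.prodMk contDiff_id)).continuous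

/-- Coordinates in which the transport derivative is the time derivative. -/
def flow (d : ℕ) : Pt d ≃ₜ ℝ × VV d where
  toFun X := (X.1, (split d).symm (shear X.1 X.2))
  invFun q := (q.1, shear (-q.1) (split d q.2))
  left_inv X := by
    simp only [ContinuousLinearEquiv.apply_symm_apply, shear_shear, neg_add_cancel, shear_zero]
  right_inv q := by
    simp only [shear_shear, add_neg_cancel, shear_zero, ContinuousLinearEquiv.symm_apply_apply]
  continuous_toFun := continuous_fst.prodMk
    ((split d).symm.continuous.comp contDiff_shear.continuous)
  continuous_invFun := continuous_fst.prodMk (contDiff_shear.continuous.comp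
    (continuous_fst.neg.prodMk ((split d).continuous.comp continuous_snd)))

theorem flow_apply (X : Pt d) : flow d X = (X.1, (split d).symm (shear X.1 X.2)) := rfl

theorem flow_symm_apply (q : ℝ × VV d) :
    (flow d).symm q = (q.1, shear (-q.1) (split d q.2)) := rfl

theorem contDiff_flow : ContDiff ℝ ∞ (flow d) :=
  contDiff_fst.prodMk ((split d).symm.contDiff.comp contDiff_shear)

theorem contDiff_flow_symm : ContDiff ℝ ∞ (flow d).symm :=
  contDiff_fst.prodMk (contDiff_shear.comp
    (contDiff_fst.neg.prodMk ((split d).contDiff.comp contDiff_snd)))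

/-- The shear is triangular: a skew product over x, then over y, of translations. -/
theorem measurePreserving_shear (t : ℝ) :
    MeasurePreserving (shear t : E d × E d × E d → E d × E d × E d) := by
  refine MeasurePreserving.skew_product (f := id) (MeasurePreserving.id _)
    (g := fun (x : E d) (p : E d × E d) => (p.1 + t • x, p.2 + t • p.1 + (t ^ 2 / 2) • x)) ?_ ?_
  · exact Continuous.measurable (by fun_prop)
  · refine Eventually.of_forall fun x => ?_
    refine (MeasurePreserving.skew_product (f := fun y : E d => y + t • x)
      (measurePreserving_add_right volume _)
      (g := fun (y z : E d) => z + t • y + (t ^ 2 / 2) • x) ?_ ?_).map_eq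
    · exact Continuous.measurable (by fun_prop)
    · refine Eventually.of_forall fun y => ?_
      simp only [add_assoc]
      exact map_add_right_eq_self _ _

theorem measurePreserving_split_symm : MeasurePreserving (split d).symm := by
  have h1 : MeasurePreserving (Prod.map id (WithLp.toLp 2) :
      E d × E d × E d → E d × WithLp 2 (E d × E d)) :=
    (MeasurePreserving.id _).prod (WithLp.volume_preserving_toLp _ _)
  exact (WithLp.volume_preserving_toLp (E d) (WithLp 2 (E d × E d))).comp h1

theorem measurePreserving_slice (t : ℝ) :
    MeasurePreserving fun p : E d × E d × E d => (split d).symm (shear t p) :=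
  measurePreserving_split_symm.comp (measurePreserving_shear t)

theorem measurePreserving_flow : MeasurePreserving (flow d) := by
  refine MeasurePreserving.skew_product (f := id) (MeasurePreserving.id _)
    (g := fun (t : ℝ) (p : E d × E d × E d) => (split d).symm (shear t p)) ?_ ?_
  · exact Continuous.measurable ((split d).symm.continuous.comp contDiff_shear.continuous)
  · exact Eventually.of_forall fun t => (measurePreserving_slice t).map_eq

theorem measurableEmbedding_flow : MeasurableEmbedding (flow d) :=
  (flow d).measurableEmbedding

theorem measurePreserving_flow_symm : MeasurePreserving (flow d).symm :=
  measurePreserving_flow.symm (flow d).toMeasurableEquiv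

theorem integral_flow {F : Type*} [NormedAddCommGroup F] [NormedSpace ℝ F] (g : ℝ × VV d → F) :
    ∫ X, g (flow d X) = ∫ q, g q :=
  measurePreserving_flow.integral_comp measurableEmbedding_flow g

/-- The components of a frequency. -/
def fk (ζ : VV d) : E d := (split d ζ).1

/-- The components of a frequency. -/
def fl (ζ : VV d) : E d := (split d ζ).2.1

/-- The components of a frequency. -/
def fm (ζ : VV d) : E d := (split d ζ).2.2

theorem continuous_fk : Continuous (fk (d := d)) := continuous_fst.comp (split d).continuous

theorem continuous_fl : Continuous (fl (d := d)) :=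
  continuous_fst.comp (continuous_snd.comp (split d).continuous)

theorem continuous_fm : Continuous (fm (d := d)) :=
  continuous_snd.comp (continuous_snd.comp (split d).continuous)

theorem inner_split_symm (p : E d × E d × E d) (ζ : VV d) :
    inner ℝ ((split d).symm p) ζ =
      inner ℝ p.1 (fk ζ) + (inner ℝ p.2.1 (fl ζ) + inner ℝ p.2.2 (fm ζ)) := by
  rw [WithLp.prod_inner_apply, WithLp.prod_inner_apply]
  rfl

/-- The frequency dual to `x` at time `t`. -/
def fkap (q : ℝ × VV d) : E d := kap (fk q.2) (fl q.2) (fm q.2) q.1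

/-- The frequency dual to `y` at time `t`. -/
def flam (q : ℝ × VV d) : E d := lam (fl q.2) (fm q.2) q.1

theorem continuous_fkap : Continuous (fkap (d := d)) := by
  have h1 := continuous_fk (d := d)
  have h2 := continuous_fl (d := d)
  have h3 := continuous_fm (d := d)
  unfold fkap kap
  fun_prop

theorem continuous_flam : Continuous (flam (d := d)) := by
  have h2 := continuous_fl (d := d)
  have h3 := continuous_fm (d := d)
  unfold flam lam
  fun_prop

/-- The direction of `∂_{x_i}` at time `t` in flow coordinates. -/
def dirX (i : Fin d) (t : ℝ) : VV d :=
  (split d).symm (shear t (EuclideanSpace.single i 1, 0, 0))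

/-- The adjoint of the shear acting on frequencies. This is where the quadratic dependence of κ on
time originates. -/
theorem inner_dirX (i : Fin d) (t : ℝ) (ζ : VV d) : inner ℝ (dirX i t) ζ = fkap (t, ζ) i := by
  rw [dirX, inner_split_symm]
  simp only [shear, fkap, kap, smul_zero, add_zero, zero_add, real_inner_smul_left,
    EuclideanSpace.inner_single_left, map_one, one_mul, PiLp.add_apply, PiLp.smul_apply,
    smul_eq_mul]
  ring

/-- The embedding of the `y` variable in flow coordinates at time `t`. -/
def embY (t : ℝ) : E d →L[ℝ] VV d :=
  (split d).symm.toContinuousLinearMap ∘L shearL t ∘L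
    ContinuousLinearMap.inr ℝ (E d) (E d × E d) ∘L ContinuousLinearMap.inl ℝ (E d) (E d)

/-- The embedding of the `z` variable in flow coordinates at time `t`. -/
def embZ (t : ℝ) : E d →L[ℝ] VV d :=
  (split d).symm.toContinuousLinearMap ∘L shearL t ∘L
    ContinuousLinearMap.inr ℝ (E d) (E d × E d) ∘L ContinuousLinearMap.inr ℝ (E d) (E d)

theorem embY_apply (t : ℝ) (w : E d) : embY t w = (split d).symm (shear t (0, w, 0)) := rfl

theorem embZ_apply (t : ℝ) (w : E d) : embZ t w = (split d).symm (shear t (0, 0, w)) := rfl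

theorem inner_embY (t : ℝ) (w : E d) (ζ : VV d) :
    inner ℝ (embY t w) ζ = inner ℝ w (flam (t, ζ)) := by
  rw [embY_apply, inner_split_symm]
  simp [shear, flam, lam, inner_add_right, real_inner_smul_left, real_inner_smul_right]

theorem inner_embZ (t : ℝ) (w : E d) (ζ : VV d) :
    inner ℝ (embZ t w) ζ = inner ℝ w (fm ζ) := by
  rw [embZ_apply, inner_split_symm]
  simp [shear]

end Flow

/-! ### Test functions in flow coordinates and the symbols of the operators -/

section Test

variable {d : ℕ}

/-- A function on `ℝ^{1+3d}` in flow coordinates. -/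
def lift (φ : Pt d → ℝ) : ℝ × VV d → ℂ := fun q => (φ ((flow d).symm q) : ℂ)

theorem lift_flow (φ : Pt d → ℝ) (X : Pt d) : lift φ (flow d X) = (φ X : ℂ) := by
  simp [lift]

theorem IsTest.contDiff_symm {G : Set (Pt d)} {φ : Pt d → ℝ} (hφ : IsTest G φ) :
    ContDiff ℝ ∞ fun q => φ ((flow d).symm q) :=
  hφ.smooth.comp contDiff_flow_symm

theorem IsTest.compact_symm {G : Set (Pt d)} {φ : Pt d → ℝ} (hφ : IsTest G φ) :
    HasCompactSupport fun q => φ ((flow d).symm q) :=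
  hφ.compact.comp_homeomorph (flow d).symm

theorem adm_lift_of_continuous {φ : Pt d → ℝ} (h : Continuous φ) (hc : HasCompactSupport φ) :
    Adm (lift φ) := by
  refine adm_of_continuous (Complex.continuous_ofReal.comp (h.comp (flow d).symm.continuous)) ?_
  exact (hc.comp_homeomorph (flow d).symm).comp_left (g := fun x : ℝ => (x : ℂ)) (by simp)

theorem IsTest.adm {G : Set (Pt d)} {φ : Pt d → ℝ} (hφ : IsTest G φ) : Adm (lift φ) :=
  adm_lift_of_continuous hφ.smooth.continuous hφ.compact

theorem IsTest.dX {G : Set (Pt d)} {φ : Pt d → ℝ} (hφ : IsTest G φ) (i : Fin d) :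
    IsTest G (dX i φ) where
  smooth := (hφ.smooth.fderiv_right (by simp)).clm_apply contDiff_const
  compact := hφ.compact.fderiv_apply ℝ _
  support := (closure_mono (by
    intro X hX
    by_contra h
    have h0 : fderiv ℝ φ X = 0 := image_eq_zero_of_notMem_tsupport
      (fun h' => h (tsupport_fderiv_subset ℝ h'))
    exact hX (by simp [KFP.dX, h0]))).trans
    ((isClosed_tsupport φ).closure_eq.le.trans hφ.support)

theorem continuous_transport {φ : Pt d → ℝ} (h : ContDiff ℝ ∞ φ) : Continuous (transport φ) := by
  have hf : Continuous (fderiv ℝ φ) := h.continuous_fderiv (by simp)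
  unfold transport
  refine ((hf.clm_apply continuous_const).sub (hf.clm_apply ?_)).sub (hf.clm_apply ?_) <;>
    fun_prop

theorem hasCompactSupport_transport {φ : Pt d → ℝ} (hc : HasCompactSupport φ) :
    HasCompactSupport (transport φ) := by
  refine HasCompactSupport.of_support_subset_isCompact (hc.fderiv (𝕜 := ℝ)).isCompact ?_
  intro X hX
  refine subset_tsupport _ fun h0 => hX ?_
  simp [transport, h0]

theorem transport_eq_zero_of_notMem {φ : Pt d → ℝ} {X : Pt d} (hX : X ∉ tsupport φ) :
    transport φ X = 0 := by
  have h0 : fderiv ℝ φ X = 0 := image_eq_zero_of_notMem_tsupport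
    (fun h' => hX (tsupport_fderiv_subset ℝ h'))
  simp [transport, h0]

/-- In flow coordinates `∂_{x_i}` is a directional derivative. -/
theorem dX_eq {φ : Pt d → ℝ} (hφ : ContDiff ℝ ∞ φ) (i : Fin d) (t : ℝ) (p : VV d) :
    dX i φ ((flow d).symm (t, p)) =
      fderiv ℝ (fun p => φ ((flow d).symm (t, p))) p (dirX i t) := by
  have hd : Differentiable ℝ φ := hφ.differentiable (by simp)
  have hd2 : Differentiable ℝ fun p => φ ((flow d).symm (t, p)) :=
    (hφ.comp (contDiff_flow_symm.comp (contDiff_const.prodMk contDiff_id))).differentiable (by simp)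
  rw [dX, ← (hd _).lineDeriv_eq_fderiv, ← (hd2 _).lineDeriv_eq_fderiv, lineDeriv, lineDeriv]
  congr 1
  ext s
  congr 1
  simp only [flow_symm_apply, map_add, map_smul, dirX, ContinuousLinearEquiv.apply_symm_apply,
    shear_add, shear_smul, shear_shear, neg_add_cancel, shear_zero]
  simp

/-- In flow coordinates the transport derivative is the time derivative. -/
theorem transport_eq {φ : Pt d → ℝ} (hφ : ContDiff ℝ ∞ φ) (t : ℝ) (p : VV d) :
    HasDerivAt (fun t => φ ((flow d).symm (t, p))) (transport φ ((flow d).symm (t, p))) t := by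
  set X := (flow d).symm (t, p) with hX
  have hd : HasFDerivAt φ (fderiv ℝ φ X) X := (hφ.differentiable (by simp) X).hasFDerivAt
  have hγ : HasDerivAt (fun s => (flow d).symm (s, p))
      ((1, 0, -X.2.1, -X.2.2.1) : Pt d) t := by
    -- The integral curve through X of the transport field, written out as a polynomial in s − t.
    have e : ∀ s, (flow d).symm (s, p) = (s, X.2.1, X.2.2.1 - (s - t) • X.2.1,
        X.2.2.2 - (s - t) • X.2.2.1 + ((s - t) ^ 2 / 2) • X.2.1) := by
      intro s
      have h1 : (flow d).symm (s, p) = (s, shear (-(s - t)) X.2) := by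
        rw [hX]
        simp only [flow_symm_apply, shear_shear]
        congr 2
        ring
      rw [h1, shear]
      simp only [Prod.mk.injEq, true_and]
      constructor <;> module
    simp only [e]
    have hs : HasDerivAt (fun s : ℝ => s - t) 1 t := (hasDerivAt_id t).sub_const t
    refine (hasDerivAt_id t).prodMk ((hasDerivAt_const t _).prodMk (HasDerivAt.prodMk ?_ ?_))
    · have := (hasDerivAt_const t X.2.2.1).fun_sub (hs.smul_const X.2.1)
      simpa using this
    · have h2 := ((hs.fun_pow 2).div_const 2).smul_const X.2.1
      have := ((hasDerivAt_const t X.2.2.2).fun_sub (hs.smul_const X.2.2.1)).fun_add h2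
      simpa using this
  have := HasFDerivAt.comp_hasDerivAt_of_eq t hd hγ hX
  refine this.congr_deriv ?_
  have e : ((1, 0, -X.2.1, -X.2.2.1) : Pt d) =
      (1, 0, 0, 0) - (0, 0, X.2.1, 0) - (0, 0, 0, X.2.2.1) := by
    simp
  rw [e, map_sub, map_sub, transport]

theorem fourier_fderiv_apply {V : Type*} [NormedAddCommGroup V] [InnerProductSpace ℝ V]
    [FiniteDimensional ℝ V] [MeasurableSpace V] [BorelSpace V] {g : V → ℝ} (hg : ContDiff ℝ ∞ g)
    (hc : HasCompactSupport g) (v ζ : V) :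
    𝓕 (fun p => (fderiv ℝ g p v : ℂ)) ζ =
      2 * Real.pi * Complex.I * (inner ℝ v ζ : ℝ) * 𝓕 (fun p => (g p : ℂ)) ζ := by
  have hg' : ContDiff ℝ ∞ fun p => (g p : ℂ) := Complex.ofRealCLM.contDiff.comp hg
  have hc' : HasCompactSupport fun p => (g p : ℂ) :=
    hc.comp_left (g := fun x : ℝ => (x : ℂ)) (by simp)
  have hi : Integrable fun p => (g p : ℂ) := hg'.continuous.integrable_of_hasCompactSupport hc'
  have hi' : Integrable (fderiv ℝ fun p => (g p : ℂ)) :=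
    (hg'.continuous_fderiv (by simp)).integrable_of_hasCompactSupport (hc'.fderiv (𝕜 := ℝ))
  have key := congrArg (fun T : V → (V →L[ℝ] ℂ) => T ζ v)
    (Real.fourier_fderiv hi (hg'.differentiable (by simp)) hi')
  simp only [Real.fourier_continuousLinearMap_apply hi', VectorFourier.fourierSMulRight_apply]
    at key
  have e : ∀ p, fderiv ℝ (fun p => (g p : ℂ)) p v = (fderiv ℝ g p v : ℂ) := fun p => by
    have := (Complex.ofRealCLM.hasFDerivAt (x := g p)).comp p
      (hg.differentiable (by simp) p).hasFDerivAt
    have h2 : HasFDerivAt (fun p => (g p : ℂ)) _ p := this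
    rw [h2.fderiv]
    rfl
  simp only [e] at key
  have e2 : ((-innerSL ℝ) ζ) v = -inner ℝ v ζ := by
    rw [real_inner_comm ζ v]
    rfl
  rw [key, e2, Complex.real_smul, smul_eq_mul]
  push_cast
  ring

theorem IsTest.slice_contDiff {G : Set (Pt d)} {φ : Pt d → ℝ} (hφ : IsTest G φ) (t : ℝ) :
    ContDiff ℝ ∞ fun p : VV d => φ ((flow d).symm (t, p)) :=
  hφ.contDiff_symm.comp (contDiff_const.prodMk contDiff_id)

theorem IsTest.slice_compact {G : Set (Pt d)} {φ : Pt d → ℝ} (hφ : IsTest G φ) (t : ℝ) :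
    HasCompactSupport fun p : VV d => φ ((flow d).symm (t, p)) :=
  hasCompactSupport_slice hφ.compact_symm t

theorem IsTest.pf_dX {G : Set (Pt d)} {φ : Pt d → ℝ} (hφ : IsTest G φ) (i : Fin d)
    (q : ℝ × VV d) :
    pf (lift (KFP.dX i φ)) q = 2 * Real.pi * Complex.I * (fkap q i : ℝ) * pf (lift φ) q := by
  have := fourier_fderiv_apply (hφ.slice_contDiff q.1) (hφ.slice_compact q.1) (dirX i q.1) q.2
  simp only [inner_dirX, ← dX_eq hφ.smooth] at this
  exact this

/-- On the whole space this form gives integrability in all variables; the slicewise form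
`fracLapY_flow_symm` gives the symbol. -/
theorem fracLapY_eq (s : ℝ) (φ : Pt d → ℝ) : fracLapY s φ = fracLapDir s
    (ContinuousLinearMap.inr ℝ ℝ (E d × E d × E d) ∘L ContinuousLinearMap.inr ℝ (E d) (E d × E d)
      ∘L ContinuousLinearMap.inl ℝ (E d) (E d)) φ := by
  ext X
  simp only [fracLapY, fracLapDir]
  congr 3
  ext w
  congr 3
  simp [Prod.ext_iff]

theorem fracLapZ_eq (s : ℝ) (φ : Pt d → ℝ) : fracLapZ s φ = fracLapDir s
    (ContinuousLinearMap.inr ℝ ℝ (E d × E d × E d) ∘L ContinuousLinearMap.inr ℝ (E d) (E d × E d)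
      ∘L ContinuousLinearMap.inr ℝ (E d) (E d)) φ := by
  ext X
  simp only [fracLapZ, fracLapDir]
  congr 3
  ext w
  congr 3
  simp [Prod.ext_iff]

theorem fracLapY_flow_symm (s : ℝ) (φ : Pt d → ℝ) (t : ℝ) (p : VV d) :
    fracLapY s φ ((flow d).symm (t, p)) =
      fracLapDir s (embY t) (fun p => φ ((flow d).symm (t, p))) p := by
  simp only [fracLapY, fracLapDir]
  congr 3
  ext w
  congr 3
  simp only [flow_symm_apply, map_sub, embY_apply, ContinuousLinearEquiv.apply_symm_apply]
  have : shear (-t) (split d p - shear t (0, w, 0)) = shear (-t) (split d p) - (0, w, 0) := by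
    have h1 := shear_add (-t) (split d p) ((-1 : ℝ) • shear t (0, w, 0))
    rw [shear_smul, shear_shear, neg_add_cancel, shear_zero] at h1
    simpa [sub_eq_add_neg] using h1
  rw [this]
  simp [Prod.ext_iff]

theorem fracLapZ_flow_symm (s : ℝ) (φ : Pt d → ℝ) (t : ℝ) (p : VV d) :
    fracLapZ s φ ((flow d).symm (t, p)) =
      fracLapDir s (embZ t) (fun p => φ ((flow d).symm (t, p))) p := by
  simp only [fracLapZ, fracLapDir]
  congr 3
  ext w
  congr 3
  simp only [flow_symm_apply, map_sub, embZ_apply, ContinuousLinearEquiv.apply_symm_apply]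
  have : shear (-t) (split d p - shear t (0, 0, w)) = shear (-t) (split d p) - (0, 0, w) := by
    have h1 := shear_add (-t) (split d p) ((-1 : ℝ) • shear t (0, 0, w))
    rw [shear_smul, shear_shear, neg_add_cancel, shear_zero] at h1
    simpa [sub_eq_add_neg] using h1
  rw [this]
  simp [Prod.ext_iff]

variable {s : ℝ}

theorem memLp_lift {φ : Pt d → ℝ} (h : MemLp φ 2 volume) : MemLp (lift φ) 2 volume :=
  (h.comp_measurePreserving measurePreserving_flow_symm).ofReal

theorem integrable_lift {φ : Pt d → ℝ} (h : Integrable φ) : Integrable (lift φ) :=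
  ((measurePreserving_flow_symm.integrable_comp_emb
    (flow d).symm.measurableEmbedding).2 h).ofReal

theorem adm_lift_of_integrable {φ : Pt d → ℝ} (h : MemLp φ 2 volume) (h1 : Integrable φ) :
    Adm (lift φ) where
  memLp := memLp_lift h
  integrable := by
    have := integrable_lift h1
    rw [Measure.volume_eq_prod] at this
    exact this.prod_right_ae

instance isAddLeftInvariant_volume : (volume : Measure (Pt d)).IsAddLeftInvariant := by
  have h1 : (volume : Measure (E d × E d)).IsAddLeftInvariant := by
    rw [Measure.volume_eq_prod]; infer_instance
  have h2 : (volume : Measure (E d × E d × E d)).IsAddLeftInvariant := by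
    rw [Measure.volume_eq_prod]; exact Measure.prod.instIsAddLeftInvariant
  rw [Measure.volume_eq_prod]; exact Measure.prod.instIsAddLeftInvariant

theorem IsTest.adm_fracLapY {G : Set (Pt d)} {φ : Pt d → ℝ} (hφ : IsTest G φ) (hs₀ : 0 < s)
    (hs₁ : s < 1 / 2) : Adm (lift (fracLapY s φ)) := by
  rw [fracLapY_eq]
  exact adm_lift_of_integrable (memLp_fracLapDir volume hs₀ hs₁ hφ.smooth hφ.compact _)
    (integrable_fracLapDir volume hs₀ hs₁ hφ.smooth hφ.compact _)

theorem IsTest.adm_fracLapZ {G : Set (Pt d)} {φ : Pt d → ℝ} (hφ : IsTest G φ) (hs₀ : 0 < s)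
    (hs₁ : s < 1 / 2) : Adm (lift (fracLapZ s φ)) := by
  rw [fracLapZ_eq]
  exact adm_lift_of_integrable (memLp_fracLapDir volume hs₀ hs₁ hφ.smooth hφ.compact _)
    (integrable_fracLapDir volume hs₀ hs₁ hφ.smooth hφ.compact _)

theorem IsTest.pf_fracLapY {G : Set (Pt d)} {φ : Pt d → ℝ} (hφ : IsTest G φ) (hs₀ : 0 < s)
    (hs₁ : s < 1 / 2) (q : ℝ × VV d) :
    pf (lift (fracLapY s φ)) q = fracSymbol d s (flam q) * pf (lift φ) q := by
  have := fourier_fracLapDir hs₀ hs₁ (hφ.slice_contDiff q.1) (hφ.slice_compact q.1) (embY q.1)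
    (ζ := q.2) (l := flam q) (fun w => inner_embY q.1 w q.2)
  simp only [← fracLapY_flow_symm] at this
  exact this

theorem IsTest.pf_fracLapZ {G : Set (Pt d)} {φ : Pt d → ℝ} (hφ : IsTest G φ) (hs₀ : 0 < s)
    (hs₁ : s < 1 / 2) (q : ℝ × VV d) :
    pf (lift (fracLapZ s φ)) q = fracSymbol d s (fm q.2) * pf (lift φ) q := by
  have := fourier_fracLapDir hs₀ hs₁ (hφ.slice_contDiff q.1) (hφ.slice_compact q.1) (embZ q.1)
    (ζ := q.2) (l := fm q.2) (fun w => inner_embZ q.1 w q.2)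
  simp only [← fracLapZ_flow_symm] at this
  exact this

/-- Test functions are real, so passing to the real part of W is harmless and no Hermitian symmetry
on the frequency side has to be tracked. -/
theorem integral_re_flow_mul {W : ℝ × VV d → ℂ} (hW : MemLp W 2 volume) {φ : Pt d → ℝ}
    (hφ : Adm (lift φ)) :
    ∫ X, (W (flow d X)).re * φ X = (∫ q, W q * lift φ q).re := by
  have h1 := integral_re (𝕜 := ℂ) (integrable_mul_of_memLp_two hW hφ.memLp)
  rw [← RCLike.re_eq_complex_re, ← h1, ← integral_flow]
  congr 1
  ext X
  rw [lift_flow]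
  simp

/-- Transfer of a duality relation from the Fourier side. -/
theorem integral_mul_eq_of_isPF {H W H' W' : ℝ × VV d → ℂ} (h : IsPF H W) (h' : IsPF H' W')
    {φ ψ : Pt d → ℝ} (hφ : Adm (lift φ)) (hψ : Adm (lift ψ))
    (he : ∫ q, H' q * pf (lift φ) q = ∫ q, H q * pf (lift ψ) q) :
    ∫ X, (W' (flow d X)).re * φ X = ∫ X, (W (flow d X)).re * ψ X := by
  rw [integral_re_flow_mul h.right hψ, integral_re_flow_mul h'.right hφ, h.pairing _ hψ,
    h'.pairing _ hφ, he]

end Test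

/-! ### The symbol of the elliptic part and the weight -/

section Symbol

variable {d : ℕ} {δ : ℝ} {a : ℝ → Matrix (Fin d) (Fin d) ℝ}

/-- The symbol of `-∑ a^{ij}(t) ∂_{x_i x_j}` in flow coordinates. -/
def qsym (a : ℝ → Matrix (Fin d) (Fin d) ℝ) (q : ℝ × VV d) : ℝ :=
  4 * Real.pi ^ 2 * ∑ i, ∑ j, a q.1 i j * fkap q i * fkap q j

theorem continuous_fkap_apply (i : Fin d) : Continuous fun q : ℝ × VV d => fkap q i :=
  (EuclideanSpace.proj i).continuous.comp continuous_fkap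

theorem measurable_qsym (ha : ∀ i j, Measurable fun t => a t i j) : Measurable (qsym a) := by
  refine Measurable.const_mul ?_ _
  refine Finset.measurable_sum _ fun i _ => Finset.measurable_sum _ fun j _ => ?_
  exact (((ha i j).comp measurable_fst).mul (continuous_fkap_apply i).measurable).mul
    (continuous_fkap_apply j).measurable

theorem one_le_four_mul_pi_sq : 1 ≤ 4 * Real.pi ^ 2 := by
  nlinarith [Real.pi_gt_three]

theorem qsym_lower (hδ : 0 < δ) (ha : IsElliptic δ a) (q : ℝ × VV d) :
    δ * ‖fkap q‖ ^ 2 ≤ qsym a q := by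
  have h1 := ha.lower q.1 (fkap q)
  have h2 : 0 ≤ δ * ‖fkap q‖ ^ 2 := by positivity
  have h3 := one_le_four_mul_pi_sq
  unfold qsym
  nlinarith

theorem qsym_nonneg (hδ : 0 < δ) (ha : IsElliptic δ a) (q : ℝ × VV d) : 0 ≤ qsym a q :=
  le_trans (by positivity) (qsym_lower hδ ha q)

theorem qsym_upper (ha : IsElliptic δ a) (q : ℝ × VV d) :
    qsym a q ≤ 4 * Real.pi ^ 2 * δ⁻¹ * ‖fkap q‖ ^ 2 := by
  rw [qsym, mul_assoc (4 * Real.pi ^ 2)]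
  exact mul_le_mul_of_nonneg_left (ha.upper q.1 (fkap q)) (by positivity)

/-- The bound depends on ζ, the symbol being unbounded in frequency; it serves only in arguments at
a fixed frequency. -/
theorem exists_qsym_bound (hδ : 0 < δ) (ha : IsElliptic δ a) (S T : ℝ) (ζ : VV d) :
    ∃ K, ∀ t ∈ Set.Icc S T, |qsym a (t, ζ)| ≤ K := by
  have hc : Continuous fun t : ℝ => 4 * Real.pi ^ 2 * δ⁻¹ * ‖fkap (t, ζ)‖ ^ 2 :=
    continuous_const.mul ((continuous_fkap.comp (by fun_prop)).norm.pow 2)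
  obtain ⟨K, hK⟩ := isCompact_Icc.bddAbove_image (hc.continuousOn (s := Set.Icc S T))
  refine ⟨K, fun t ht => ?_⟩
  rw [abs_of_nonneg (qsym_nonneg hδ ha _)]
  exact (qsym_upper ha _).trans (hK ⟨t, ht, rfl⟩)

theorem intervalIntegrable_qsym (hδ : 0 < δ) (ha : IsElliptic δ a)
    (ham : ∀ i j, Measurable fun t => a t i j) (ζ : VV d) (x y : ℝ) :
    IntervalIntegrable (fun t => qsym a (t, ζ)) volume x y := by
  obtain ⟨K, hK⟩ := exists_qsym_bound hδ ha (min x y) (max x y) ζ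
  refine (intervalIntegrable_const (c := K)).mono_fun
    ((measurable_qsym ham).comp (by fun_prop)).aestronglyMeasurable ?_
  rw [EventuallyLE, ae_restrict_iff' measurableSet_uIoc]
  refine Eventually.of_forall fun t ht => ?_
  rw [Real.norm_eq_abs]
  exact (hK t ⟨ht.1.le, ht.2⟩).trans (le_abs_self K)

/-- The weight in flow coordinates. -/
def fwt (q : ℝ × VV d) : ℝ := wt (fk q.2) (fl q.2) (fm q.2) q.1

theorem fwt_nonneg (q : ℝ × VV d) : 0 ≤ fwt q := wt_nonneg _ _ _ _

theorem fwt_eq (q : ℝ × VV d) :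
    fwt q = ‖fkap q‖ ^ 2 + ‖flam q‖ ^ (2 / 3 : ℝ) + ‖fm q.2‖ ^ (2 / 5 : ℝ) := rfl

theorem measurable_fwt : Measurable (fwt (d := d)) := by
  have h3 : Measurable fun q : ℝ × VV d => ‖fm q.2‖ :=
    (continuous_fm.comp continuous_snd).norm.measurable
  exact ((continuous_fkap.norm.pow 2).measurable.add
    (continuous_flam.norm.measurable.pow_const _)).add (h3.pow_const _)

end Symbol

/-! ### The solution on the Fourier side -/

section Solution

/-- The moving endpoint is put into the indicator of a measurable subset of the product, so that the
integral has a fixed domain; the two pieces are the two orientations of the interval. -/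
theorem stronglyMeasurable_primitive {V F : Type*} [MeasurableSpace V] [NormedAddCommGroup F]
    [NormedSpace ℝ F] {g : ℝ × V → F} (hg : StronglyMeasurable g) (S : ℝ) :
    StronglyMeasurable fun q : ℝ × V => ∫ r in S..q.1, g (r, q.2) := by
  have hg' : StronglyMeasurable fun x : (ℝ × V) × ℝ => g (x.2, x.1.2) :=
    hg.comp_measurable (by fun_prop)
  have h1 : StronglyMeasurable fun q : ℝ × V => ∫ r in Set.Ioc S q.1, g (r, q.2) := by
    have hm : MeasurableSet {x : (ℝ × V) × ℝ | S < x.2 ∧ x.2 ≤ x.1.1} :=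
      (measurableSet_lt measurable_const measurable_snd).inter
        (measurableSet_le measurable_snd (by fun_prop))
    have := (hg'.indicator hm).integral_prod_right' (ν := (volume : Measure ℝ))
    simp only [← integral_indicator measurableSet_Ioc]
    exact this
  have h2 : StronglyMeasurable fun q : ℝ × V => ∫ r in Set.Ioc q.1 S, g (r, q.2) := by
    have hm : MeasurableSet {x : (ℝ × V) × ℝ | x.1.1 < x.2 ∧ x.2 ≤ S} :=
      (measurableSet_lt (by fun_prop) measurable_snd).inter
        (measurableSet_le measurable_snd measurable_const)
    have := (hg'.indicator hm).integral_prod_right' (ν := (volume : Measure ℝ))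
    simp only [← integral_indicator measurableSet_Ioc]
    exact this
  exact h1.sub h2

variable {d : ℕ} {δ : ℝ} {a : ℝ → Matrix (Fin d) (Fin d) ℝ} {S T : ℝ} {F : ℝ × VV d → ℂ}

/-- The solution on the Fourier side. -/
def solH (a : ℝ → Matrix (Fin d) (Fin d) ℝ) (S T : ℝ) (F : ℝ × VV d → ℂ) (q : ℝ × VV d) : ℂ :=
  (Set.Ioo S T).indicator (duhamel S (fun t => qsym a (t, q.2)) fun t => F (t, q.2)) q.1

theorem stronglyMeasurable_solH (ham : ∀ i j, Measurable fun t => a t i j)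
    (hF : StronglyMeasurable F) : StronglyMeasurable (solH a S T F) := by
  have h1 := stronglyMeasurable_primitive (measurable_qsym ham).stronglyMeasurable S
  have h2 : StronglyMeasurable fun q : ℝ × VV d =>
      (Real.exp (∫ r in S..q.1, qsym a (r, q.2)) : ℂ) :=
    (Complex.continuous_ofReal.comp Real.continuous_exp).comp_stronglyMeasurable h1
  have h3 : StronglyMeasurable fun q : ℝ × VV d =>
      (Real.exp (-∫ r in S..q.1, qsym a (r, q.2)) : ℂ) :=
    (Complex.continuous_ofReal.comp
      (Real.continuous_exp.comp continuous_neg)).comp_stronglyMeasurable h1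
  have h4 := h3.mul (stronglyMeasurable_primitive (h2.mul hF) S)
  exact h4.indicator (measurable_fst measurableSet_Ioo)

theorem lintegral_prod_slab (g : ℝ × VV d → ℝ≥0∞) (hg : Measurable g) :
    ∫⁻ q, g q = ∫⁻ ζ, ∫⁻ t, g (t, ζ) := by
  rw [Measure.volume_eq_prod]
  exact lintegral_prod_symm' _ hg

/-- The bound along each characteristic, integrated over ζ by Tonelli; its constant is independent
of ζ. -/
theorem exists_solH_bound (d : ℕ) (hδ : 0 < δ) (τ : ℝ) :
    ∃ N : ℝ≥0, ∀ (S T : ℝ), T - S = τ → ∀ a : ℝ → Matrix (Fin d) (Fin d) ℝ, IsElliptic δ a →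
      (∀ i j, Measurable fun t => a t i j) → ∀ F : ℝ × VV d → ℂ, StronglyMeasurable F →
      eLpNorm (fun q => ((1 + fwt q : ℝ) : ℂ) * solH a S T F q) 2 volume ≤
        N * eLpNorm F 2 volume := by
  obtain ⟨N, hN⟩ := exists_duhamel_bound (E d) hδ τ
  refine ⟨N, fun S T hST a ha ham F hF => ?_⟩
  have hH := stronglyMeasurable_solH (S := S) (T := T) ham hF
  rw [← ENNReal.pow_le_pow_left_iff two_ne_zero, mul_pow, eLpNorm_two_sq, eLpNorm_two_sq,
    lintegral_prod_slab, lintegral_prod_slab, ← lintegral_const_mul]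
  · refine lintegral_mono fun ζ => ?_
    have h1 := hN S T hST (fk ζ) (fl ζ) (fm ζ) _ (intervalIntegrable_qsym hδ ha ham ζ)
      (fun t => qsym_lower hδ ha (t, ζ)) (fun t => F (t, ζ)) (hF.measurable.comp (by fun_prop))
    refine le_trans (le_of_eq ?_) (h1.trans (mul_le_mul_right (setLIntegral_le_lintegral _ _) _))
    rw [← lintegral_indicator measurableSet_Ioo]
    congr 1
    ext t
    simp only [solH, Set.indicator]
    split_ifs
    · rfl
    · simp
  · exact (hF.measurable.enorm.pow_const 2).lintegral_prod_left'
  · exact hF.measurable.enorm.pow_const 2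
  · refine (((Complex.measurable_ofReal.comp (measurable_const.add measurable_fwt)).mul
      hH.measurable).enorm).pow_const 2

/-- Each operator in the final estimate reduces to this: its symbol only has to be dominated by the
weight 1 + w. -/
theorem memLp_symbol_mul {N : ℝ≥0} {H F M : ℝ × VV d → ℂ} (hH : StronglyMeasurable H)
    (hF : MemLp F 2 volume)
    (h : eLpNorm (fun q => ((1 + fwt q : ℝ) : ℂ) * H q) 2 volume ≤ N * eLpNorm F 2 volume)
    (hM : StronglyMeasurable M) {C : ℝ≥0} (hC : ∀ q, ‖M q‖ ≤ C * (1 + fwt q)) :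
    MemLp (fun q => M q * H q) 2 volume ∧
      eLpNorm (fun q => M q * H q) 2 volume ≤ (C * N : ℝ≥0) * eLpNorm F 2 volume := by
  have h1 : eLpNorm (fun q => M q * H q) 2 volume ≤ (C * N : ℝ≥0) * eLpNorm F 2 volume := by
    have h2 : eLpNorm (fun q => M q * H q) 2 volume ≤
        ENNReal.ofReal C * eLpNorm (fun q => ((1 + fwt q : ℝ) : ℂ) * H q) 2 volume := by
      refine eLpNorm_le_mul_eLpNorm_of_ae_le_mul (Eventually.of_forall fun q => ?_) _
      rw [norm_mul, norm_mul, ← mul_assoc, Complex.norm_real,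
        Real.norm_of_nonneg (add_nonneg zero_le_one (fwt_nonneg q))]
      exact mul_le_mul_of_nonneg_right (hC q) (norm_nonneg _)
    refine h2.trans ?_
    rw [ENNReal.ofReal_coe_nnreal, ENNReal.coe_mul, mul_assoc]
    exact mul_le_mul_right h _
  exact ⟨⟨(hM.mul hH).aestronglyMeasurable, h1.trans_lt (ENNReal.mul_lt_top ENNReal.coe_lt_top hF.2)⟩, h1⟩

/-- The solution on the Fourier side is small near the initial time. -/
theorem eLpNorm_solH_slice_le (hδ : 0 < δ) (ha : IsElliptic δ a)
    (ham : ∀ i j, Measurable fun t => a t i j) (hF : StronglyMeasurable F) {t : ℝ} (ht : S < t) :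
    eLpNorm (fun ζ => solH a S T F (t, ζ)) 2 volume ≤
      ENNReal.ofReal (Real.sqrt (t - S)) * eLpNorm F 2 volume := by
  rw [← ENNReal.pow_le_pow_left_iff two_ne_zero, mul_pow, eLpNorm_two_sq, eLpNorm_two_sq,
    lintegral_prod_slab _ (hF.measurable.enorm.pow_const 2), ← lintegral_const_mul]
  swap
  · exact (hF.measurable.enorm.pow_const 2).lintegral_prod_left'
  refine lintegral_mono fun ζ => ?_
  have hm : Measurable fun r => ‖F (r, ζ)‖ₑ := (hF.measurable.comp (by fun_prop)).enorm
  have h1 : ‖solH a S T F (t, ζ)‖ₑ ≤ ∫⁻ r in Set.Ioo S t, 1 * ‖F (r, ζ)‖ₑ := by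
    refine (enorm_indicator_le_enorm_self _ _).trans ?_
    refine (enorm_duhamel_le ht.le (intervalIntegrable_qsym hδ ha ham ζ) _).trans ?_
    refine setLIntegral_mono' measurableSet_Ioo fun r hr => ?_
    refine mul_le_mul_left ?_ _
    rw [ENNReal.ofReal_le_one, Real.exp_le_one_iff, neg_nonpos]
    exact intervalIntegral.integral_nonneg hr.2.le fun s _ => qsym_nonneg hδ ha _
  -- Cauchy–Schwarz in time; the exponential factor is at most 1 because the symbol is nonnegative.
  calc ‖solH a S T F (t, ζ)‖ₑ ^ 2 ≤ (∫⁻ r in Set.Ioo S t, 1 * ‖F (r, ζ)‖ₑ) ^ 2 := by gcongr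
    _ ≤ (∫⁻ r in Set.Ioo S t, 1) * ∫⁻ r in Set.Ioo S t, 1 * ‖F (r, ζ)‖ₑ ^ 2 :=
      lintegral_mul_sq_le aemeasurable_const hm.aemeasurable
    _ ≤ ENNReal.ofReal (Real.sqrt (t - S)) ^ 2 * ∫⁻ r, ‖F (r, ζ)‖ₑ ^ 2 := by
      simp only [one_mul]
      refine mul_le_mul' (le_of_eq ?_) (setLIntegral_le_lintegral _ _)
      rw [setLIntegral_one, Real.volume_Ioo, ← ENNReal.ofReal_pow (Real.sqrt_nonneg _),
        Real.sq_sqrt (by linarith)]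

end Solution

/-! ### The transport derivative under the Fourier transform -/

section TransportIdentity

theorem continuous_character {V : Type*} [NormedAddCommGroup V] [InnerProductSpace ℝ V] (ζ : V) :
    Continuous fun p : V => (Real.fourierChar (-inner ℝ p ζ) : ℂ) :=
  continuous_subtype_val.comp (Real.continuous_fourierChar.comp (by fun_prop))

variable {d : ℕ}

theorem pf_eq_integral (Φ : ℝ × VV d → ℂ) (t : ℝ) (ζ : VV d) :
    pf Φ (t, ζ) = ∫ p, (Real.fourierChar (-inner ℝ p ζ) : ℂ) * Φ (t, p) := by
  simp only [pf, Real.fourier_eq, Circle.smul_def, smul_eq_mul]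

theorem integrable_character_mul {Φ : ℝ × VV d → ℂ} (h : Continuous Φ) (hc : HasCompactSupport Φ)
    (ζ : VV d) :
    Integrable fun q : ℝ × VV d => (Real.fourierChar (-inner ℝ q.2 ζ) : ℂ) * Φ q :=
  Continuous.integrable_of_hasCompactSupport
    (((continuous_character ζ).comp continuous_snd).mul h) hc.mul_left

theorem integrable_pf_slice {Φ : ℝ × VV d → ℂ} (h : Continuous Φ) (hc : HasCompactSupport Φ)
    (ζ : VV d) : Integrable fun t => pf Φ (t, ζ) := by
  simp only [pf_eq_integral]
  have := integrable_character_mul h hc ζ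
  rw [Measure.volume_eq_prod] at this
  exact this.integral_prod_left

theorem continuous_lift {φ : Pt d → ℝ} (h : Continuous φ) : Continuous (lift φ) :=
  Complex.continuous_ofReal.comp (h.comp (flow d).symm.continuous)

theorem hasCompactSupport_lift {φ : Pt d → ℝ} (hc : HasCompactSupport φ) :
    HasCompactSupport (lift φ) :=
  (hc.comp_homeomorph (flow d).symm).comp_left (g := fun x : ℝ => (x : ℂ)) (by simp)

/-- The fundamental theorem of calculus on the Fourier side. -/
theorem pf_eq_neg_integral_transport {φ : Pt d → ℝ} (h : ContDiff ℝ ∞ φ)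
    (hc : HasCompactSupport φ) {r T : ℝ} (hrT : r ≤ T)
    (hT : ∀ p, φ ((flow d).symm (T, p)) = 0) (ζ : VV d) :
    pf (lift φ) (r, ζ) = -∫ t in Set.Ioo r T, pf (lift (transport φ)) (t, ζ) := by
  have hY : Continuous (lift (transport φ)) := continuous_lift (continuous_transport h)
  have hint := integrable_character_mul hY
    (hasCompactSupport_lift (hasCompactSupport_transport hc)) ζ
  rw [Measure.volume_eq_prod] at hint
  have hint' := hint.integrableOn (s := Set.Ioo r T ×ˢ Set.univ)
  rw [IntegrableOn, ← Measure.prod_restrict, Measure.restrict_univ] at hint'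
  simp only [pf_eq_integral]
  rw [integral_integral_swap hint', ← integral_neg]
  congr 1
  ext p
  rw [integral_const_mul, ← integral_Ioc_eq_integral_Ioo, ← intervalIntegral.integral_of_le hrT]
  have hd : ∀ t, HasDerivAt (fun t => lift φ (t, p)) (lift (transport φ) (t, p)) t := fun t =>
    (transport_eq h t p).ofReal_comp
  rw [intervalIntegral.integral_eq_sub_of_hasDerivAt (fun t _ => hd t)
    (Continuous.intervalIntegrable (by fun_prop) _ _)]
  simp [lift, hT p]

end TransportIdentity

/-! ### The weak equation on the Fourier side -/

section Pairing

variable {d : ℕ} {δ : ℝ} {a : ℝ → Matrix (Fin d) (Fin d) ℝ} {S T : ℝ} {F : ℝ × VV d → ℂ}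

theorem mem_slab_iff {X : Pt d} : X ∈ slab d S T ↔ X.1 ∈ Set.Ioo S T := by
  simp [slab]

theorem measurableSet_slab : MeasurableSet (slab d S T) :=
  measurableSet_Ioo.prod MeasurableSet.univ

theorem IsTest.eq_zero {φ : Pt d → ℝ} (hφ : IsTest (slab d S T) φ) {X : Pt d}
    (hX : X ∉ slab d S T) : φ X = 0 :=
  image_eq_zero_of_notMem_tsupport fun h => hX (hφ.support h)

theorem IsTest.transport_eq_zero {φ : Pt d → ℝ} (hφ : IsTest (slab d S T) φ) {X : Pt d}
    (hX : X ∉ slab d S T) : transport φ X = 0 :=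
  transport_eq_zero_of_notMem fun h => hX (hφ.support h)

theorem IsTest.fracLapY_eq_zero {φ : Pt d → ℝ} (hφ : IsTest (slab d S T) φ) (s : ℝ) {X : Pt d}
    (hX : X ∉ slab d S T) : fracLapY s φ X = 0 := by
  rw [mem_slab_iff] at hX
  have h (p : E d × E d × E d) : φ (X.1, p) = 0 := hφ.eq_zero (mt mem_slab_iff.1 hX)
  simp [fracLapY, h]

theorem IsTest.fracLapZ_eq_zero {φ : Pt d → ℝ} (hφ : IsTest (slab d S T) φ) (s : ℝ) {X : Pt d}
    (hX : X ∉ slab d S T) : fracLapZ s φ X = 0 := by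
  rw [mem_slab_iff] at hX
  have h (p : E d × E d × E d) : φ (X.1, p) = 0 := hφ.eq_zero (mt mem_slab_iff.1 hX)
  simp [fracLapZ, h]

theorem ae_integrableOn_slice (hF : MemLp F 2 volume) (hFm : StronglyMeasurable F) (S T : ℝ) :
    ∀ᵐ ζ : VV d, IntegrableOn (fun t => F (t, ζ)) (Set.Ioo S T) := by
  have h1 : ∀ᵐ ζ : VV d, ∫⁻ t, ‖F (t, ζ)‖ₑ ^ 2 < ⊤ := by
    refine ae_lt_top (hFm.measurable.enorm.pow_const 2).lintegral_prod_left' ?_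
    rw [← lintegral_prod_slab _ (hFm.measurable.enorm.pow_const 2), ← eLpNorm_two_sq]
    exact ENNReal.pow_ne_top hF.2.ne
  filter_upwards [h1] with ζ hζ
  rw [← eLpNorm_two_sq] at hζ
  have : MemLp (fun t => F (t, ζ)) 2 volume :=
    ⟨(hFm.comp_measurable (by fun_prop)).aestronglyMeasurable, by simpa using hζ⟩
  exact (this.restrict _).integrable (by norm_num)

theorem integral_prod_slab {g : ℝ × VV d → ℂ} (hg : Integrable g) :
    ∫ q, g q = ∫ ζ, ∫ t, g (t, ζ) := by
  rw [Measure.volume_eq_prod] at hg ⊢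
  exact integral_prod_symm _ hg

/-- The weak form of the equation on the Fourier side. -/
theorem integral_solH_transport (hδ : 0 < δ) (ha : IsElliptic δ a)
    (ham : ∀ i j, Measurable fun t => a t i j) (hST : S ≤ T) (hFm : StronglyMeasurable F)
    (hF : MemLp F 2 volume) (hH : MemLp (solH a S T F) 2 volume) {HY : ℝ × VV d → ℂ}
    (hHY : MemLp HY 2 volume)
    (hHYe : ∀ q, HY q = (Set.Ioo S T).indicator
      (fun t => F (t, q.2) - qsym a (t, q.2) * solH a S T F (t, q.2)) q.1)
    {φ : Pt d → ℝ} (hφ : IsTest (slab d S T) φ) :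
    ∫ q, HY q * pf (lift φ) q = -∫ q, solH a S T F q * pf (lift (transport φ)) q := by
  have hY : Adm (lift (transport φ)) := adm_lift_of_continuous (continuous_transport hφ.smooth)
    (hasCompactSupport_transport hφ.compact)
  rw [integral_prod_slab (integrable_mul_of_memLp_two hHY hφ.adm.memLp_pf),
    integral_prod_slab (integrable_mul_of_memLp_two hH hY.memLp_pf), ← integral_neg]
  refine integral_congr_ae ?_
  filter_upwards [ae_integrableOn_slice hF hFm S T] with ζ hζ
  have hq := intervalIntegrable_qsym hδ ha ham ζ
  obtain ⟨C, hC⟩ := exists_qsym_bound hδ ha S T ζ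
  have hFi : IntervalIntegrable (fun t => F (t, ζ)) volume S T :=
    (intervalIntegrable_iff_integrableOn_Ioo_of_le hST).2 hζ
  set Y := duhamel S (fun t => qsym a (t, ζ)) fun t => F (t, ζ) with hYdef
  set K : ℝ → ℂ := fun t => F (t, ζ) - qsym a (t, ζ) * Y t with hKdef
  have hK : IntegrableOn K (Set.Ioo S T) := by
    rw [← intervalIntegrable_iff_integrableOn_Ioo_of_le hST]
    refine hFi.sub (IntervalIntegrable.mul_continuousOn ?_ (continuousOn_duhamel hq hFi))
    exact ⟨(hq S T).1.ofReal, (hq S T).2.ofReal⟩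
  -- By Duhamel's formula Y is the primitive from S of K = F − qY, while the transform of φ is the
  -- primitive, vanishing at T, of the transform of its transport derivative.
  have key := integral_primitive_mul hK
    (integrable_pf_slice (continuous_lift (continuous_transport hφ.smooth))
      (hasCompactSupport_lift (hasCompactSupport_transport hφ.compact)) ζ).integrableOn
    (ψ := fun t => pf (lift φ) (t, ζ))
    (fun r hr => pf_eq_neg_integral_transport hφ.smooth hφ.compact hr.2.le
      (fun p => hφ.eq_zero (by rw [mem_slab_iff]; simp [flow_symm_apply])) ζ)
  have e1 : ∫ t, HY (t, ζ) * pf (lift φ) (t, ζ) =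
      ∫ t in Set.Ioo S T, K t * pf (lift φ) (t, ζ) := by
    rw [← integral_indicator measurableSet_Ioo]
    congr 1
    ext t
    rw [hHYe]
    by_cases ht : t ∈ Set.Ioo S T
    · simp [ht, hKdef, solH, ← hYdef]
    · simp [ht]
  have e2 : ∫ t, solH a S T F (t, ζ) * pf (lift (transport φ)) (t, ζ) =
      ∫ t in Set.Ioo S T, (∫ r in S..t, K r) * pf (lift (transport φ)) (t, ζ) := by
    rw [← integral_indicator measurableSet_Ioo]
    congr 1
    ext t
    by_cases ht : t ∈ Set.Ioo S T
    · simp only [solH, ht, Set.indicator_of_mem]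
      rw [duhamel_eq hq hC hFi ⟨ht.1.le, ht.2.le⟩]
    · simp [ht, solH]
  rw [e1, e2, key, neg_neg]

end Pairing

/-! ### Return from the Fourier side to functions on the slab -/

section Field

variable {d : ℕ} {S T : ℝ} {H W W' M : ℝ × VV d → ℂ}

/-- The real part of a function in flow coordinates, as a function on `ℝ^{1+3d}`. -/
def field (W : ℝ × VV d → ℂ) (X : Pt d) : ℝ := (W (flow d X)).re

theorem eLpNorm_field_le (hW : MemLp W 2 volume) (G : Set (Pt d)) :
    eLpNorm (field W) 2 (volume.restrict G) ≤ eLpNorm W 2 volume := by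
  refine (eLpNorm_restrict_le _ _ _ _).trans ?_
  rw [← eLpNorm_comp_measurePreserving hW.1 measurePreserving_flow]
  exact eLpNorm_mono fun X => Complex.abs_re_le_norm _

theorem memLp_field (hW : MemLp W 2 volume) (G : Set (Pt d)) :
    MemLp (field W) 2 (volume.restrict G) :=
  ((hW.comp_measurePreserving measurePreserving_flow).re).restrict G

/-- A vector of fields. -/
def vfield {ι : Type*} (W : ι → ℝ × VV d → ℂ) (X : Pt d) : EuclideanSpace ℝ ι :=
  WithLp.toLp 2 fun i => field (W i) X

theorem memLp_vfield {ι : Type*} [Fintype ι] {W : ι → ℝ × VV d → ℂ}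
    (hW : ∀ i, MemLp (W i) 2 volume) (G : Set (Pt d)) :
    MemLp (vfield W) 2 (volume.restrict G) :=
  MemLp.of_eval_piLp fun i => memLp_field (hW i) G

theorem eLpNorm_vfield_le {ι : Type*} [Fintype ι] {W : ι → ℝ × VV d → ℂ}
    (hW : ∀ i, MemLp (W i) 2 volume) (G : Set (Pt d)) {C : ℝ≥0∞}
    (hC : ∀ i, eLpNorm (W i) 2 volume ≤ C) :
    eLpNorm (vfield W) 2 (volume.restrict G) ≤ Fintype.card ι * C := by
  classical
  have h1 : eLpNorm (vfield W) 2 (volume.restrict G) ≤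
      eLpNorm (∑ i, fun X => ‖field (W i) X‖) 2 (volume.restrict G) := by
    refine eLpNorm_mono_real fun X => ?_
    rw [Finset.sum_apply, EuclideanSpace.norm_eq]
    refine Real.sqrt_le_iff.2 ⟨Finset.sum_nonneg fun i _ => norm_nonneg _, ?_⟩
    exact Finset.sum_sq_le_sq_sum_of_nonneg fun i _ => norm_nonneg _
  refine h1.trans
    ((eLpNorm_sum_le (fun i _ => (memLp_field (hW i) G).1.norm) (by norm_num)).trans ?_)
  refine (Finset.sum_le_card_nsmul _ _ C fun i _ => ?_).trans (by simp)
  rw [eLpNorm_norm]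
  exact (eLpNorm_field_le (hW i) G).trans (hC i)

/-- A multiplier acting on the transformed test function can be moved onto H. All the weak
derivatives, fractional ones included, are identified in this way. -/
theorem setIntegral_field_mul (hW : IsPF H W) (hW' : IsPF (fun q => M q * H q) W')
    {φ ψ : Pt d → ℝ} (hφ : Adm (lift φ)) (hψ : Adm (lift ψ))
    (hφ0 : ∀ X, X ∉ slab d S T → φ X = 0) (hψ0 : ∀ X, X ∉ slab d S T → ψ X = 0)
    (he : ∀ q, pf (lift ψ) q = M q * pf (lift φ) q) :
    ∫ X in slab d S T, field W' X * φ X = ∫ X in slab d S T, field W X * ψ X := by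
  rw [setIntegral_eq_integral_of_forall_compl_eq_zero fun X hX => by rw [hφ0 X hX, mul_zero],
    setIntegral_eq_integral_of_forall_compl_eq_zero fun X hX => by rw [hψ0 X hX, mul_zero]]
  refine integral_mul_eq_of_isPF hW hW' hφ hψ ?_
  congr 1
  ext q
  rw [he]
  ring

/-- The bound on the slices of H passes to those of W only for almost every t, which is what the
filter in `ZeroInitial` allows. -/
theorem zeroInitial_field (h : IsPF H W) {C : ℝ≥0∞} (hC : C ≠ ⊤)
    (hb : ∀ t, S < t → eLpNorm (fun ζ => H (t, ζ)) 2 volume ≤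
      ENNReal.ofReal (Real.sqrt (t - S)) * C) : ZeroInitial S (field W) := by
  have h1 : ∀ᶠ t in 𝓝[>] S ⊓ ae volume,
      eLpNorm (fun p : E d × E d × E d => field W (t, p)) 2 volume ≤
        ENNReal.ofReal (Real.sqrt (t - S)) * C := by
    have hae : ∀ᶠ t in 𝓝[>] S ⊓ ae volume, t ∈ Set.Ioi S :=
      (eventually_mem_nhdsWithin (a := S) (s := Set.Ioi S)).filter_mono inf_le_left
    filter_upwards [hae, (h.slice_le).filter_mono inf_le_right,
      (ae_memLp_slice h.right).filter_mono inf_le_right] with t ht h2 h3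
    refine le_trans ?_ (h2.trans (hb t ht))
    rw [← eLpNorm_comp_measurePreserving h3.1 (measurePreserving_slice t)]
    exact eLpNorm_mono fun p => Complex.abs_re_le_norm _
  have h2 : Tendsto (fun t => ENNReal.ofReal (Real.sqrt (t - S)) * C) (𝓝[>] S ⊓ ae volume)
      (𝓝 0) := by
    have h3 : Tendsto (fun t => ENNReal.ofReal (Real.sqrt (t - S))) (𝓝 S) (𝓝 0) := by
      have : Continuous fun t => ENNReal.ofReal (Real.sqrt (t - S)) :=
        ENNReal.continuous_ofReal.comp (by fun_prop)
      simpa using this.tendsto S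
    have h4 := ENNReal.Tendsto.mul_const (b := C) h3 (Or.inr hC)
    rw [zero_mul] at h4
    exact h4.mono_left (inf_le_left.trans nhdsWithin_le_nhds)
  exact tendsto_of_tendsto_of_tendsto_of_le_of_le' tendsto_const_nhds h2
    (Eventually.of_forall fun _ => zero_le) h1

end Field

/-! ### Existence and the full estimate -/

section Existence

variable {d : ℕ} {δ : ℝ} {a : ℝ → Matrix (Fin d) (Fin d) ℝ} {S T : ℝ}

/-- The symbol of `∂_{x_i}`. -/
def symX (i : Fin d) (q : ℝ × VV d) : ℂ := 2 * Real.pi * Complex.I * (fkap q i : ℝ)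

theorem continuous_symX (i : Fin d) : Continuous (symX i) :=
  continuous_const.mul (Complex.continuous_ofReal.comp (continuous_fkap_apply i))

theorem norm_symX_le (i : Fin d) (q : ℝ × VV d) : ‖symX i q‖ ≤ 2 * Real.pi * ‖fkap q‖ := by
  have h := PiLp.norm_apply_le (fkap q) i
  simp only [symX, norm_mul, Complex.norm_I, mul_one, Complex.norm_real, Complex.norm_ofNat,
    Real.norm_of_nonneg Real.pi_pos.le]
  exact mul_le_mul_of_nonneg_left h (by positivity)

theorem sum_symX_mul (q : ℝ × VV d) :
    ∑ i, ∑ j, (a q.1 i j : ℂ) * (symX i q * symX j q) = -qsym a q := by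
  simp only [qsym, symX]
  push_cast
  rw [Finset.mul_sum, ← Finset.sum_neg_distrib]
  refine Finset.sum_congr rfl fun i _ => ?_
  rw [Finset.mul_sum, ← Finset.sum_neg_distrib]
  refine Finset.sum_congr rfl fun j _ => ?_
  linear_combination (a q.1 i j : ℂ) * 4 * Real.pi ^ 2 * fkap q i * fkap q j * Complex.I_sq

theorem norm_fkap_le (q : ℝ × VV d) : ‖fkap q‖ ≤ 1 + fwt q := by
  have h1 : 0 ≤ ‖flam q‖ ^ (2 / 3 : ℝ) := by positivity
  have h2 : 0 ≤ ‖fm q.2‖ ^ (2 / 5 : ℝ) := by positivity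
  rw [fwt_eq]
  nlinarith [sq_nonneg (‖fkap q‖ - 1)]

theorem norm_fkap_sq_le (q : ℝ × VV d) : ‖fkap q‖ ^ 2 ≤ 1 + fwt q := by
  have h1 : 0 ≤ ‖flam q‖ ^ (2 / 3 : ℝ) := by positivity
  have h2 : 0 ≤ ‖fm q.2‖ ^ (2 / 5 : ℝ) := by positivity
  rw [fwt_eq]
  linarith

theorem norm_flam_rpow_le (q : ℝ × VV d) : ‖flam q‖ ^ (2 / 3 : ℝ) ≤ 1 + fwt q := by
  have h1 : 0 ≤ ‖fkap q‖ ^ 2 := by positivity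
  have h2 : 0 ≤ ‖fm q.2‖ ^ (2 / 5 : ℝ) := by positivity
  rw [fwt_eq]
  linarith

theorem norm_fm_rpow_le (q : ℝ × VV d) : ‖fm q.2‖ ^ (2 / 5 : ℝ) ≤ 1 + fwt q := by
  have h1 : 0 ≤ ‖fkap q‖ ^ 2 := by positivity
  have h2 : 0 ≤ ‖flam q‖ ^ (2 / 3 : ℝ) := by positivity
  rw [fwt_eq]
  linarith

/-- The mixed symbol of ∇_x(−Δ_y)^{1/6} is interpolated by 2ab ≤ a² + b² with a = |κ| and b =
|λ|^{1/3}. -/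
theorem norm_fkap_mul_flam_le (q : ℝ × VV d) :
    ‖fkap q‖ * ‖flam q‖ ^ (1 / 3 : ℝ) ≤ 1 + fwt q := by
  have h2 : 0 ≤ ‖fm q.2‖ ^ (2 / 5 : ℝ) := by positivity
  have h3 : ‖flam q‖ ^ (2 / 3 : ℝ) = (‖flam q‖ ^ (1 / 3 : ℝ)) ^ 2 := by
    rw [← Real.rpow_natCast, ← Real.rpow_mul (norm_nonneg _)]
    norm_num
  rw [fwt_eq, h3]
  nlinarith [sq_nonneg (‖fkap q‖ - ‖flam q‖ ^ (1 / 3 : ℝ)), norm_nonneg (fkap q),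
    sq_nonneg (‖fkap q‖ + ‖flam q‖ ^ (1 / 3 : ℝ))]

theorem memLp_indicator_lift {f : Pt d → ℝ} (hf : MemLp f 2 (volume.restrict (slab d S T))) :
    MemLp (lift ((slab d S T).indicator f)) 2 volume :=
  memLp_lift ((memLp_indicator_iff_restrict measurableSet_slab).2 hf)

theorem eLpNorm_indicator_lift {f : Pt d → ℝ}
    (hf : MemLp f 2 (volume.restrict (slab d S T))) :
    eLpNorm (lift ((slab d S T).indicator f)) 2 volume =
      eLpNorm f 2 (volume.restrict (slab d S T)) := by
  have h := (memLp_indicator_iff_restrict measurableSet_slab).2 hf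
  rw [← eLpNorm_indicator_eq_eLpNorm_restrict measurableSet_slab,
    ← eLpNorm_comp_measurePreserving h.1 (measurePreserving_flow_symm (d := d))]
  refine eLpNorm_congr_norm_ae (Eventually.of_forall fun q => ?_)
  simp [lift]

theorem IsPF.restrict_time {H W : ℝ × VV d → ℂ} (h : IsPF H W) (S T : ℝ) :
    IsPF (fun q => (Set.Ioo S T).indicator (fun _ => (1 : ℂ)) q.1 * H q)
      (fun q => (Set.Ioo S T).indicator (fun _ => (1 : ℂ)) q.1 * W q) := by
  refine h.time_mul (K := 1)
    (stronglyMeasurable_const.indicator measurableSet_Ioo).aestronglyMeasurable fun t => ?_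
  by_cases ht : t ∈ Set.Ioo S T <;> simp [ht]

/-- A strongly measurable version of the inverse transform is cut off in time; the cutoff commutes
with the transform and does not change a function supported in the slab. Everywhere defined,
measurable fibres are needed to solve the equation one frequency at a time. -/
theorem exists_isPF_inv_slab {f : Pt d → ℝ} (hf : MemLp f 2 (volume.restrict (slab d S T))) :
    ∃ F : ℝ × VV d → ℂ, StronglyMeasurable F ∧ (∀ q, q.1 ∉ Set.Ioo S T → F q = 0) ∧
      IsPF F (lift ((slab d S T).indicator f)) ∧
      eLpNorm F 2 volume ≤ eLpNorm f 2 (volume.restrict (slab d S T)) := by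
  obtain ⟨F, hF, hFn⟩ := exists_isPF_inv (memLp_indicator_lift hf)
  have h1 := (hF.congr hF.left.1.ae_eq_mk (EventuallyEq.refl _ _)).restrict_time S T
  have h2 : (fun q => (Set.Ioo S T).indicator (fun _ => (1 : ℂ)) q.1 *
      lift ((slab d S T).indicator f) q) = lift ((slab d S T).indicator f) := by
    ext q
    by_cases hq : q.1 ∈ Set.Ioo S T
    · simp [hq]
    · simp [hq, lift, slab, flow_symm_apply]
  rw [h2] at h1
  refine ⟨_, ?_, ?_, h1, ?_⟩
  · exact StronglyMeasurable.mul ((stronglyMeasurable_const.indicator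
      measurableSet_Ioo).comp_measurable measurable_fst) hF.left.1.stronglyMeasurable_mk
  · intro q hq
    simp [hq]
  · rw [← eLpNorm_indicator_lift hf]
    refine le_trans ?_ hFn
    refine le_trans ?_ (eLpNorm_congr_ae hF.left.1.ae_eq_mk).ge
    refine eLpNorm_mono fun q => ?_
    by_cases hq : q.1 ∈ Set.Ioo S T <;> simp [hq]

theorem exists_solution (d : ℕ) (hδ : 0 < δ) {τ : ℝ} (hτ : 0 < τ) :
    ∃ N : ℝ≥0, ∀ (S T : ℝ), T - S = τ → ∀ a : ℝ → Matrix (Fin d) (Fin d) ℝ, IsElliptic δ a →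
      (∀ i j, Measurable fun t => a t i j) →
      ∀ f : Pt d → ℝ, MemLp f 2 (volume.restrict (slab d S T)) →
      ∃ u : Pt d → ℝ, IsCauchySolution a S T f u ∧
        FullBound (slab d S T) u (N * eLpNorm f 2 (volume.restrict (slab d S T))) := by
  obtain ⟨N₀, hN₀⟩ := exists_solH_bound d hδ τ
  obtain ⟨C₃, hC₃, hs₃⟩ := exists_norm_fracSymbol_le d (s := 1 / 3) (by norm_num) (by norm_num)
  obtain ⟨C₅, hC₅, hs₅⟩ := exists_norm_fracSymbol_le d (s := 1 / 5) (by norm_num) (by norm_num)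
  obtain ⟨C₆, hC₆, hs₆⟩ := exists_norm_fracSymbol_le d (s := 1 / 6) (by norm_num) (by norm_num)
  lift C₃ to ℝ≥0 using hC₃
  lift C₅ to ℝ≥0 using hC₅
  lift C₆ to ℝ≥0 using hC₆
  let Cπ : ℝ≥0 := ⟨2 * Real.pi, by positivity⟩
  let Cδ : ℝ≥0 := ⟨4 * Real.pi ^ 2 * δ⁻¹, by positivity⟩
  have hCπ : (Cπ : ℝ) = 2 * Real.pi := rfl
  -- One summand for each norm in `FullBound`, in the same order. Cardinalities come from bounding a
  -- vector by the sum of its components, and the last summand bounds F − qH.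
  refine ⟨1 * N₀ + Fintype.card (Fin d) * (Cπ * N₀) + Fintype.card (Fin d) * (Cπ * C₆ * N₀)
    + Fintype.card (Fin d × Fin d) * (Cπ ^ 2 * N₀) + C₃ * N₀ + C₅ * N₀ + (1 + Cδ * N₀), ?_⟩
  intro S T hST a ha ham f hf
  obtain ⟨F, hFm, hF0, hF, hFn⟩ := exists_isPF_inv_slab hf
  have hb := hN₀ S T hST a ha ham F hFm
  have hHm := stronglyMeasurable_solH (S := S) (T := T) ham hFm
  set H := solH a S T F with hHdef
  set A := eLpNorm f 2 (volume.restrict (slab d S T))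
  have hmul (M : ℝ × VV d → ℂ) (hM : StronglyMeasurable M) (C : ℝ≥0)
      (hC : ∀ q, ‖M q‖ ≤ C * (1 + fwt q)) :
      ∃ W, IsPF (fun q => M q * H q) W ∧ eLpNorm W 2 volume ≤ (C * N₀ : ℝ≥0) * A := by
    obtain ⟨h1, h2⟩ := memLp_symbol_mul hHm hF.left hb hM hC
    obtain ⟨W, hW, hWn⟩ := exists_isPF h1
    exact ⟨W, hW, hWn.trans (h2.trans (mul_le_mul_right hFn _))⟩
  obtain ⟨W, hW, hWn⟩ := hmul (fun _ => 1) stronglyMeasurable_const 1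
    (fun q => by simpa using fwt_nonneg q)
  simp only [one_mul] at hW
  have hMx (i : Fin d) (q : ℝ × VV d) : ‖symX i q‖ ≤ Cπ * (1 + fwt q) :=
    (norm_symX_le i q).trans (mul_le_mul_of_nonneg_left (norm_fkap_le q) Cπ.2)
  choose Wx hWx hWxn using fun i : Fin d =>
    hmul (symX i) (continuous_symX i).stronglyMeasurable Cπ (hMx i)
  have hMxx (i j : Fin d) (q : ℝ × VV d) :
      ‖symX i q * symX j q‖ ≤ (Cπ ^ 2 : ℝ≥0) * (1 + fwt q) := by
    rw [norm_mul, NNReal.coe_pow, hCπ]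
    calc ‖symX i q‖ * ‖symX j q‖ ≤ (2 * Real.pi * ‖fkap q‖) * (2 * Real.pi * ‖fkap q‖) :=
          mul_le_mul (norm_symX_le i q) (norm_symX_le j q) (norm_nonneg _) (by positivity)
      _ = (2 * Real.pi) ^ 2 * ‖fkap q‖ ^ 2 := by ring
      _ ≤ _ := mul_le_mul_of_nonneg_left (norm_fkap_sq_le q) (by positivity)
  choose Wh hWh hWhn using fun ij : Fin d × Fin d =>
    hmul (fun q => symX ij.1 q * symX ij.2 q)
      ((continuous_symX ij.1).mul (continuous_symX ij.2)).stronglyMeasurable (Cπ ^ 2)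
      (hMxx ij.1 ij.2)
  have hfm (s : ℝ) : StronglyMeasurable fun q : ℝ × VV d => fracSymbol d s (flam q) :=
    (stronglyMeasurable_fracSymbol d s).comp_measurable continuous_flam.measurable
  have hMxf (i : Fin d) (q : ℝ × VV d) :
      ‖symX i q * fracSymbol d (1 / 6) (flam q)‖ ≤ (Cπ * C₆ : ℝ≥0) * (1 + fwt q) := by
    rw [norm_mul, NNReal.coe_mul, hCπ]
    have h6 := hs₆ (flam q)
    rw [show (2 * (1 / 6) : ℝ) = 1 / 3 by norm_num] at h6
    calc _ ≤ (2 * Real.pi * ‖fkap q‖) * (C₆ * ‖flam q‖ ^ (1 / 3 : ℝ)) :=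
          mul_le_mul (norm_symX_le i q) h6 (norm_nonneg _) (by positivity)
      _ = (2 * Real.pi * C₆) * (‖fkap q‖ * ‖flam q‖ ^ (1 / 3 : ℝ)) := by ring
      _ ≤ _ := mul_le_mul_of_nonneg_left (norm_fkap_mul_flam_le q) (by positivity)
  choose Wxf hWxf hWxfn using fun i : Fin d =>
    hmul (fun q => symX i q * fracSymbol d (1 / 6) (flam q))
      ((continuous_symX i).stronglyMeasurable.mul (hfm _)) (Cπ * C₆) (hMxf i)
  obtain ⟨Wy, hWy, hWyn⟩ := hmul (fun q => fracSymbol d (1 / 3) (flam q)) (hfm _) C₃ fun q => by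
    have h3 := hs₃ (flam q)
    rw [show (2 * (1 / 3) : ℝ) = 2 / 3 by norm_num] at h3
    exact h3.trans (mul_le_mul_of_nonneg_left (norm_flam_rpow_le q) C₃.2)
  obtain ⟨Wz, hWz, hWzn⟩ := hmul (fun q => fracSymbol d (1 / 5) (fm q.2))
    ((stronglyMeasurable_fracSymbol d _).comp_measurable
      (continuous_fm.comp continuous_snd).measurable) C₅ fun q => by
    have h5 := hs₅ (fm q.2)
    rw [show (2 * (1 / 5) : ℝ) = 2 / 5 by norm_num] at h5
    exact h5.trans (mul_le_mul_of_nonneg_left (norm_fm_rpow_le q) C₅.2)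
  -- The weak gradient carries a minus sign, whereas the multiplier `symX` is moved onto H without
  -- one; hence the negation, here and for `hgradf`.
  have hgrad : IsGradX (slab d S T) (field W) (-vfield Wx) := by
    refine ⟨(memLp_vfield (fun i => (hWx i).right) _).neg, fun i φ hφ => ?_⟩
    have := setIntegral_field_mul hW (hWx i) hφ.adm (hφ.dX i).adm (fun X hX => hφ.eq_zero hX)
      (fun X hX => (hφ.dX i).eq_zero hX) (hφ.pf_dX i)
    rw [← this, ← integral_neg]
    simp [vfield]
  have hhess : IsHessX (slab d S T) (field W) (vfield Wh) := by
    refine ⟨memLp_vfield (fun i => (hWh i).right) _, fun i j φ hφ => ?_⟩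
    refine setIntegral_field_mul hW (hWh (i, j)) hφ.adm ((hφ.dX j).dX i).adm
      (fun X hX => hφ.eq_zero hX) (fun X hX => ((hφ.dX j).dX i).eq_zero hX) fun q => ?_
    rw [(hφ.dX j).pf_dX i, hφ.pf_dX j, ← mul_assoc]
    rfl
  have hgradf : IsGradXFracLapY (1 / 6) (slab d S T) (field W) (-vfield Wxf) := by
    refine ⟨(memLp_vfield (fun i => (hWxf i).right) _).neg, fun i φ hφ => ?_⟩
    have := setIntegral_field_mul hW (hWxf i) hφ.adm
      ((hφ.dX i).adm_fracLapY (s := 1 / 6) (by norm_num) (by norm_num))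
      (fun X hX => hφ.eq_zero hX)
      (fun X hX => (hφ.dX i).fracLapY_eq_zero _ hX) (fun q => by
        rw [(hφ.dX i).pf_fracLapY (by norm_num) (by norm_num), hφ.pf_dX i, symX]
        ring)
    rw [← this, ← integral_neg]
    simp [vfield]
  have hfy : IsFracLapY (1 / 3) (slab d S T) (field W) (field Wy) :=
    ⟨memLp_field hWy.right _, fun φ hφ => setIntegral_field_mul hW hWy hφ.adm
      (hφ.adm_fracLapY (by norm_num) (by norm_num)) (fun X hX => hφ.eq_zero hX)
      (fun X hX => hφ.fracLapY_eq_zero _ hX) (hφ.pf_fracLapY (by norm_num) (by norm_num))⟩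
  have hfz : IsFracLapZ (1 / 5) (slab d S T) (field W) (field Wz) :=
    ⟨memLp_field hWz.right _, fun φ hφ => setIntegral_field_mul hW hWz hφ.adm
      (hφ.adm_fracLapZ (by norm_num) (by norm_num)) (fun X hX => hφ.eq_zero hX)
      (fun X hX => hφ.fracLapZ_eq_zero _ hX) (hφ.pf_fracLapZ (by norm_num) (by norm_num))⟩
  obtain ⟨K, hK⟩ := ha.bounded
  have hYW := hF.add (IsPF.sum Finset.univ fun i _ => IsPF.sum Finset.univ fun j _ =>
    (hWh (i, j)).time_mul (c := fun t => (a t i j : ℂ)) (K := K)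
      (Complex.measurable_ofReal.comp (ham i j)).aestronglyMeasurable
      (fun t => by simpa using hK t i j))
  -- The candidate transport derivative is f + Σ a^{ij} ∂_{x_i x_j}u, so the equation holds by
  -- construction. What has to be proved is that it is the transport derivative of u; this follows
  -- because its frequency side is F − qH.
  set WY : ℝ × VV d → ℂ := fun q => lift ((slab d S T).indicator f) q +
    ∑ i, ∑ j, (a q.1 i j : ℂ) * Wh (i, j) q with hWY
  have hYH : IsPF (fun q => F q - qsym a q * H q) WY := by
    convert hYW using 1
    ext q
    rw [sub_eq_add_neg, ← neg_mul, ← sum_symX_mul, Finset.sum_mul]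
    congr 1
    refine Finset.sum_congr rfl fun i _ => ?_
    rw [Finset.sum_mul]
    refine Finset.sum_congr rfl fun j _ => ?_
    ring
  have htr : IsTransport (slab d S T) (field W) (field WY) := by
    refine ⟨memLp_field hYH.right _, fun φ hφ => ?_⟩
    have hY : Adm (lift (transport φ)) := adm_lift_of_continuous (continuous_transport hφ.smooth)
      (hasCompactSupport_transport hφ.compact)
    rw [setIntegral_eq_integral_of_forall_compl_eq_zero
        fun X hX => by rw [hφ.eq_zero hX, mul_zero],
      setIntegral_eq_integral_of_forall_compl_eq_zero
        fun X hX => by rw [hφ.transport_eq_zero hX, mul_zero]]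
    have key := integral_solH_transport hδ ha ham (by linarith) hFm hF.left hW.left hYH.left
      (fun q => by
        by_cases hq : q.1 ∈ Set.Ioo S T
        · simp [hq, hHdef]
        · simp [hq, hHdef, hF0 q hq, solH]) hφ
    have h1 := integral_mul_eq_of_isPF hW (hYH.const_mul (-1)) hφ.adm hY (by
      simp only [neg_mul, one_mul, integral_neg]
      rw [key, neg_neg])
    have h2 : ∀ X, (-1 * WY (flow d X)).re = -field WY X := fun X => by simp [field]
    simp only [h2] at h1
    simp only [neg_mul, integral_neg] at h1
    rw [← neg_eq_iff_eq_neg]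
    exact h1
  have hYn : eLpNorm WY 2 volume ≤ (1 + Cδ * N₀ : ℝ≥0) * A := by
    have hqm : StronglyMeasurable fun q => (qsym a q : ℂ) :=
      (Complex.measurable_ofReal.comp (measurable_qsym ham)).stronglyMeasurable
    obtain ⟨h1, h2⟩ := memLp_symbol_mul hHm hF.left hb hqm (C := Cδ) fun q => by
      rw [Complex.norm_real, Real.norm_of_nonneg (qsym_nonneg hδ ha q)]
      exact (qsym_upper ha q).trans (mul_le_mul_of_nonneg_left (norm_fkap_sq_le q) Cδ.2)
    refine hYH.eLpNorm_le.trans ((eLpNorm_sub_le hF.left.1 h1.1 (by norm_num)).trans ?_)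
    refine (add_le_add hFn (h2.trans (mul_le_mul_right hFn _))).trans (le_of_eq ?_)
    push_cast
    ring
  have heq : SolvesP0 a (slab d S T) (field W) f := by
    refine ⟨_, _, hhess, htr, ?_⟩
    filter_upwards [ae_restrict_mem measurableSet_slab] with X hX
    simp only [field, vfield, hWY, Complex.add_re, Complex.re_sum, Complex.re_ofReal_mul,
      lift_flow, Set.indicator_of_mem hX, Complex.ofReal_re]
    exact add_sub_cancel_right _ _
  refine ⟨field W, ⟨⟨memLp_field hW.right _, ⟨_, hgrad⟩, ⟨_, hhess⟩, ⟨_, htr⟩⟩, heq, ?_⟩, ?_⟩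
  · exact zeroInitial_field hW hF.left.2.ne fun t ht =>
      eLpNorm_solH_slice_le hδ ha ham hFm ht
  · refine ⟨_, _, _, _, _, _, hgrad, hgradf, hhess, hfy, hfz, htr, ?_⟩
    rw [eLpNorm_neg, eLpNorm_neg]
    refine (add_le_add (add_le_add (add_le_add (add_le_add (add_le_add (add_le_add
      ((eLpNorm_field_le hW.right _).trans hWn)
      (eLpNorm_vfield_le (fun i => (hWx i).right) _ hWxn))
      (eLpNorm_vfield_le (fun i => (hWxf i).right) _ hWxfn))
      (eLpNorm_vfield_le (fun i => (hWh i).right) _ hWhn))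
      ((eLpNorm_field_le hWy.right _).trans hWyn))
      ((eLpNorm_field_le hWz.right _).trans hWzn))
      ((eLpNorm_field_le hYH.right _).trans hYn)).trans (le_of_eq ?_)
    push_cast
    ring

end Existence

/-! ### Functions determined by moments against tensor products -/

section Density

/-- A π–λ argument: rectangles generate the product σ-algebra, and the sets with zero integral are
stable under complements and countable disjoint unions. -/
theorem ae_eq_zero_of_rectangles {α β : Type*} [MeasurableSpace α] [MeasurableSpace β]
    {μ : Measure (α × β)} {G : α × β → ℂ} (hG : Integrable G μ)
    (h : ∀ A B, MeasurableSet A → MeasurableSet B → ∫ q in A ×ˢ B, G q ∂μ = 0) :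
    G =ᵐ[μ] 0 := by
  have huniv : ∫ q, G q ∂μ = 0 := by
    have := h Set.univ Set.univ MeasurableSet.univ MeasurableSet.univ
    simpa using this
  refine hG.ae_eq_zero_of_forall_setIntegral_eq_zero fun s hs _ => ?_
  refine MeasurableSpace.induction_on_inter (C := fun s _ => ∫ q in s, G q ∂μ = 0)
    generateFrom_prod.symm isPiSystem_prod ?_ ?_ ?_ ?_ s hs
  · simp
  · rintro t ⟨A, hA, B, hB, rfl⟩
    exact h A B hA hB
  · intro t ht hC
    rw [setIntegral_compl ht hG, huniv, hC, sub_zero]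
  · intro f hd hf hC
    rw [integral_iUnion hf hd hG.integrableOn]
    simp [hC]

variable {V : Type*} [NormedAddCommGroup V] [InnerProductSpace ℝ V] [FiniteDimensional ℝ V]
  [MeasurableSpace V] [BorelSpace V]

/-- Every test function is the transform of a Schwartz function, so moving the transform onto g
makes its integral against any test function vanish. -/
theorem ae_eq_zero_of_fourier_eq_zero {g : V → ℂ} (hg : Integrable g) (h : ∀ ζ, 𝓕 g ζ = 0) :
    ∀ᵐ ζ, g ζ = 0 := by
  refine ae_eq_zero_of_integral_contDiff_smul_eq_zero hg.locallyIntegrable fun ψ hψ hψc => ?_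
  have hψ' : ContDiff ℝ ∞ (fun v => (ψ v : ℂ)) := Complex.ofRealCLM.contDiff.comp hψ
  have hψc' : HasCompactSupport (fun v => (ψ v : ℂ)) :=
    hψc.comp_left (g := fun x : ℝ => (x : ℂ)) (by simp)
  let Ψ : 𝓢(V, ℂ) := hψc'.toSchwartzMap hψ'
  have e1 : 𝓕 (⇑(𝓕⁻ Ψ : 𝓢(V, ℂ))) = Ψ := by
    rw [← SchwartzMap.fourier_coe, FourierTransform.fourier_fourierInv_eq]
  have e2 := integral_fourier_mul_eq (𝓕⁻ Ψ : 𝓢(V, ℂ)).integrable hg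
  rw [e1] at e2
  simp only [h, mul_zero, integral_zero] at e2
  exact e2

/-- A bump supported so close to 0 that |⟨p, ζ⟩| ≤ 1/4 for ‖ζ‖ < n: on its support cos(2π⟨p, ζ⟩) ≥
0, with value 1 at the origin, so the real part of the transform is positive. -/
theorem exists_fourier_ne_zero (n : ℝ) : ∃ ρ : V → ℝ, ContDiff ℝ ∞ ρ ∧ HasCompactSupport ρ ∧
    ∀ ζ : V, ‖ζ‖ < n → 𝓕 (fun p => (ρ p : ℂ)) ζ ≠ 0 := by
  have hr : 0 < 1 / (4 * (|n| + 1)) := by positivity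
  let ρ : ContDiffBump (0 : V) := ⟨1 / (4 * (|n| + 1)) / 2, 1 / (4 * (|n| + 1)), by positivity,
    half_lt_self hr⟩
  refine ⟨ρ, ρ.contDiff, ρ.hasCompactSupport, fun ζ hζ h0 => ?_⟩
  have hi : Integrable fun p : V => Real.fourierChar (-inner ℝ p ζ) • (ρ p : ℂ) :=
    (Real.fourierIntegral_convergent_iff ζ).2 ρ.integrable.ofReal
  have h1 : ∀ p, RCLike.re (Real.fourierChar (-inner ℝ p ζ) • (ρ p : ℂ)) =
      Real.cos (2 * Real.pi * inner ℝ p ζ) * ρ p := fun p => by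
    rw [Circle.smul_def, smul_eq_mul, Real.fourierChar_apply, RCLike.re_eq_complex_re,
      Complex.re_mul_ofReal, Complex.exp_ofReal_mul_I_re, mul_neg, Real.cos_neg]
  rw [Real.fourier_eq] at h0
  have h2 := integral_re (𝕜 := ℂ) hi
  rw [h0] at h2
  simp only [h1, map_zero] at h2
  have hpos : 0 < ∫ p, Real.cos (2 * Real.pi * inner ℝ p ζ) * ρ p := by
    refine Continuous.integral_pos_of_hasCompactSupport_nonneg_nonzero (x := 0) ?_ ?_ ?_ ?_
    · exact (Real.continuous_cos.comp (by fun_prop)).mul ρ.continuous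
    · exact ρ.hasCompactSupport.mul_left
    · intro p
      by_cases hp : p ∈ Metric.ball (0 : V) ρ.rOut
      · refine mul_nonneg (Real.cos_nonneg_of_mem_Icc ?_) ρ.nonneg
        rw [mem_ball_zero_iff] at hp
        have h3 : |inner ℝ p ζ| ≤ 1 / 4 := by
          refine (abs_real_inner_le_norm p ζ).trans ?_
          have h4 : ‖p‖ * ‖ζ‖ ≤ 1 / (4 * (|n| + 1)) * (|n| + 1) :=
            mul_le_mul hp.le (by linarith [le_abs_self n]) (norm_nonneg _) hr.le
          refine h4.trans (le_of_eq ?_)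
          field_simp
        rw [abs_le] at h3
        constructor <;> nlinarith [Real.pi_pos]
      · have : ρ p = 0 := by
          rw [← Function.notMem_support, ρ.support_eq]
          exact hp
        simp [this]
    · simp only [inner_zero_left, mul_zero, Real.cos_zero, one_mul]
      exact (ρ.pos_of_mem_ball (Metric.mem_ball_self hr)).ne'
  exact hpos.ne h2.symm

/-- Smooth functions with compact support in an interval. -/
structure IsTest1 (S T : ℝ) (θ : ℝ → ℝ) : Prop where
  smooth : ContDiff ℝ ∞ θ
  compact : HasCompactSupport θ
  support : tsupport θ ⊆ Set.Ioo S T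

theorem exists_isTest1_ne_zero (S T : ℝ) :
    ∃ χ : ℕ → ℝ → ℝ, (∀ n, IsTest1 S T (χ n)) ∧ (∀ n t, 0 ≤ χ n t) ∧
      ∀ t ∈ Set.Ioo S T, ∃ n₀, ∀ n, n₀ ≤ n → χ n t ≠ 0 := by
  rcases le_or_gt T S with hTS | hST
  · refine ⟨fun _ _ => 0, fun n => ⟨contDiff_const, HasCompactSupport.zero, by simp [tsupport]⟩,
      fun _ _ => le_rfl, fun t ht => absurd (ht.1.trans ht.2) (not_lt.2 hTS)⟩
  set L := (T - S) / 2 with hL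
  have hLp : 0 < L := by rw [hL]; linarith
  have hlt (n : ℕ) : 0 < 1 - 1 / ((n : ℝ) + 2) := by
    rw [sub_pos, div_lt_one (by positivity)]
    have : (0 : ℝ) ≤ n := n.cast_nonneg
    linarith
  -- The outer radii stay strictly below half the length of the interval and increase to it; the
  -- shift by 2 keeps the radius positive at n = 0.
  let χ : ℕ → ContDiffBump ((S + T) / 2) := fun n => ⟨L * (1 - 1 / ((n : ℝ) + 2)) / 2,
    L * (1 - 1 / ((n : ℝ) + 2)), by have := hlt n; positivity,
    half_lt_self (mul_pos hLp (hlt n))⟩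
  refine ⟨fun n => χ n, fun n => ⟨(χ n).contDiff, (χ n).hasCompactSupport, ?_⟩,
    fun n t => (χ n).nonneg, fun t ht => ?_⟩
  · rw [(χ n).tsupport_eq, Real.closedBall_eq_Icc]
    have h1 : (χ n).rOut < L := by
      have : 0 < 1 / ((n : ℝ) + 2) := by positivity
      show L * (1 - 1 / ((n : ℝ) + 2)) < L
      nlinarith
    intro t ht
    constructor
    · have := ht.1
      linarith
    · have := ht.2
      linarith
  · have h1 : |t - (S + T) / 2| < L := by
      rw [abs_lt]
      constructor <;> linarith [ht.1, ht.2]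
    have h2 : Tendsto (fun n : ℕ => L * (1 - 1 / ((n : ℝ) + 2))) atTop (𝓝 (L * (1 - 0))) := by
      refine (tendsto_const_nhds.sub ?_).const_mul L
      refine ((tendsto_one_div_add_atTop_nhds_zero_nat (𝕜 := ℝ)).comp
        (tendsto_add_atTop_nat 1)).congr fun n => ?_
      simp only [Function.comp_apply]
      push_cast
      ring_nf
    rw [sub_zero, mul_one] at h2
    obtain ⟨n₀, hn₀⟩ := eventually_atTop.1 (h2.eventually (lt_mem_nhds h1))
    refine ⟨n₀, fun n hn => ((χ n).pos_of_mem_ball ?_).ne'⟩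
    rw [Metric.mem_ball, Real.dist_eq]
    exact hn₀ n hn

theorem IsTest1.mul {S T : ℝ} {χ θ : ℝ → ℝ} (hχ : IsTest1 S T χ) (hθ : ContDiff ℝ ∞ θ) :
    IsTest1 S T fun t => χ t * θ t where
  smooth := hχ.smooth.mul hθ
  compact := hχ.compact.mul_right
  support := (closure_mono (Function.support_mul_subset_left _ _)).trans hχ.support

/-- Functions are determined on a time strip by their moments against tensor products. -/
theorem ae_eq_zero_of_tensor {S T : ℝ} {R : ℝ × V → ℂ}
    (hR : ∀ (θ : ℝ → ℝ) (ρ : V → ℝ), IsTest1 S T θ → ContDiff ℝ ∞ ρ → HasCompactSupport ρ →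
      Integrable (fun q : ℝ × V => R q * (θ q.1 * 𝓕 (fun p => (ρ p : ℂ)) q.2)) ∧
      ∫ q : ℝ × V, R q * (θ q.1 * 𝓕 (fun p => (ρ p : ℂ)) q.2) = 0) :
    ∀ᵐ q : ℝ × V, q.1 ∈ Set.Ioo S T → R q = 0 := by
  have key (θ : ℝ → ℝ) (ρ : V → ℝ) (hθ : IsTest1 S T θ) (hρ : ContDiff ℝ ∞ ρ)
      (hρc : HasCompactSupport ρ) :
      ∀ᵐ ζ, ∫ t, R (t, ζ) * (θ t * 𝓕 (fun p => (ρ p : ℂ)) ζ) = 0 := by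
    have hi := (hR θ ρ hθ hρ hρc).1
    rw [Measure.volume_eq_prod] at hi
    -- Translating ρ by v multiplies its transform by a character, so the hypothesis for all
    -- translates says that the Fourier transform of the time moment vanishes at every v.
    refine ae_eq_zero_of_fourier_eq_zero hi.integral_prod_right fun v => ?_
    obtain ⟨h1, h2⟩ := hR θ (fun p => ρ (p - v)) hθ (hρ.comp (contDiff_id.sub contDiff_const))
      (hρc.comp_homeomorph (Homeomorph.subRight v))
    rw [Measure.volume_eq_prod] at h1 h2
    rw [integral_prod_symm _ h1] at h2
    rw [Real.fourier_eq, ← h2]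
    congr 1
    ext ζ
    rw [Circle.smul_def, smul_eq_mul, ← integral_const_mul]
    congr 1
    ext t
    rw [fourier_comp_sub (fun p => (ρ p : ℂ)), real_inner_comm]
    ring
  obtain ⟨χ, hχ, -, hχ0⟩ := exists_isTest1_ne_zero S T
  choose ρ hρ hρc hρ0 using fun n : ℕ => exists_fourier_ne_zero (V := V) n
  have hz (n : ℕ) : ∀ᵐ q : ℝ × V, R q * (χ n q.1 * 𝓕 (fun p => (ρ n p : ℂ)) q.2) = 0 := by
    have hi := (hR (χ n) (ρ n) (hχ n) (hρ n) (hρc n)).1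
    refine ae_eq_zero_of_rectangles hi fun A B hA hB => ?_
    rw [Measure.volume_eq_prod] at hi ⊢
    have hiB : Integrable (fun q : ℝ × V => R q * (χ n q.1 * 𝓕 (fun p => (ρ n p : ℂ)) q.2))
        (volume.prod (volume.restrict B)) := by
      have := hi.integrableOn (s := Set.univ ×ˢ B)
      rwa [IntegrableOn, ← Measure.prod_restrict, Measure.restrict_univ] at this
    have hz : ∀ᵐ t : ℝ, ∫ ζ in B, R (t, ζ) * (χ n t * 𝓕 (fun p => (ρ n p : ℂ)) ζ) = 0 := by
      -- A further factor θ(t) is harmless, since χθ is again a test function on the interval and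
      -- `key` applies to it.
      refine ae_eq_zero_of_integral_contDiff_smul_eq_zero
        hiB.integral_prod_left.locallyIntegrable fun θ hθ hθc => ?_
      have hθi : Integrable (fun q : ℝ × V => θ q.1 •
          (R q * (χ n q.1 * 𝓕 (fun p => (ρ n p : ℂ)) q.2))) (volume.prod (volume.restrict B)) := by
        obtain ⟨C, hC⟩ := hθ.continuous.bounded_above_of_compact_support hθc
        exact hiB.bdd_smul C
          (hθ.continuous.comp continuous_fst).aestronglyMeasurable
          (Eventually.of_forall fun q => hC q.1)
      have e : ∀ t, θ t • ∫ ζ in B, R (t, ζ) * (χ n t * 𝓕 (fun p => (ρ n p : ℂ)) ζ) =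
          ∫ ζ in B, θ t • (R (t, ζ) * (χ n t * 𝓕 (fun p => (ρ n p : ℂ)) ζ)) := fun t =>
        (integral_smul _ _).symm
      simp only [e]
      rw [integral_integral_swap hθi]
      refine setIntegral_eq_zero_of_ae_eq_zero ?_
      filter_upwards [key _ (ρ n) ((hχ n).mul hθ) (hρ n) (hρc n)] with ζ hζ _
      rw [← hζ]
      congr 1
      ext t
      rw [Complex.real_smul]
      push_cast
      ring
    rw [setIntegral_prod _ hi.integrableOn]
    exact setIntegral_eq_zero_of_ae_eq_zero (hz.mono fun t ht _ => ht)
  filter_upwards [ae_all_iff.2 hz] with q hq ht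
  obtain ⟨n₀, hn₀⟩ := hχ0 q.1 ht
  obtain ⟨n₁, hn₁⟩ := exists_nat_gt ‖q.2‖
  have h1 := hn₀ (max n₀ n₁) (le_max_left _ _)
  have h2 := hρ0 (max n₀ n₁) q.2 (hn₁.trans_le (by exact_mod_cast le_max_right n₀ n₁))
  exact (mul_eq_zero.1 (hq (max n₀ n₁))).resolve_right
    (mul_ne_zero (Complex.ofReal_ne_zero.2 h1) h2)

end Density

/-! ### Weak derivatives in one variable with zero initial value -/

section Primitive

variable {S T : ℝ}

/-- Limits along this filter are unique only if it is proper; it is, because right neighbourhoods of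
S have positive measure. -/
theorem neBot_nhdsGT_inf_ae (S : ℝ) : (𝓝[>] S ⊓ ae (volume : Measure ℝ)).NeBot := by
  rw [inf_neBot_iff]
  intro s hs t ht
  obtain ⟨b, hb, hbs⟩ := mem_nhdsGT_iff_exists_Ioo_subset.1 hs
  by_contra h
  rw [Set.not_nonempty_iff_eq_empty] at h
  have h1 : Set.Ioo S b ⊆ tᶜ := fun x hx hxt => by
    have : x ∈ s ∩ t := ⟨hbs hx, hxt⟩
    rw [h] at this
    exact this
  have h2 : volume (Set.Ioo S b) = 0 := measure_mono_null h1 (mem_ae_iff.1 ht)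
  rw [Real.volume_Ioo, ENNReal.ofReal_eq_zero] at h2
  have : S < b := hb
  linarith

theorem IsTest1.eq_zero {θ : ℝ → ℝ} (h : IsTest1 S T θ) {t : ℝ} (ht : t ∉ Set.Ioo S T) :
    θ t = 0 :=
  image_eq_zero_of_notMem_tsupport fun h' => ht (h.support h')

theorem IsTest1.integrable {θ : ℝ → ℝ} (h : IsTest1 S T θ) : Integrable θ :=
  h.smooth.continuous.integrable_of_hasCompactSupport h.compact

theorem IsTest1.hasDerivAt {θ : ℝ → ℝ} (h : IsTest1 S T θ) (t : ℝ) :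
    HasDerivAt θ (deriv θ t) t :=
  (h.smooth.differentiable (by simp) t).hasDerivAt

theorem IsTest1.continuous_deriv {θ : ℝ → ℝ} (h : IsTest1 S T θ) : Continuous (deriv θ) :=
  h.smooth.continuous_deriv (by simp)

theorem IsTest1.eq_neg_integral_deriv {θ : ℝ → ℝ} (h : IsTest1 S T θ) {r : ℝ}
    (hr : r ∈ Set.Ioo S T) : (θ r : ℂ) = -∫ t in Set.Ioo r T, ((deriv θ t : ℝ) : ℂ) := by
  rw [← integral_Ioc_eq_integral_Ioo, ← intervalIntegral.integral_of_le hr.2.le,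
    intervalIntegral.integral_ofReal, intervalIntegral.integral_eq_sub_of_hasDerivAt
    (fun t _ => h.hasDerivAt t) (h.continuous_deriv.intervalIntegrable _ _),
    h.eq_zero (t := T) (by simp)]
  simp

/-- A test function with zero mean is the derivative of a test function. -/
theorem IsTest1.primitive {g : ℝ → ℝ} (h : IsTest1 S T g) (h0 : ∫ t, g t = 0) :
    IsTest1 S T (fun t => ∫ r in S..t, g r) ∧ deriv (fun t => ∫ r in S..t, g r) = g := by
  have hc := h.smooth.continuous
  have hd : ∀ t, HasDerivAt (fun t => ∫ r in S..t, g r) (g t) t := fun t =>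
    intervalIntegral.integral_hasDerivAt_right (hc.intervalIntegrable _ _)
      (hc.stronglyMeasurableAtFilter _ _) hc.continuousAt
  have hderiv : deriv (fun t => ∫ r in S..t, g r) = g := funext fun t => (hd t).deriv
  refine ⟨?_, hderiv⟩
  have hsm : ContDiff ℝ ∞ fun t => ∫ r in S..t, g r :=
    contDiff_infty_iff_deriv.2 ⟨fun t => (hd t).differentiableAt, by rw [hderiv]; exact h.smooth⟩
  rcases (tsupport g).eq_empty_or_nonempty with he | hne
  · have hg : g = 0 := by rwa [tsupport_eq_empty_iff] at he
    subst hg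
    simp only [Pi.zero_apply, intervalIntegral.integral_zero]
    exact ⟨contDiff_const, HasCompactSupport.zero, by simp [tsupport]⟩
  obtain ⟨s₀, hs₀, hs₁⟩ := h.compact.isCompact.exists_isLeast hne
  obtain ⟨t₀, ht₀, ht₁⟩ := h.compact.isCompact.exists_isGreatest hne
  have hsupp : (Function.support fun t => ∫ r in S..t, g r) ⊆ Set.Icc s₀ t₀ := by
    intro t ht
    by_contra hn
    refine ht ?_
    rw [Set.mem_Icc, not_and_or, not_le, not_le] at hn
    rcases hn with hn | hn
    · have : ∀ r ∈ Set.uIcc S t, g r = 0 := fun r hr =>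
        image_eq_zero_of_notMem_tsupport fun hr' => by
          have h1 := hs₁ hr'
          have h2 := (h.support hs₀).1
          have h3 := hr.2
          exact absurd h3 (not_le.2 (lt_of_lt_of_le (max_lt h2 hn) h1))
      exact (intervalIntegral.integral_congr this).trans (by simp)
    · refine (intervalIntegral.integral_eq_integral_of_support_subset ?_).trans h0
      intro r hr
      have hr' := subset_tsupport _ hr
      exact ⟨(h.support hr').1, (ht₁ hr').trans hn.le⟩
  have hts : tsupport (fun t => ∫ r in S..t, g r) ⊆ Set.Icc s₀ t₀ :=
    closure_minimal hsupp isClosed_Icc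
  exact ⟨hsm, HasCompactSupport.of_support_subset_isCompact isCompact_Icc hsupp,
    hts.trans fun t ht => ⟨(h.support hs₀).1.trans_le ht.1, ht.2.trans_lt (h.support ht₀).2⟩⟩

theorem exists_isTest1_integral_eq_one (hST : S < T) :
    ∃ θ, IsTest1 S T θ ∧ ∫ t, θ t = 1 := by
  obtain ⟨χ, hχ, hχ0, hχ1⟩ := exists_isTest1_ne_zero S T
  obtain ⟨n, hn⟩ := hχ1 ((S + T) / 2) ⟨by linarith, by linarith⟩
  have hpos : 0 < ∫ t, χ n t := Continuous.integral_pos_of_hasCompactSupport_nonneg_nonzero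
    (hχ n).smooth.continuous (hχ n).compact (hχ0 n) (hn n le_rfl)
  refine ⟨_, (hχ n).mul (contDiff_const (c := (∫ t, χ n t)⁻¹)), ?_⟩
  rw [integral_mul_const, mul_inv_cancel₀ hpos.ne']

/-- An integrable function with an integrable weak derivative and zero initial value is the
primitive of that derivative. -/
theorem ae_eq_primitive (hST : S < T) {m k : ℝ → ℂ} (hm : IntegrableOn m (Set.Ioo S T))
    (hk : IntegrableOn k (Set.Ioo S T))
    (h : ∀ θ, IsTest1 S T θ →
      ∫ t in Set.Ioo S T, k t * θ t = -∫ t in Set.Ioo S T, m t * deriv θ t)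
    (h0 : Tendsto m (𝓝[>] S ⊓ ae volume) (𝓝 0)) :
    ∀ᵐ t, t ∈ Set.Ioo S T → m t = ∫ r in S..t, k r := by
  have hki : IntervalIntegrable k volume S T :=
    (intervalIntegrable_iff_integrableOn_Ioo_of_le hST.le).2 hk
  have hP : ContinuousOn (fun t => ∫ r in S..t, k r) (Set.Icc S T) := by
    have := intervalIntegral.continuousOn_primitive_interval' hki Set.left_mem_uIcc
    rwa [Set.uIcc_of_le hST.le] at this
  have hPi : IntegrableOn (fun t => ∫ r in S..t, k r) (Set.Ioo S T) :=
    hP.integrableOn_Icc.mono_set Set.Ioo_subset_Icc_self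
  set n : ℝ → ℂ := fun t => m t - ∫ r in S..t, k r with hn
  have hni : IntegrableOn n (Set.Ioo S T) := hm.sub hPi
  have hbdd {f : ℝ → ℂ} (hf : IntegrableOn f (Set.Ioo S T)) {θ : ℝ → ℝ} (hθ : Continuous θ)
      (hθc : HasCompactSupport θ) : IntegrableOn (fun t => f t * θ t) (Set.Ioo S T) := by
    obtain ⟨C, hC⟩ := hθ.bounded_above_of_compact_support hθc
    exact Integrable.mul_bdd (c := C) hf (Complex.continuous_ofReal.comp hθ).aestronglyMeasurable
      (Eventually.of_forall fun t => by simpa using hC t)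
  have hnθ (θ : ℝ → ℝ) (hθ : IsTest1 S T θ) : ∫ t in Set.Ioo S T, n t * deriv θ t = 0 := by
    have h1 := integral_primitive_mul hk (ψ := fun t => (θ t : ℂ)) (ψ' := fun t => ((deriv θ t : ℝ) : ℂ))
      (hθ.continuous_deriv.integrable_of_hasCompactSupport hθ.compact.deriv).ofReal.integrableOn
      fun r hr => hθ.eq_neg_integral_deriv hr
    rw [h θ hθ, neg_neg] at h1
    simp only [hn, sub_mul]
    rw [integral_sub (hbdd hm hθ.continuous_deriv hθ.compact.deriv)
      (hbdd hPi hθ.continuous_deriv hθ.compact.deriv), h1, sub_self]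
  obtain ⟨θ₀, hθ₀, hθ₀i⟩ := exists_isTest1_integral_eq_one hST
  set C := ∫ t in Set.Ioo S T, n t * θ₀ t with hC
  -- Du Bois-Reymond: n has zero weak derivative. Subtracting (∫ϑ)θ₀ from ϑ leaves a function of
  -- zero mean, hence the derivative of a test function, and this forces n to equal C = ∫nθ₀.
  have hconst : ∀ᵐ t, t ∈ Set.Ioo S T → n t - C = 0 := by
    refine isOpen_Ioo.ae_eq_zero_of_integral_contDiff_smul_eq_zero
      (hni.sub (integrableOn_const (by simp))).locallyIntegrableOn fun ϑ hϑ hϑc hϑs => ?_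
    have hϑ' : IsTest1 S T ϑ := ⟨hϑ, hϑc, hϑs⟩
    have hg : IsTest1 S T fun t => ϑ t - (∫ s, ϑ s) * θ₀ t :=
      ⟨hϑ.sub (contDiff_const.mul hθ₀.smooth), hϑc.sub hθ₀.compact.mul_left,
        (tsupport_sub _ _).trans (Set.union_subset hϑs
          ((closure_mono (Function.support_mul_subset_right _ _)).trans hθ₀.support))⟩
    have hg0 : ∫ t, (ϑ t - (∫ s, ϑ s) * θ₀ t) = 0 := by
      rw [integral_sub hϑ'.integrable (hθ₀.integrable.const_mul _), integral_const_mul, hθ₀i]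
      simp
    obtain ⟨h1, h2⟩ := hg.primitive hg0
    have h3 := hnθ _ h1
    rw [h2] at h3
    have h4 : ∀ t, n t * ((ϑ t - (∫ s, ϑ s) * θ₀ t : ℝ) : ℂ) =
        n t * ϑ t - ((∫ s, ϑ s : ℝ) : ℂ) * (n t * θ₀ t) := fun t => by push_cast; ring
    simp only [h4] at h3
    rw [integral_sub (hbdd hni hϑ.continuous hϑc)
      ((hbdd hni hθ₀.smooth.continuous hθ₀.compact).const_mul _), integral_const_mul, ← hC] at h3
    have h5 : ∫ t in Set.Ioo S T, ((ϑ t : ℝ) : ℂ) = ((∫ s, ϑ s : ℝ) : ℂ) := by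
      rw [setIntegral_eq_integral_of_forall_compl_eq_zero fun t ht => by rw [hϑ'.eq_zero ht]; simp]
      exact integral_ofReal
    rw [← setIntegral_eq_integral_of_forall_compl_eq_zero (s := Set.Ioo S T)
      fun t ht => by rw [hϑ'.eq_zero ht, zero_smul]]
    have h6 : ∀ t, ϑ t • (n t - C) = n t * ϑ t - C * ϑ t := fun t => by
      rw [Complex.real_smul]; ring
    simp only [h6]
    have h7 : IntegrableOn (fun t => (ϑ t : ℂ)) (Set.Ioo S T) := hϑ'.integrable.ofReal.integrableOn
    rw [integral_sub (hbdd hni hϑ.continuous hϑc) (h7.const_mul _),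
      integral_const_mul, h5, mul_comm C]
    exact h3
  -- The initial condition fixes the constant: both m and the primitive tend to 0 at S.
  have hC0 : C = 0 := by
    have hne := neBot_nhdsGT_inf_ae S
    have h1 : Tendsto (fun t => ∫ r in S..t, k r) (𝓝[>] S) (𝓝 0) := by
      have h2 := (hP S ⟨le_rfl, hST.le⟩).tendsto
      rw [intervalIntegral.integral_same] at h2
      refine h2.mono_left ?_
      rw [nhdsWithin_le_iff]
      exact mem_of_superset (Ioo_mem_nhdsGT hST) Set.Ioo_subset_Icc_self
    have h2 : Tendsto n (𝓝[>] S ⊓ ae volume) (𝓝 (0 - 0)) := h0.sub (h1.mono_left inf_le_left)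
    rw [sub_zero] at h2
    refine tendsto_nhds_unique (tendsto_const_nhds.congr' ?_) h2
    have h3 : ∀ᶠ t in 𝓝[>] S ⊓ ae volume, t ∈ Set.Ioo S T :=
      (show ∀ᶠ t in 𝓝[>] S, t ∈ Set.Ioo S T from Ioo_mem_nhdsGT hST).filter_mono inf_le_left
    filter_upwards [h3, hconst.filter_mono inf_le_right] with t ht h4
    exact (sub_eq_zero.1 (h4 ht)).symm
  filter_upwards [hconst] with t ht h1
  have := ht h1
  rw [hC0, sub_zero] at this
  exact sub_eq_zero.1 this

end Primitive

/-! ### Tensor test functions and moments in flow coordinates -/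

section Tensor

variable {d : ℕ} {S T : ℝ} {θ : ℝ → ℝ} {ρ : VV d → ℝ}

/-- A product of a function of time and a function in flow coordinates. -/
def tensor (θ : ℝ → ℝ) (ρ : VV d → ℝ) (X : Pt d) : ℝ := θ X.1 * ρ (flow d X).2

theorem lift_tensor (θ : ℝ → ℝ) (ρ : VV d → ℝ) :
    lift (tensor θ ρ) = fun q => (θ q.1 : ℂ) * (ρ q.2 : ℂ) := by
  ext q
  simp only [lift, tensor, Homeomorph.apply_symm_apply, Complex.ofReal_mul]
  rfl

theorem isTest_tensor (hθ : IsTest1 S T θ) (hρ : ContDiff ℝ ∞ ρ) (hρc : HasCompactSupport ρ) :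
    IsTest (slab d S T) (tensor θ ρ) where
  smooth := (hθ.smooth.comp contDiff_fst).mul (hρ.comp (contDiff_snd.comp contDiff_flow))
  compact := by
    have : HasCompactSupport fun q : ℝ × VV d => θ q.1 * ρ q.2 := by
      refine HasCompactSupport.of_support_subset_isCompact
        (hθ.compact.isCompact.prod hρc.isCompact) fun q hq => ?_
      exact ⟨subset_tsupport _ (left_ne_zero_of_mul hq),
        subset_tsupport _ (right_ne_zero_of_mul hq)⟩
    exact this.comp_homeomorph (flow d)
  support := by
    have h1 : tsupport (tensor θ ρ) ⊆ Prod.fst ⁻¹' tsupport θ := by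
      refine closure_minimal (fun X hX => ?_) ((isClosed_tsupport θ).preimage continuous_fst)
      exact subset_tsupport _ (left_ne_zero_of_mul hX)
    exact h1.trans fun X hX => mem_slab_iff.2 (hθ.support hX)

/-- The factor ρ is constant along the flow, so the transport derivative falls on θ only. -/
theorem lift_transport_tensor (hθ : IsTest1 S T θ) (hρ : ContDiff ℝ ∞ ρ)
    (hρc : HasCompactSupport ρ) :
    lift (transport (tensor θ ρ)) = fun q => ((deriv θ q.1 : ℝ) : ℂ) * (ρ q.2 : ℂ) := by
  ext ⟨t, p⟩
  have h1 := transport_eq (isTest_tensor hθ hρ hρc).smooth t p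
  have h2 : (fun t => tensor θ ρ ((flow d).symm (t, p))) = fun t => θ t * ρ p := by
    ext t
    simp only [tensor, Homeomorph.apply_symm_apply]
    rfl
  rw [h2] at h1
  rw [lift, h1.unique ((hθ.hasDerivAt t).mul_const (ρ p)), Complex.ofReal_mul]

theorem pf_tensor (c : ℝ → ℂ) (ρ : VV d → ℝ) (q : ℝ × VV d) :
    pf (fun q => c q.1 * (ρ q.2 : ℂ)) q = c q.1 * 𝓕 (fun p => (ρ p : ℂ)) q.2 :=
  pf_time_mul c (fun q => (ρ q.2 : ℂ)) q

theorem adm_tensor {c : ℝ → ℂ} (hc : MemLp c 2 volume) (hρ : Continuous ρ)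
    (hρc : HasCompactSupport ρ) : Adm fun q : ℝ × VV d => c q.1 * (ρ q.2 : ℂ) where
  memLp := by
    have hρ2 : MemLp (fun p => (ρ p : ℂ)) 2 volume := (hρ.memLp_of_hasCompactSupport hρc).ofReal
    rw [Measure.volume_eq_prod]
    refine (memLp_two_iff_integrable_sq_norm (hc.1.comp_fst.mul hρ2.1.comp_snd)).2 ?_
    have e : ∀ q : ℝ × VV d, ‖c q.1 * (ρ q.2 : ℂ)‖ ^ 2 = ‖c q.1‖ ^ 2 * ‖(ρ q.2 : ℂ)‖ ^ 2 :=
      fun q => by rw [norm_mul, mul_pow]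
    refine Integrable.congr ?_ (Eventually.of_forall fun q => (e q).symm)
    exact ((memLp_two_iff_integrable_sq_norm hc.1).1 hc).mul_prod
      ((memLp_two_iff_integrable_sq_norm hρ2.1).1 hρ2)
  integrable := Eventually.of_forall fun t =>
    Integrable.const_mul (hρ.integrable_of_hasCompactSupport hρc).ofReal (c t)

theorem memLp_indicator_of_continuous {c : ℝ → ℂ} (hc : Continuous c) :
    MemLp ((Set.Ioo S T).indicator c) 2 volume := by
  rw [memLp_indicator_iff_restrict measurableSet_Ioo]
  obtain ⟨C, hC⟩ := isCompact_Icc.exists_bound_of_continuousOn (hc.continuousOn (s := Set.Icc S T))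
  refine MemLp.of_bound hc.aestronglyMeasurable C ?_
  filter_upwards [ae_restrict_mem measurableSet_Ioo] with t ht
  exact hC t (Set.Ioo_subset_Icc_self ht)

theorem IsTest1.memLp (hθ : IsTest1 S T θ) : MemLp (fun t => (θ t : ℂ)) 2 volume :=
  (hθ.smooth.continuous.memLp_of_hasCompactSupport hθ.compact).ofReal

theorem IsTest1.memLp_deriv (hθ : IsTest1 S T θ) :
    MemLp (fun t => ((deriv θ t : ℝ) : ℂ)) 2 volume :=
  (hθ.continuous_deriv.memLp_of_hasCompactSupport hθ.compact.deriv).ofReal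

theorem integral_moment_mul {W : ℝ × VV d → ℂ} (hW : MemLp W 2 volume)
    (hW0 : ∀ q, q.1 ∉ Set.Ioo S T → W q = 0) {c : ℝ → ℂ} (hc : MemLp c 2 volume)
    (hρ : Continuous ρ) (hρc : HasCompactSupport ρ) :
    ∫ t in Set.Ioo S T, (∫ p, W (t, p) * ρ p) * c t = ∫ q, W q * (c q.1 * ρ q.2) := by
  have hi := integrable_mul_of_memLp_two hW (adm_tensor hc hρ hρc).memLp
  rw [Measure.volume_eq_prod] at hi ⊢
  rw [integral_prod _ hi, setIntegral_eq_integral_of_forall_compl_eq_zero]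
  · congr 1
    ext t
    rw [← integral_mul_const]
    congr 1
    ext p
    ring
  · intro t ht
    have : ∀ p, W (t, p) = 0 := fun p => hW0 (t, p) ht
    simp [this]

theorem integrableOn_moment {W : ℝ × VV d → ℂ} (hW : MemLp W 2 volume)
    (hW0 : ∀ q, q.1 ∉ Set.Ioo S T → W q = 0) (hρ : Continuous ρ) (hρc : HasCompactSupport ρ) :
    IntegrableOn (fun t => ∫ p, W (t, p) * ρ p) (Set.Ioo S T) := by
  have hi := integrable_mul_of_memLp_two hW (adm_tensor (memLp_indicator_of_continuous
    (S := S) (T := T) (c := fun _ => 1) continuous_const) hρ hρc).memLp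
  have e : (fun q : ℝ × VV d => W q * ((Set.Ioo S T).indicator (fun _ => (1 : ℂ)) q.1 * ρ q.2)) =
      fun q => W q * ρ q.2 := by
    ext q
    by_cases hq : q.1 ∈ Set.Ioo S T
    · simp [hq]
    · simp [hW0 q hq]
  rw [e, Measure.volume_eq_prod] at hi
  exact hi.integral_prod_left.integrableOn

theorem integral_lift_mul (w φ : Pt d → ℝ) :
    ∫ q, lift ((slab d S T).indicator w) q * lift φ q =
      ((∫ X in slab d S T, w X * φ X : ℝ) : ℂ) := by
  rw [← integral_flow, ← integral_indicator measurableSet_slab, ← integral_complex_ofReal]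
  congr 1
  ext X
  rw [lift_flow, lift_flow, ← Complex.ofReal_mul]
  by_cases hX : X ∈ slab d S T <;> simp [hX]

theorem lift_indicator_eq_zero (w : Pt d → ℝ) (q : ℝ × VV d) (hq : q.1 ∉ Set.Ioo S T) :
    lift ((slab d S T).indicator w) q = 0 := by
  have : (flow d).symm q ∉ slab d S T := fun h => hq (mem_slab_iff.1 h)
  simp [lift, this]

theorem enorm_integral_mul_le {α : Type*} [MeasurableSpace α] {μ : Measure α} {f g : α → ℂ}
    (hf : AEStronglyMeasurable f μ) (hg : AEStronglyMeasurable g μ) :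
    ‖∫ x, f x * g x ∂μ‖ₑ ≤ eLpNorm f 2 μ * eLpNorm g 2 μ := by
  refine (enorm_integral_le_lintegral_enorm _).trans ?_
  rw [← eLpNorm_one_eq_lintegral_enorm]
  have h : eLpNorm (f • g) 1 μ ≤ eLpNorm f 2 μ * eLpNorm g 2 μ :=
    eLpNorm_smul_le_mul_eLpNorm hg hf
  exact h

/-- Cauchy–Schwarz against ρ; slices keep their L² norm because the shear preserves measure. -/
theorem tendsto_moment (hST : S < T) {v : Pt d → ℝ}
    (hv : MemLp v 2 (volume.restrict (slab d S T))) (h0 : ZeroInitial S v) (hρ : Continuous ρ)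
    (hρc : HasCompactSupport ρ) :
    Tendsto (fun t => ∫ p, lift ((slab d S T).indicator v) (t, p) * ρ p)
      (𝓝[>] S ⊓ ae volume) (𝓝 0) := by
  have hρ2 : MemLp (fun p => (ρ p : ℂ)) 2 volume := (hρ.memLp_of_hasCompactSupport hρc).ofReal
  have h1 := ENNReal.Tendsto.mul_const (b := eLpNorm (fun p => (ρ p : ℂ)) 2 volume) h0
    (Or.inr hρ2.2.ne)
  rw [zero_mul] at h1
  rw [tendsto_zero_iff_enorm_tendsto_zero]
  refine tendsto_of_tendsto_of_tendsto_of_le_of_le' tendsto_const_nhds h1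
    (Eventually.of_forall fun _ => zero_le) ?_
  have h3 : ∀ᶠ t in 𝓝[>] S ⊓ ae volume, t ∈ Set.Ioo S T :=
    (show ∀ᶠ t in 𝓝[>] S, t ∈ Set.Ioo S T from Ioo_mem_nhdsGT hST).filter_mono inf_le_left
  filter_upwards [h3, (ae_memLp_slice (memLp_indicator_lift hv)).filter_mono inf_le_right]
    with t ht h4
  refine (enorm_integral_mul_le h4.1 hρ2.1).trans (mul_le_mul_left (le_of_eq ?_) _)
  rw [← eLpNorm_comp_measurePreserving h4.1 (measurePreserving_slice t)]
  refine eLpNorm_congr_norm_ae (Eventually.of_forall fun p => ?_)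
  have : lift ((slab d S T).indicator v) (flow d (t, p)) = (v (t, p) : ℂ) := by
    rw [lift_flow, Set.indicator_of_mem (mem_slab_iff.2 ht)]
  rw [Function.comp_apply]
  rw [flow_apply] at this
  rw [this, Complex.norm_real]

end Tensor

/-! ### Weak derivatives of an arbitrary solution on the Fourier side -/

section FourierSide

variable {d : ℕ} {S T : ℝ}

/-- Here the weak Hessian is given rather than constructed, so its symbol is recovered by testing
against tensor products, which suffice by `ae_eq_zero_of_tensor`. -/
theorem hess_fourier {v : Pt d → ℝ} {h : Pt d → EuclideanSpace ℝ (Fin d × Fin d)}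
    (hh : IsHessX (slab d S T) v h) {H H' : ℝ × VV d → ℂ}
    (hH : IsPF H (lift ((slab d S T).indicator v))) (i j : Fin d)
    (hH' : IsPF H' (lift ((slab d S T).indicator fun X => h X (i, j)))) :
    ∀ᵐ q, q.1 ∈ Set.Ioo S T → H' q = symX i q * symX j q * H q := by
  have key : ∀ᵐ q, q.1 ∈ Set.Ioo S T → H' q - symX i q * symX j q * H q = 0 := by
    refine ae_eq_zero_of_tensor fun θ ρ hθ hρ hρc => ?_
    have hφ := isTest_tensor hθ hρ hρc
    have e1 : ∀ q, pf (lift (tensor θ ρ)) q = θ q.1 * 𝓕 (fun p => (ρ p : ℂ)) q.2 := fun q => by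
      rw [lift_tensor]
      exact pf_tensor (fun t => (θ t : ℂ)) ρ q
    have e2 : ∀ q, pf (lift (dX i (dX j (tensor θ ρ)))) q =
        symX i q * symX j q * (θ q.1 * 𝓕 (fun p => (ρ p : ℂ)) q.2) := fun q => by
      rw [(hφ.dX j).pf_dX i, hφ.pf_dX j, e1, ← mul_assoc]
      rfl
    have hA := ((hφ.dX j).dX i).adm
    have i1 := integrable_mul_of_memLp_two hH'.left hφ.adm.memLp_pf
    have i2 := integrable_mul_of_memLp_two hH.left hA.memLp_pf
    have e3 : (fun q => (H' q - symX i q * symX j q * H q) *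
        (θ q.1 * 𝓕 (fun p => (ρ p : ℂ)) q.2)) = fun q => H' q * pf (lift (tensor θ ρ)) q -
          H q * pf (lift (dX i (dX j (tensor θ ρ)))) q := by
      ext q
      rw [e1, e2]
      ring
    rw [e3]
    refine ⟨i1.sub i2, ?_⟩
    rw [integral_sub i1 i2, ← hH'.pairing _ hφ.adm, ← hH.pairing _ hA, integral_lift_mul,
      integral_lift_mul, hh.2 i j _ hφ, sub_self]
  filter_upwards [key] with q hq ht using sub_eq_zero.1 (hq ht)

/-- Take c(r) = −∫_r^T θ on (S, T). It need not vanish near S, so it is no test function; being in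
L², it is covered by `adm_tensor`. -/
theorem IsTest1.exists_adjoint_primitive {θ : ℝ → ℝ} (hθ : IsTest1 S T θ) :
    ∃ c : ℝ → ℂ, MemLp c 2 volume ∧ (∀ t, t ∉ Set.Ioo S T → c t = 0) ∧
      ∀ k : ℝ → ℂ, IntegrableOn k (Set.Ioo S T) →
        ∫ t in Set.Ioo S T, (∫ r in S..t, k r) * (θ t : ℂ) =
          -∫ t in Set.Ioo S T, k t * c t := by
  have hθc := hθ.smooth.continuous
  have hcont : Continuous fun r => ((-∫ t in r..T, θ t : ℝ) : ℂ) := by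
    refine Complex.continuous_ofReal.comp (Continuous.neg ?_)
    simp only [intervalIntegral.integral_symm T]
    exact (intervalIntegral.continuous_primitive (fun _ _ => hθc.intervalIntegrable _ _) T).neg
  refine ⟨(Set.Ioo S T).indicator fun r => ((-∫ t in r..T, θ t : ℝ) : ℂ),
    memLp_indicator_of_continuous hcont, fun t ht => Set.indicator_of_notMem ht _,
    fun k hk => integral_primitive_mul hk hθ.integrable.ofReal.integrableOn fun r hr => ?_⟩
  rw [Set.indicator_of_mem hr, ← integral_Ioc_eq_integral_Ioo,
    ← intervalIntegral.integral_of_le hr.2.le, intervalIntegral.integral_ofReal,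
    Complex.ofReal_neg]

/-- The primitive need not be in L² a priori. It is dominated on each fibre by the full integral of
‖K‖ over (S, T), and the product of |θ| with a function integrable in ζ then bounds everything. -/
theorem integrable_primitive_mul_tensor {θ : ℝ → ℝ} (hθ : IsTest1 S T θ) {K : ℝ × VV d → ℂ}
    (hK : MemLp K 2 volume) (hKm : StronglyMeasurable K) {g : VV d → ℂ}
    (hg : ∀ {c : ℝ → ℂ}, MemLp c 2 volume →
      MemLp (fun q : ℝ × VV d => c q.1 * g q.2) 2 volume) :
    Integrable fun q : ℝ × VV d => (∫ r in S..q.1, K (r, q.2)) * (θ q.1 * g q.2) := by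
  have i1 := integrable_mul_of_memLp_two hK (hg (memLp_indicator_of_continuous
    (S := S) (T := T) (c := fun _ => 1) continuous_const))
  rw [Measure.volume_eq_prod] at i1
  have i2 := Integrable.mul_prod hθ.integrable.norm i1.norm.integral_prod_right
  refine Integrable.mono' i2 ((stronglyMeasurable_primitive hKm S).aestronglyMeasurable.mul
    (hg hθ.memLp).1) ?_
  have hq := (Measure.quasiMeasurePreserving_snd (μ := (volume : Measure ℝ))
    (ν := (volume : Measure (VV d)))).ae (ae_integrableOn_slice hK hKm S T)
  filter_upwards [hq] with q hq
  by_cases ht : q.1 ∈ Set.Ioo S T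
  · have h1 : ∫ t, ‖K (t, q.2) * ((Set.Ioo S T).indicator (fun _ => (1 : ℂ)) t * g q.2)‖ =
        (∫ t in Set.Ioo S T, ‖K (t, q.2)‖) * ‖g q.2‖ := by
      rw [← integral_mul_const, ← integral_indicator measurableSet_Ioo]
      congr 1
      ext t
      by_cases ht : t ∈ Set.Ioo S T <;> simp [ht]
    have h2 : ‖∫ r in S..q.1, K (r, q.2)‖ ≤ ∫ t in Set.Ioo S T, ‖K (t, q.2)‖ := by
      rw [intervalIntegral.integral_of_le ht.1.le]
      refine (norm_integral_le_integral_norm _).trans ?_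
      exact setIntegral_mono_set hq.norm (Eventually.of_forall fun _ => norm_nonneg _)
        (Eventually.of_forall fun r hr => ⟨hr.1, hr.2.trans_lt ht.2⟩)
    rw [h1, norm_mul, norm_mul, Complex.norm_real]
    calc _ ≤ (∫ t in Set.Ioo S T, ‖K (t, q.2)‖) * (‖θ q.1‖ * ‖g q.2‖) := by gcongr
      _ = _ := by ring
  · simp [hθ.eq_zero ht]

/-- For fixed ρ the moment of v against ρ has as weak time derivative the moment of g, and it starts
from 0, so it is a primitive by `ae_eq_primitive`. On the Fourier side this says that H and the
primitive of K have the same integral, −∫K (c ⊗ ρ̂), against θ ⊗ ρ̂. -/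
theorem volterra_fourier (hST : S < T) {v g : Pt d → ℝ}
    (hv : MemLp v 2 (volume.restrict (slab d S T))) (hg : IsTransport (slab d S T) v g)
    (h0 : ZeroInitial S v) {H K : ℝ × VV d → ℂ}
    (hH : IsPF H (lift ((slab d S T).indicator v)))
    (hK : IsPF K (lift ((slab d S T).indicator g))) (hKm : StronglyMeasurable K) :
    ∀ᵐ q, q.1 ∈ Set.Ioo S T → H q = ∫ r in S..q.1, K (r, q.2) := by
  have key : ∀ᵐ q, q.1 ∈ Set.Ioo S T → H q - ∫ r in S..q.1, K (r, q.2) = 0 := by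
    refine ae_eq_zero_of_tensor fun θ ρ hθ hρ hρc => ?_
    have hφ := isTest_tensor hθ hρ hρc
    have hρ' := hρ.continuous
    have hv0 := lift_indicator_eq_zero (S := S) (T := T) v
    have hg0 := lift_indicator_eq_zero (S := S) (T := T) g
    have hmk := ae_eq_primitive hST (integrableOn_moment hH.right hv0 hρ' hρc)
      (integrableOn_moment hK.right hg0 hρ' hρc) (fun ϑ hϑ => by
        have hφ := isTest_tensor hϑ hρ hρc
        rw [integral_moment_mul hK.right hg0 hϑ.memLp hρ' hρc,
          integral_moment_mul hH.right hv0 hϑ.memLp_deriv hρ' hρc]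
        have h1 := integral_lift_mul (S := S) (T := T) g (tensor ϑ ρ)
        have h2 := integral_lift_mul (S := S) (T := T) v (transport (tensor ϑ ρ))
        rw [lift_tensor] at h1
        rw [lift_transport_tensor hϑ hρ hρc] at h2
        rw [h1, h2, hg.2 _ hφ, Complex.ofReal_neg])
      (tendsto_moment hST hv h0 hρ' hρc)
    set ρF : VV d → ℂ := 𝓕 fun p => (ρ p : ℂ) with hρF
    obtain ⟨c, hcL, hc0, hP⟩ := hθ.exists_adjoint_primitive
    have e1 : ∫ q, H q * (θ q.1 * ρF q.2) = -∫ q, K q * (c q.1 * ρF q.2) := by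
      have h1 := hH.pairing _ (adm_tensor hθ.memLp hρ' hρc)
      have h2 := hK.pairing _ (adm_tensor hcL hρ' hρc)
      simp only [pf_tensor (fun t => (θ t : ℂ)) ρ] at h1
      simp only [pf_tensor] at h2
      rw [← h1, ← h2, ← integral_moment_mul hK.right hg0 hcL hρ' hρc,
        ← integral_moment_mul hH.right hv0 hθ.memLp hρ' hρc,
        ← hP _ (integrableOn_moment hK.right hg0 hρ' hρc)]
      refine setIntegral_congr_ae measurableSet_Ioo ?_
      filter_upwards [hmk] with t ht h3
      rw [ht h3]
    have hpfc {c : ℝ → ℂ} (hcL : MemLp c 2 volume) :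
        MemLp (fun q : ℝ × VV d => c q.1 * ρF q.2) 2 volume := by
      have := (adm_tensor hcL hρ' hρc).memLp_pf
      simpa only [funext (pf_tensor c ρ)] using this
    have hsl := ae_integrableOn_slice hK.left hKm S T
    have iH := integrable_mul_of_memLp_two hH.left (hpfc hθ.memLp)
    have iP := integrable_primitive_mul_tensor hθ hK.left hKm hpfc
    have e2 : ∫ q : ℝ × VV d, (∫ r in S..q.1, K (r, q.2)) * (θ q.1 * ρF q.2) =
        -∫ q, K q * (c q.1 * ρF q.2) := by
      rw [integral_prod_slab iP,
        integral_prod_slab (integrable_mul_of_memLp_two hK.left (hpfc hcL)), ← integral_neg]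
      refine integral_congr_ae ?_
      filter_upwards [hsl] with ζ hζ
      have h1 := hP _ hζ
      have h2 : ∫ t, (∫ r in S..t, K (r, ζ)) * (θ t * ρF ζ) =
          (∫ t in Set.Ioo S T, (∫ r in S..t, K (r, ζ)) * θ t) * ρF ζ := by
        rw [← integral_mul_const, setIntegral_eq_integral_of_forall_compl_eq_zero
          fun t ht => by rw [hθ.eq_zero ht]; simp]
        simp only [mul_assoc]
      have h3 : ∫ t, K (t, ζ) * (c t * ρF ζ) =
          (∫ t in Set.Ioo S T, K (t, ζ) * c t) * ρF ζ := by
        rw [← integral_mul_const, setIntegral_eq_integral_of_forall_compl_eq_zero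
          fun t ht => by rw [hc0 t ht]; simp]
        simp only [mul_assoc]
      rw [h2, h3, h1, neg_mul]
    simp only [sub_mul]
    refine ⟨iH.sub iP, ?_⟩
    rw [integral_sub iH iP, e1, e2, sub_self]
  filter_upwards [key] with q hq ht using sub_eq_zero.1 (hq ht)

end FourierSide

/-! ### Uniqueness and reduction to Borel coefficients -/

section Uniqueness

variable {d : ℕ} {δ : ℝ} {a : ℝ → Matrix (Fin d) (Fin d) ℝ} {S T : ℝ}

theorem ae_section {P : ℝ × VV d → Prop} (h : ∀ᵐ q, P q) : ∀ᵐ ζ, ∀ᵐ t, P (t, ζ) := by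
  rw [Measure.volume_eq_prod] at h
  exact Measure.ae_ae_of_ae_prod
    ((Measure.measurePreserving_swap (μ := (volume : Measure (VV d)))
      (ν := (volume : Measure ℝ))).quasiMeasurePreserving.ae h)

/-- On the Fourier side every solution satisfies a Volterra equation along almost every
characteristic. -/
theorem IsCauchySolution.exists_volterra (ha : IsElliptic δ a)
    (ham : ∀ i j, Measurable fun t => a t i j) (hST : S < T) {f v : Pt d → ℝ}
    {F : ℝ × VV d → ℂ} (hFm : StronglyMeasurable F)
    (hF : IsPF F (lift ((slab d S T).indicator f))) (hv : IsCauchySolution a S T f v) :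
    ∃ H : ℝ × VV d → ℂ, StronglyMeasurable H ∧ (∀ q, q.1 ∉ Set.Ioo S T → H q = 0) ∧
      IsPF H (lift ((slab d S T).indicator v)) ∧
      ∀ᵐ ζ, ∀ᵐ t ∂volume.restrict (Set.Ioo S T),
        H (t, ζ) = ∫ r in S..t, (F (r, ζ) - qsym a (r, ζ) * H (r, ζ)) := by
  obtain ⟨h, g, hh, hg, he⟩ := hv.equation
  obtain ⟨H, hHm, hH0, hH, -⟩ := exists_isPF_inv_slab hv.memS2.memLp
  have hhij (ij : Fin d × Fin d) : MemLp (fun X => h X ij) 2 (volume.restrict (slab d S T)) :=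
    hh.1.eval_piLp ij
  choose H' hH'm _ hH' _ using fun ij => exists_isPF_inv_slab (hhij ij)
  obtain ⟨B, hB⟩ := ha.bounded
  have hK := hF.add (IsPF.sum Finset.univ fun i _ => IsPF.sum Finset.univ fun j _ =>
    (hH' (i, j)).time_mul (c := fun t => (a t i j : ℂ)) (K := B)
      (Complex.measurable_ofReal.comp (ham i j)).aestronglyMeasurable
      (fun t => by simpa using hB t i j))
  set K : ℝ × VV d → ℂ := fun q => F q + ∑ i, ∑ j, (a q.1 i j : ℂ) * H' (i, j) q with hKdef
  have hKm : StronglyMeasurable K := by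
    refine hFm.add (Finset.stronglyMeasurable_fun_sum _ fun i _ =>
      Finset.stronglyMeasurable_fun_sum _ fun j _ => StronglyMeasurable.mul ?_ (hH'm (i, j)))
    exact (Complex.measurable_ofReal.comp ((ham i j).comp measurable_fst)).stronglyMeasurable
  have hKg : IsPF K (lift ((slab d S T).indicator g)) := by
    refine hK.congr (EventuallyEq.refl _ _) ?_
    rw [ae_restrict_iff' measurableSet_slab] at he
    filter_upwards [measurePreserving_flow_symm.quasiMeasurePreserving.ae he] with q hq
    by_cases hX : (flow d).symm q ∈ slab d S T
    · have h1 := hq hX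
      simp only [lift, Set.indicator_of_mem hX]
      rw [← h1]
      push_cast
      exact sub_add_cancel _ _
    · simp [lift, hX]
  have hvol := volterra_fourier hST hv.memS2.memLp hg hv.initial hH hKg hKm
  have hKe : ∀ᵐ q, q.1 ∈ Set.Ioo S T → K q = F q - qsym a q * H q := by
    have h1 : ∀ᵐ q, ∀ i j, q.1 ∈ Set.Ioo S T → H' (i, j) q = symX i q * symX j q * H q :=
      ae_all_iff.2 fun i => ae_all_iff.2 fun j => hess_fourier hh hH i j (hH' (i, j))
    filter_upwards [h1] with q hq ht
    rw [hKdef, sub_eq_add_neg, ← neg_mul, ← sum_symX_mul, Finset.sum_mul]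
    simp only [Finset.sum_mul]
    congr 1
    refine Finset.sum_congr rfl fun i _ => Finset.sum_congr rfl fun j _ => ?_
    rw [hq i j ht]
    ring
  refine ⟨H, hHm, hH0, hH, ?_⟩
  filter_upwards [ae_section hvol, ae_section hKe] with ζ h1 h2
  rw [ae_restrict_iff' measurableSet_Ioo]
  filter_upwards [h1] with t h3 ht
  rw [h3 ht]
  refine intervalIntegral.integral_congr_ae ?_
  filter_upwards [h2] with r hr hr'
  rw [Set.uIoc_of_le ht.1.le] at hr'
  exact hr ⟨hr'.1, hr'.2.trans_lt ht.2⟩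

theorem IsCauchySolution.unique (hδ : 0 < δ) (ha : IsElliptic δ a)
    (ham : ∀ i j, Measurable fun t => a t i j) (hST : S < T) {f u v : Pt d → ℝ}
    (hf : MemLp f 2 (volume.restrict (slab d S T)))
    (hu : IsCauchySolution a S T f u) (hv : IsCauchySolution a S T f v) :
    v =ᵐ[volume.restrict (slab d S T)] u := by
  obtain ⟨F, hFm, -, hF, -⟩ := exists_isPF_inv_slab hf
  obtain ⟨H₁, hm₁, h0₁, hH₁, hv₁⟩ := hv.exists_volterra ha ham hST hFm hF
  obtain ⟨H₂, hm₂, h0₂, hH₂, hv₂⟩ := hu.exists_volterra ha ham hST hFm hF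
  have hsec : ∀ᵐ ζ, ∀ᵐ t, H₁ (t, ζ) - H₂ (t, ζ) = 0 := by
    filter_upwards [hv₁, hv₂, ae_integrableOn_slice hF.left hFm S T,
      ae_integrableOn_slice hH₁.left hm₁ S T, ae_integrableOn_slice hH₂.left hm₂ S T]
      with ζ h1 h2 iF i1 i2
    obtain ⟨C, hC⟩ := exists_qsym_bound hδ ha S T ζ
    have hqm : Measurable fun t => qsym a (t, ζ) := (measurable_qsym ham).comp (by fun_prop)
    have hq {Y : ℝ → ℂ} (hY : IntegrableOn Y (Set.Ioo S T)) :
        IntegrableOn (fun t => (qsym a (t, ζ) : ℂ) * Y t) (Set.Ioo S T) := by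
      refine Integrable.bdd_mul (c := C) hY
        (Complex.measurable_ofReal.comp hqm).aestronglyMeasurable ?_
      filter_upwards [ae_restrict_mem measurableSet_Ioo] with t ht
      rw [Complex.norm_real]
      exact hC t (Set.Ioo_subset_Icc_self ht)
    have hI {Y : ℝ → ℂ} (hY : IntegrableOn Y (Set.Ioo S T)) {t : ℝ} (ht : t ∈ Set.Ioo S T) :
        IntervalIntegrable Y volume S t :=
      (intervalIntegrable_iff_integrableOn_Ioo_of_le ht.1.le).2
        (hY.mono_set (Set.Ioo_subset_Ioo_right ht.2.le))
    -- The forcing F cancels in the difference, leaving the homogeneous Volterra equation at the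
    -- frequency ζ.
    have key := ae_eq_zero_of_volterra (Y := fun t => H₁ (t, ζ) - H₂ (t, ζ))
      hqm.aestronglyMeasurable (fun t ht => hC t (Set.Ioo_subset_Icc_self ht)) (i1.sub i2) (by
        filter_upwards [h1, h2, ae_restrict_mem measurableSet_Ioo] with t h1 h2 ht
        have j1 : IntervalIntegrable (fun r => F (r, ζ) - qsym a (r, ζ) * H₁ (r, ζ))
            volume S t := (hI iF ht).sub (hI (hq i1) ht)
        have j2 : IntervalIntegrable (fun r => F (r, ζ) - qsym a (r, ζ) * H₂ (r, ζ))
            volume S t := (hI iF ht).sub (hI (hq i2) ht)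
        rw [h1, h2, ← intervalIntegral.integral_sub j1 j2, ← intervalIntegral.integral_neg]
        congr 1
        ext r
        ring)
    rw [ae_restrict_iff' measurableSet_Ioo] at key
    filter_upwards [key] with t ht
    by_cases h : t ∈ Set.Ioo S T
    · exact ht h
    · rw [h0₁ (t, ζ) h, h0₂ (t, ζ) h, sub_zero]
  -- Tonelli turns vanishing on almost every fibre into vanishing almost everywhere; joint
  -- measurability of both functions is essential here.
  have hHe : H₁ =ᵐ[volume] H₂ := by
    have hm : Measurable fun q => ‖H₁ q - H₂ q‖ₑ := (hm₁.sub hm₂).measurable.enorm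
    have h0 : ∫⁻ q, ‖H₁ q - H₂ q‖ₑ = 0 := by
      rw [lintegral_prod_slab _ hm, lintegral_eq_zero_iff hm.lintegral_prod_left']
      filter_upwards [hsec] with ζ hζ
      refine (lintegral_eq_zero_iff (hm.comp (by fun_prop))).2 ?_
      filter_upwards [hζ] with t ht
      simp [ht]
    filter_upwards [(lintegral_eq_zero_iff hm).1 h0] with q hq
    exact sub_eq_zero.1 (enorm_eq_zero.1 hq)
  have hW := hH₁.unique (hH₂.congr hHe.symm (EventuallyEq.refl _ _))
  rw [EventuallyEq, ae_restrict_iff' measurableSet_slab]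
  filter_upwards [measurePreserving_flow.quasiMeasurePreserving.ae hW] with X hX hXs
  rw [lift_flow, lift_flow, Set.indicator_of_mem hXs, Set.indicator_of_mem hXs] at hX
  exact_mod_cast hX

/-- Elliptic coefficients agree almost everywhere with Borel measurable elliptic coefficients. -/
theorem IsElliptic.exists_measurable (hδ₀ : 0 < δ) (hδ₁ : δ < 1) (ha : IsElliptic δ a) :
    ∃ a' : ℝ → Matrix (Fin d) (Fin d) ℝ, IsElliptic δ a' ∧
      (∀ i j, Measurable fun t => a' t i j) ∧ ∀ᵐ t, a t = a' t := by
  classical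
  have hae : ∀ᵐ t, ∀ i j, a t i j = (ha.measurable i j).mk _ t :=
    ae_all_iff.2 fun i => ae_all_iff.2 fun j => (ha.measurable i j).ae_eq_mk
  set N := toMeasurable volume {t | ¬∀ i j, a t i j = (ha.measurable i j).mk _ t} with hN
  have hNm : MeasurableSet N := measurableSet_toMeasurable _ _
  have hN0 : volume N = 0 := by rw [hN, measure_toMeasurable]; exact hae
  have hNe : ∀ t, t ∉ N → ∀ i j, a t i j = (ha.measurable i j).mk _ t := fun t ht => by
    by_contra h
    exact ht (subset_toMeasurable _ _ h)
  obtain ⟨K, hK⟩ := ha.bounded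
  have hone : ∀ ξ : E d, ∑ i, ∑ j, (1 : Matrix (Fin d) (Fin d) ℝ) i j * ξ i * ξ j = ‖ξ‖ ^ 2 := by
    intro ξ
    rw [EuclideanSpace.norm_sq_eq]
    refine Finset.sum_congr rfl fun i _ => ?_
    simp [Matrix.one_apply, pow_two]
  -- On the exceptional null set the identity matrix is used; it satisfies both ellipticity bounds
  -- because δ < 1 < δ⁻¹.
  refine ⟨fun t => if t ∈ N then 1 else a t, ⟨?_, ?_, ?_, ?_⟩, ?_, ?_⟩
  rotate_left 4
  · intro i j
    have : (fun t => (if t ∈ N then (1 : Matrix (Fin d) (Fin d) ℝ) else a t) i j) =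
        fun t => if t ∈ N then (1 : Matrix (Fin d) (Fin d) ℝ) i j
          else (ha.measurable i j).mk _ t := by
      ext t
      by_cases ht : t ∈ N
      · simp [ht]
      · simp only [ht, if_false]
        exact hNe t ht i j
    rw [this]
    exact Measurable.ite hNm measurable_const (ha.measurable i j).measurable_mk
  · filter_upwards [measure_eq_zero_iff_ae_notMem.1 hN0] with t ht
    simp [ht]
  · intro i j
    refine (ha.measurable i j).congr ?_
    filter_upwards [measure_eq_zero_iff_ae_notMem.1 hN0] with t ht
    simp [ht]
  · refine ⟨max K 1, fun t i j => ?_⟩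
    by_cases ht : t ∈ N
    · simp only [ht, if_true]
      refine le_trans ?_ (le_max_right _ _)
      by_cases hij : i = j <;> simp [Matrix.one_apply, hij]
    · simp only [ht, if_false]
      exact (hK t i j).trans (le_max_left _ _)
  · intro t ξ
    by_cases ht : t ∈ N
    · simp only [ht, if_true]
      rw [hone]
      nlinarith [sq_nonneg ‖ξ‖]
    · simp only [ht, if_false]
      exact ha.lower t ξ
  · intro t ξ
    by_cases ht : t ∈ N
    · simp only [ht, if_true]
      rw [hone]
      have : 1 ≤ δ⁻¹ := (one_le_inv₀ hδ₀).2 hδ₁.le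
      nlinarith [sq_nonneg ‖ξ‖]
    · simp only [ht, if_false]
      exact ha.upper t ξ

theorem IsCauchySolution.congr_coeff {a a' : ℝ → Matrix (Fin d) (Fin d) ℝ}
    (h : ∀ᵐ t, a t = a' t) {f u : Pt d → ℝ} (hu : IsCauchySolution a S T f u) :
    IsCauchySolution a' S T f u := by
  refine ⟨hu.memS2, ?_, hu.initial⟩
  obtain ⟨D, g, hD, hg, he⟩ := hu.equation
  refine ⟨D, g, hD, hg, ?_⟩
  have h1 : ∀ᵐ X : Pt d, a X.1 = a' X.1 := by
    rw [Measure.volume_eq_prod]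
    exact Measure.quasiMeasurePreserving_fst.ae h
  filter_upwards [he, ae_restrict_of_ae h1] with X hX h2
  rw [← hX, h2]

end Uniqueness

end KFP

end


theorem corollary2p3 (d : ℕ) (δ : ℝ) (hδ₀ : 0 < δ) (hδ₁ : δ < 1) (τ : ℝ) (hτ : 0 < τ) :
    ∃ N : ℝ≥0, ∀ (S T : ℝ), T - S = τ →
      ∀ a : ℝ → Matrix (Fin d) (Fin d) ℝ, KFP.IsElliptic δ a →
      ∀ f : KFP.Pt d → ℝ, MemLp f 2 (volume.restrict (KFP.slab d S T)) →
      ∃ u : KFP.Pt d → ℝ,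
        KFP.IsCauchySolution a S T f u ∧
        (∀ v : KFP.Pt d → ℝ, KFP.IsCauchySolution a S T f v →
          v =ᵐ[volume.restrict (KFP.slab d S T)] u) ∧
        KFP.FullBound (KFP.slab d S T) u
          (N * eLpNorm f 2 (volume.restrict (KFP.slab d S T))) := by
  obtain ⟨N, hN⟩ := KFP.exists_solution d hδ₀ hτ
  refine ⟨N, fun S T hST a ha f hf => ?_⟩
  -- Joint measurability of the symbol requires Borel coefficients; changing them on a null set of
  -- times does not change which functions are solutions.
  obtain ⟨a', ha', ham', hae⟩ := ha.exists_measurable hδ₀ hδ₁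
  obtain ⟨u, hu, hb⟩ := hN S T hST a' ha' ham' f hf
  refine ⟨u, hu.congr_coeff (hae.mono fun t ht => ht.symm), fun v hv => ?_, hb⟩
  exact hu.unique hδ₀ ha' ham' (by linarith) hf (hv.congr_coeff hae)
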